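/- **One-phase Whitham equations of the Camassa–Holm equation in Riemann invariant form.** Let $\nu\in\mathbb R$ and consider the Camassa–Holm equation $\mathtt u_t+3\mathtt u\mathtt u_x=\mathtt u_{xxt}+2\mathtt u_x\mathtt u_{xx}+\mathtt u\mathtt u_{xxx}-2\nu\mathtt u_x$, whose Lagrangian density in the potential $\phi$, $\phi_x=\mathtt u$, is $\mathcal L=-\tfrac12\phi_x\phi_t+\tfrac12\phi_{xxx}\phi_t-\tfrac12\phi_x^3-\nu\phi_x^2+\tfrac14\phi_x^2\phi_{xxx}$. *Waves.* A one-phase wave is $\phi=\beta x-\gamma t+\Phi(\theta)$, $\theta=kx-\omega t$, $k>0$, where $\Phi$ has zero mean and minimal period $2\pi$ and $\mathtt u=\phi_x=\eta(\theta)=\beta+k\Phi_\theta$ solves the Camassa–Holm equation. With $c=\omega/k$ it satisfies $k^2(c-\eta)\eta_\theta^2+(2\nu-c)\eta^2+\eta^3+2B\eta-2A=0$ for constants $A,B$; let $e^1,e^2,e^3$ be the roots of $\eta^3+(2\nu-c)\eta^2+2B\eta-2A$, so that $c=2\nu+e^1+e^2+e^3$, and assume $c>e^1>e^2>e^3$.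 For all real $e^1,e^2,e^3$ with $2\nu+e^1+e^2+e^3>e^1>e^2>e^3$ and all $\gamma\in\mathbb R$ such a wave exists. *Modulation equations.* Let $\bar{\mathcal L}=\bar{\mathcal L}(k,\omega,\beta,\gamma)$ be the mean of $\mathcal L$ over a period of $\theta$ on the wave, let $\bar{\mathcal L}_k,\bar{\mathcal L}_\omega,\bar{\mathcal L}_\beta,\bar{\mathcal L}_\gamma$ be its derivatives, taken at fixed $\Phi$ (along families of waves, with $\gamma$ an arbitrary differentiable function of $e$, one has $d\bar{\mathcal L}=\bar{\mathcal L}_k\,dk+\bar{\mathcal L}_\omega\,d\omega+\bar{\mathcal L}_\beta\,d\beta+\bar{\mathcal L}_\gamma\,d\gamma$), and put $J=\bar{\mathcal L}_\omega$, $\mathcal H=\omega\bar{\mathcal L}_\omega+\gamma\bar{\mathcal L}_\gamma-\bar{\mathcal L}$. Then $(k,J,\beta)$ are local coordinates on the set of admissible $(e^1,e^2,e^3)$, and $\mathcal H$ is locally a $C^2$ function $\mathcal H(k,J,\beta)$ of them. The one-phase modulation equations, for slowly varying $(e^1,e^2,e^3)(x,t)$, are $$k_t=-\partial_x\mathcal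 H_J,\qquad J_t=-\partial_x\mathcal H_k,\qquad \beta_t=-\partial_x\mathcal H_\beta .$$ *Theorem.* Put $u^1=\tfrac12(e^2+e^3)$, $u^2=\tfrac12(e^1+e^3)$, $u^3=\tfrac12(e^1+e^2)$; then $-\nu<u^1<u^2<u^3$. The wave number and the frequency are $$k=2\pi\Big(\oint_a\frac{(\lambda+\nu)\,d\lambda}{\sqrt{R(\lambda)}}\Big)^{-1},\quad R(\lambda)=(\lambda+\nu)(\lambda-u^1)(\lambda-u^2)(\lambda-u^3),\qquad \omega=(2\nu+u^1+u^2+u^3)\,k,$$ where the cycle $a$ runs from $u^1$ to $u^2$ with $\sqrt R>0$ and back on the other sheet. These are differentiable functions of $\boldsymbol u=(u^1,u^2,u^3)$ on $-\nu<u^1<u^2<u^3$ with $\partial_{u^i}k\neq0$, and for differentiable admissible $(e^1,e^2,e^3)(x,t)$ on an open set of the $(x,t)$-plane the modulation equations are equivalent to $$\partial_tu^i+C^i(\boldsymbol u)\,\partial_xu^i=0,\qquad C^i(\boldsymbol u)=\frac{\partial_{u^i}\omega(\boldsymbol u)}{\partial_{u^i}k(\boldsymbol u)},\qquad i=1,2,3.$$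 -/

import Mathlib

open Filter Topology

noncomputable section

namespace CamassaHolm

/-! ### The equation and its one-phase waves -/

/-- Partial derivative in `x` of a function of `(x, t)`. -/
def dX (f : ℝ × ℝ → ℝ) (p : ℝ × ℝ) : ℝ := deriv (fun x => f (x, p.2)) p.1

/-- Partial derivative in `t` of a function of `(x, t)`. -/
def dT (f : ℝ × ℝ → ℝ) (p : ℝ × ℝ) : ℝ := deriv (fun t => f (p.1, t)) p.2

/-- The Camassa-Holm equation
`u_t + 3 u u_x = u_xxt + 2 u_x u_xx + u u_xxx - 2 ν u_x` on all of `ℝ²`. -/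
def SolvesCH (ν : ℝ) (u : ℝ × ℝ → ℝ) : Prop :=
  ∀ p : ℝ × ℝ, dT u p + 3 * u p * dX u p =
    dT (dX (dX u)) p + 2 * dX u p * dX (dX u) p + u p * dX (dX (dX u)) p - 2 * ν * dX u p

/-- The data of a potential `φ(x, t) = β x - γ t + Φ(k x - ω t)`. -/
structure WaveData where
  /-- wave number -/
  k : ℝ
  /-- frequency -/
  ω : ℝ
  /-- mean of `φ_x` -/
  β : ℝ
  /-- minus the mean of `φ_t` -/
  γ : ℝ
  /-- periodic part of the potential -/
  Φ : ℝ → ℝ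

/-- The profile `η` of the wave: `φ_x (x, t) = η (k x - ω t)`. -/
def WaveData.η (w : WaveData) (θ : ℝ) : ℝ := w.β + w.k * deriv w.Φ θ

/-- `w` is a one-phase wave of the Camassa-Holm equation whose integrated travelling wave equation
`k² (c - η) η'² + (2 ν - c) η² + η³ + 2 B η - 2 A = 0`, `c = ω / k`, has the cubic
`η³ + (2 ν - c) η² + 2 B η - 2 A` with roots `e 0, e 1, e 2`. -/
structure IsOnePhaseWave (ν : ℝ) (e : Fin 3 → ℝ) (w : WaveData) : Prop where
  k_pos : 0 < w.k
  contDiff : ContDiff ℝ 4 w.Φ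
  periodic : Function.Periodic w.Φ (2 * Real.pi)
  minimal : ∀ T, 0 < T → T < 2 * Real.pi → ¬ Function.Periodic w.Φ T
  mean_zero : ∫ θ in (0 : ℝ)..(2 * Real.pi), w.Φ θ = 0
  solves : SolvesCH ν (fun p => w.η (w.k * p.1 - w.ω * p.2))
  integrated : ∃ A B : ℝ,
    (∀ θ, w.k ^ 2 * (w.ω / w.k - w.η θ) * (deriv w.η θ) ^ 2
      + (2 * ν - w.ω / w.k) * w.η θ ^ 2 + w.η θ ^ 3 + 2 * B * w.η θ - 2 * A = 0) ∧
    (∀ z : ℝ, z ^ 3 + (2 * ν - w.ω / w.k) * z ^ 2 + 2 * B * z - 2 * A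
      = (z - e 0) * (z - e 1) * (z - e 2))

/-- The admissible roots: `c > e⁰ > e¹ > e²`, where `c = 2 ν + e⁰ + e¹ + e²`. -/
def rootDomain (ν : ℝ) : Set (Fin 3 → ℝ) :=
  {e | e 2 < e 1 ∧ e 1 < e 0 ∧ e 0 < 2 * ν + (e 0 + e 1 + e 2)}

/-! ### Lagrangian averaging -/

/-- The Lagrangian density of the Camassa-Holm equation in the potential `φ`, as a function of
`φ_x`, `φ_xxx` and `φ_t`. -/
def lagrangian (ν φx φxxx φt : ℝ) : ℝ :=
  -(1 / 2) * φx * φt + 1 / 2 * φxxx * φt - 1 / 2 * φx ^ 3 - ν * φx ^ 2 + 1 / 4 * φx ^ 2 * φxxx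

/-- The Lagrangian density on `φ = β x - γ t + Φ(θ)`, `θ = k x - ω t`, averaged over a period
of the phase `θ`. -/
def avgLagrangian (ν k ω β γ : ℝ) (Φ : ℝ → ℝ) : ℝ :=
  (2 * Real.pi)⁻¹ * ∫ θ in (0 : ℝ)..(2 * Real.pi),
    lagrangian ν (β + k * deriv Φ θ) (k ^ 3 * iteratedDeriv 3 Φ θ) (-γ - ω * deriv Φ θ)

namespace WaveData

/-- The averaged Lagrangian of a wave. -/
def avgL (ν : ℝ) (w : WaveData) : ℝ := avgLagrangian ν w.k w.ω w.β w.γ w.Φ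

/-- `∂ L̄ / ∂ k`; here and below the profile `Φ`, a critical point of `L̄`, is kept fixed. -/
def avgL_k (ν : ℝ) (w : WaveData) : ℝ :=
  deriv (fun k => avgLagrangian ν k w.ω w.β w.γ w.Φ) w.k

/-- `∂ L̄ / ∂ ω` -/
def avgL_ω (ν : ℝ) (w : WaveData) : ℝ :=
  deriv (fun ω => avgLagrangian ν w.k ω w.β w.γ w.Φ) w.ω

/-- `∂ L̄ / ∂ β` -/
def avgL_β (ν : ℝ) (w : WaveData) : ℝ :=
  deriv (fun β => avgLagrangian ν w.k w.ω β w.γ w.Φ) w.β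

/-- `∂ L̄ / ∂ γ` -/
def avgL_γ (ν : ℝ) (w : WaveData) : ℝ :=
  deriv (fun γ => avgLagrangian ν w.k w.ω w.β γ w.Φ) w.γ

/-- The Hamiltonian density `H = ω L̄_ω + γ L̄_γ - L̄`. -/
def hamiltonian (ν : ℝ) (w : WaveData) : ℝ :=
  w.ω * w.avgL_ω ν + w.γ * w.avgL_γ ν - w.avgL ν

/-- The field variables `(k, J, β)` with `J = L̄_ω`. -/
def coords (ν : ℝ) (w : WaveData) : ℝ × ℝ × ℝ := (w.k, w.avgL_ω ν, w.β)

end WaveData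

/-- `h` is the Hamiltonian density as a `C²` function of `(k, J, β)`, near the wave with
roots `e`, for the family of waves `W`. -/
def IsLocalHamiltonian (ν : ℝ) (W : (Fin 3 → ℝ) → WaveData) (e : Fin 3 → ℝ)
    (h : ℝ × ℝ × ℝ → ℝ) : Prop :=
  ContDiffAt ℝ 2 h ((W e).coords ν) ∧
    ∀ᶠ e' in 𝓝 e, h ((W e').coords ν) = (W e').hamiltonian ν

/-- The one-phase modulation equations
`k_t = -∂_x H_J`, `J_t = -∂_x H_k`, `β_t = -∂_x H_β`, `H = H(k, J, β)`, on `Ω`, for the slowly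
varying wave that at `(x, t)` is the member `W (e (x, t))` of the family `W`. -/
def SatisfiesModulation (ν : ℝ) (W : (Fin 3 → ℝ) → WaveData) (Ω : Set (ℝ × ℝ))
    (e : ℝ × ℝ → Fin 3 → ℝ) : Prop :=
  ∀ p ∈ Ω, ∃ h : ℝ × ℝ × ℝ → ℝ, IsLocalHamiltonian ν W (e p) h ∧
    dT (fun q => (W (e q)).k) p
      = -dX (fun q => fderiv ℝ h ((W (e q)).coords ν) (0, 1, 0)) p ∧
    dT (fun q => (W (e q)).avgL_ω ν) p
      = -dX (fun q => fderiv ℝ h ((W (e q)).coords ν) (1, 0, 0)) p ∧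
    dT (fun q => (W (e q)).β) p
      = -dX (fun q => fderiv ℝ h ((W (e q)).coords ν) (0, 0, 1)) p

/-! ### Riemann invariants and Abelian integrals -/

/-- The Riemann invariants as functions of the roots. -/
def riemann (e : Fin 3 → ℝ) : Fin 3 → ℝ :=
  ![(e 1 + e 2) / 2, (e 0 + e 2) / 2, (e 0 + e 1) / 2]

/-- The range of the Riemann invariants: `-ν < u⁰ < u¹ < u²`. -/
def riemannDomain (ν : ℝ) : Set (Fin 3 → ℝ) :=
  {u | -ν < u 0 ∧ u 0 < u 1 ∧ u 1 < u 2}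

/-- `R(z) = (z + ν) (z - u⁰) (z - u¹) (z - u²)` -/
def R (ν : ℝ) (u : Fin 3 → ℝ) (z : ℝ) : ℝ := (z + ν) * (z - u 0) * (z - u 1) * (z - u 2)

/-- The integral of `f(z) dz / √R(z)` over the cycle `a` of the curve `y² = R(z)`: from the branch
point `u⁰` to `u¹` on the sheet `y = √R(z)`, and back on the sheet `y = -√R(z)`. -/
def cycleIntegral (ν : ℝ) (u : Fin 3 → ℝ) (f : ℝ → ℝ) : ℝ :=
  (∫ z in (u 0)..(u 1), f z / √(R ν u z)) + ∫ z in (u 1)..(u 0), f z / (-√(R ν u z))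

/-- The wave number as a function of the Riemann invariants. -/
def waveNumber (ν : ℝ) (u : Fin 3 → ℝ) : ℝ :=
  2 * Real.pi * (cycleIntegral ν u (fun z => z + ν))⁻¹

/-- The frequency as a function of the Riemann invariants. -/
def frequency (ν : ℝ) (u : Fin 3 → ℝ) : ℝ := (2 * ν + u 0 + u 1 + u 2) * waveNumber ν u

/-- The partial derivative `∂ f / ∂ uⁱ`. -/
def pd (i : Fin 3) (f : (Fin 3 → ℝ) → ℝ) (u : Fin 3 → ℝ) : ℝ :=
  deriv (fun s => f (Function.update u i s)) (u i)

/-- The characteristic speeds `Cⁱ = ∂_i ω / ∂_i k`. -/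
def speed (ν : ℝ) (i : Fin 3) (u : Fin 3 → ℝ) : ℝ :=
  pd i (frequency ν) u / pd i (waveNumber ν) u

end CamassaHolm

end

open CamassaHolm

/-!
# One-phase modulation equations of the Camassa-Holm equation

In the travelling wave equation `(c - η) η_x ^ 2 = -∏ (η - eⁱ)` the substitution
`z = (c - η) / 2 - ν` turns the roots `e⁰, e¹` into the branch points `u⁰, u¹` of the curve
`y ^ 2 = R(z)`. On the cycle `z = (u⁰ + u¹) / 2 - (u¹ - u⁰) / 2 cos τ` everything is smooth in
`τ`: with `p = z + ν` and `q = u² - z` the position `x` along the wave satisfies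
`dx = √p / √q dτ`. Inverting this relation gives a model wave. Conversely, a one-phase wave
oscillates between `e¹` and `e⁰` and satisfies a regular second order equation, so by uniqueness
for ordinary differential equations (`eq_wave`) it is a translate of the model wave. Hence means
over the phase are means over the cycle (`IsOnePhaseWave.integral_comp_η`).

Let `A = e⁰ e¹ e² / 2`, `B = (e⁰ e¹ + e⁰ e² + e¹ e²) / 2`, let `c` be the phase velocity and `I`
the abbreviated action. The periods `X = 1 / k`, `Y = -β / k`, `Z = J + β ^ 2 / (2 k)` satisfy
`dI = X dA + Y dB + Z dc` (`fderiv_perI_eq`). Here `(∂_i A, ∂_i B, ∂_i c) = (Aᵢ, eⁱ, 1)` with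
`Aᵢ = gradA u i`. Modulo exact differentials on the cycle, the derivatives with respect to `uⁱ` of
the integrands of `X`, `Y`, `Z` are proportional, which gives `∂_i Y = -eⁱ ∂_i X` and
`∂_i Z = Aᵢ ∂_i X` (`fderiv_perY_single`, `fderiv_perZ_single`); also `∂_i X ≠ 0`
(`fderiv_perX_single_ne_zero`).

Averaging the second order equation with weights `1` and `η - β` expresses the averaged Lagrangian
and its derivatives at fixed profile: `L̄_k = I - c J`, `L̄_ω = J`, `L̄_β = γ / 2 - c β + B`,
`L̄_γ = β / 2`, and `L̄ = β γ / 2 - c β ^ 2 / 2 + B β - A + k I`. With `dI` above this yields the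
formula for `dL̄` and `dH = (c J - I) dk + ω dJ + (c β - B) dβ`, whichever function `H (k, J, β)`
is chosen.

With `D = ∂_t + c ∂_x` the modulation equations then become `D X = X c_x`, `D Y = -X B_x`,
`D Z = X A_x`. By the relations between the periods these read `∑ rᵢ = 0`, `∑ eⁱ rᵢ = 0`,
`∑ Aᵢ rᵢ = 0` for `rᵢ = ∂_i X D uⁱ - X ∂_x uⁱ`, a system of Vandermonde type because the `eⁱ` are
distinct (`eq_zero_of_moments`). So they are equivalent to `rᵢ = 0`, that is, to transport of `uⁱ`
with speed `c - X / ∂_i X = ∂_i (c / X) / ∂_i (1 / X) = ∂_i ω / ∂_i k`. The same Vandermonde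
argument shows that `(k, J, β)` are local coordinates.
-/

namespace CamassaHolm

/-! ### Integrals depending smoothly on a parameter -/

section Parametric

universe v

theorem continuous_slice {E F : Type*} [TopologicalSpace E] [TopologicalSpace F]
    {U : Set E} {f : E → ℝ → F} (hf : ContinuousOn (Function.uncurry f) (U ×ˢ Set.univ))
    {u : E} (hu : u ∈ U) : Continuous (f u) := by
  have : Continuous (fun τ : ℝ => (u, τ)) := by fun_prop
  exact hf.comp_continuous this fun τ => ⟨hu, trivial⟩

variable {E F : Type v} [NormedAddCommGroup E] [NormedSpace ℝ E]
  [NormedAddCommGroup F] [NormedSpace ℝ F] {U : Set E} {f : E → ℝ → F}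

/-- The derivative in the parameter loses one degree of joint smoothness. -/
theorem contDiffOn_partial_fderiv {n : ℕ} (hU : IsOpen U)
    (hf : ContDiffOn ℝ (n + 1 : ℕ) (Function.uncurry f) (U ×ˢ Set.univ)) :
    ContDiffOn ℝ n (Function.uncurry fun u τ => fderiv ℝ (fun u' => f u' τ) u)
      (U ×ˢ Set.univ) := by
  have ho : IsOpen (U ×ˢ (Set.univ : Set ℝ)) := hU.prod isOpen_univ
  have h1 : ContDiffOn ℝ n (fun p : E × ℝ => (fderiv ℝ (Function.uncurry f) p).comp
      (ContinuousLinearMap.inl ℝ E ℝ)) (U ×ˢ Set.univ) := by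
    have := hf.fderiv_of_isOpen (m := (n : WithTop ℕ∞)) ho (by norm_cast)
    exact this.clm_comp contDiffOn_const
  refine h1.congr ?_
  rintro ⟨u, τ⟩ hp
  have hd : HasFDerivAt (Function.uncurry f) (fderiv ℝ (Function.uncurry f) (u, τ)) (u, τ) :=
    ((hf.contDiffAt (ho.mem_nhds hp)).differentiableAt (by simp)).hasFDerivAt
  have hi : HasFDerivAt (fun u' : E => (u', τ)) (ContinuousLinearMap.inl ℝ E ℝ) u :=
    hasFDerivAt_prodMk_left u τ
  exact (hd.comp u hi).fderiv

theorem differentiableAt_slice (hU : IsOpen U)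
    (hf : ContDiffOn ℝ 1 (Function.uncurry f) (U ×ˢ Set.univ)) {u : E} (hu : u ∈ U) (τ : ℝ) :
    DifferentiableAt ℝ (fun u' => f u' τ) u := by
  have hd : DifferentiableAt ℝ (Function.uncurry f) (u, τ) :=
    (hf.contDiffAt ((hU.prod isOpen_univ).mem_nhds ⟨hu, trivial⟩)).differentiableAt (by simp)
  exact hd.comp u (hasFDerivAt_prodMk_left (𝕜 := ℝ) u τ).differentiableAt

/-- Differentiation under the integral sign. -/
theorem hasFDerivAt_integral_param [ProperSpace E] (hU : IsOpen U)
    (hf : ContDiffOn ℝ 1 (Function.uncurry f) (U ×ˢ Set.univ)) {u : E} (hu : u ∈ U) (a b : ℝ) :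
    HasFDerivAt (fun u' => ∫ τ in a..b, f u' τ)
      (∫ τ in a..b, fderiv ℝ (fun u' => f u' τ) u) u := by
  have hDc := (contDiffOn_partial_fderiv (n := 0) hU (by simpa using hf)).continuousOn
  obtain ⟨ε, hε, hεU⟩ := Metric.nhds_basis_closedBall.mem_iff.1 (hU.mem_nhds hu)
  have hK : IsCompact (Metric.closedBall u ε ×ˢ Set.uIcc a b) :=
    (isCompact_closedBall u ε).prod isCompact_uIcc
  obtain ⟨C, hC⟩ := hK.exists_bound_of_continuousOn (f := Function.uncurry fun u τ =>
      fderiv ℝ (fun u' => f u' τ) u)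
    (hDc.mono (Set.prod_mono hεU (Set.subset_univ _)))
  refine intervalIntegral.hasFDerivAt_integral_of_dominated_of_fderiv_le (𝕜 := ℝ)
    (F := f) (F' := fun u τ => fderiv ℝ (fun u' => f u' τ) u) (bound := fun _ => C)
    (Metric.closedBall_mem_nhds u hε) ?_ ?_ ?_ ?_ ?_ ?_
  · filter_upwards [hU.mem_nhds hu] with x hx
    exact (continuous_slice hf.continuousOn hx).aestronglyMeasurable
  · exact (continuous_slice hf.continuousOn hu).intervalIntegrable _ _
  · exact (continuous_slice hDc hu).aestronglyMeasurable
  · exact Eventually.of_forall fun t ht x hx => hC (x, t) ⟨hx, Set.uIoc_subset_uIcc ht⟩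
  · exact intervalIntegrable_const
  · exact Eventually.of_forall fun t ht x hx =>
      (differentiableAt_slice hU hf (hεU hx) t).hasFDerivAt

/-- An integral over a compact interval is as smooth in a parameter as its integrand. -/
theorem contDiffOn_integral_param [ProperSpace E] {n : ℕ} (hU : IsOpen U)
    (hf : ContDiffOn ℝ n (Function.uncurry f) (U ×ˢ Set.univ)) (a b : ℝ) :
    ContDiffOn ℝ n (fun u => ∫ τ in a..b, f u τ) U := by
  induction n generalizing F with
  | zero =>
    simp only [Nat.cast_zero, contDiffOn_zero] at hf ⊢
    intro u hu
    refine ContinuousAt.continuousWithinAt ?_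
    obtain ⟨ε, hε, hεU⟩ := Metric.nhds_basis_closedBall.mem_iff.1 (hU.mem_nhds hu)
    have hK : IsCompact (Metric.closedBall u ε ×ˢ Set.uIcc a b) :=
      (isCompact_closedBall u ε).prod isCompact_uIcc
    obtain ⟨C, hC⟩ := hK.exists_bound_of_continuousOn
      (hf.mono (Set.prod_mono hεU (Set.subset_univ _)))
    refine intervalIntegral.continuousAt_of_dominated_interval (bound := fun _ => C) ?_ ?_ ?_ ?_
    · filter_upwards [hU.mem_nhds hu] with x hx
      exact (continuous_slice hf hx).aestronglyMeasurable
    · filter_upwards [Metric.closedBall_mem_nhds u hε] with x hx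
      exact Eventually.of_forall fun t ht => hC (x, t) ⟨hx, Set.uIoc_subset_uIcc ht⟩
    · exact intervalIntegrable_const
    · refine Eventually.of_forall fun t ht => ?_
      have h1 : ContinuousAt (Function.uncurry f) (u, t) :=
        hf.continuousAt ((hU.prod isOpen_univ).mem_nhds ⟨hu, trivial⟩)
      have h2 : ContinuousAt (fun u' : E => (u', t)) u := by fun_prop
      exact ContinuousAt.comp (g := Function.uncurry f) (f := fun u' : E => (u', t)) h1 h2
  | succ n ih =>
    have h1 : ContDiffOn ℝ 1 (Function.uncurry f) (U ×ˢ Set.univ) := hf.of_le (by norm_cast; omega)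
    rw [Nat.cast_succ, contDiffOn_succ_iff_fderiv_of_isOpen hU]
    refine ⟨fun u hu => (hasFDerivAt_integral_param hU h1 hu a b).differentiableAt
      |>.differentiableWithinAt, by simp, ?_⟩
    exact (ih (contDiffOn_partial_fderiv hU hf)).congr fun u hu =>
      (hasFDerivAt_integral_param hU h1 hu a b).fderiv

/-- Differentiation under the integral sign in a direction `v`, from the derivatives of the
integrand
along a line; these are continuous in the variable of integration. -/
theorem fderiv_integral_param_apply [ProperSpace E] [CompleteSpace F] (hU : IsOpen U)
    (hf : ContDiffOn ℝ 1 (Function.uncurry f) (U ×ˢ Set.univ)) {u : E} (hu : u ∈ U) (v : E)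
    {f' : ℝ → F} (hf' : ∀ τ, HasDerivAt (fun s : ℝ => f (u + s • v) τ) (f' τ) 0) (a b : ℝ) :
    fderiv ℝ (fun u' => ∫ τ in a..b, f u' τ) u v = ∫ τ in a..b, f' τ ∧ Continuous f' := by
  have hD := continuous_slice
    (contDiffOn_partial_fderiv (n := 0) hU (by simpa using hf)).continuousOn hu
  have h : (fun τ => fderiv ℝ (fun u' => f u' τ) u v) = f' := by
    funext τ
    have h1 : HasFDerivAt (fun u' => f u' τ) (fderiv ℝ (fun u' => f u' τ) u) (u + (0 : ℝ) • v) := by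
      simpa using (differentiableAt_slice hU hf hu τ).hasFDerivAt
    have h2 : HasDerivAt (fun s : ℝ => u + s • v) v 0 := by
      simpa using ((hasDerivAt_id (0 : ℝ)).smul_const v).const_add u
    exact (HasFDerivAt.comp_hasDerivAt (l := fun u' => f u' τ) 0 h1 h2).unique (hf' τ)
  constructor
  · rw [(hasFDerivAt_integral_param hU hf hu a b).fderiv,
      ContinuousLinearMap.intervalIntegral_apply (hD.intervalIntegrable _ _), ← h]
  · rw [← h]; exact hD.clm_apply continuous_const

end Parametric

/-! ### Period integrals over the cycle `a` -/

noncomputable section Periods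

/-- The point `z + ν` of the cycle `a`, where `z = (u⁰ + u¹) / 2 - (u¹ - u⁰) / 2 cos τ`. -/
def cycleP (ν : ℝ) (u : Fin 3 → ℝ) (τ : ℝ) : ℝ :=
  ν + (u 0 + u 1) / 2 - (u 1 - u 0) / 2 * Real.cos τ

/-- The distance `u² - z` from a point of the cycle `a` to the third branch point. -/
def cycleQ (ν : ℝ) (u : Fin 3 → ℝ) (τ : ℝ) : ℝ := u 2 + ν - cycleP ν u τ

/-- The phase velocity `c = 2 ν + u⁰ + u¹ + u²`. -/
def phaseVel (ν : ℝ) (u : Fin 3 → ℝ) : ℝ := 2 * ν + u 0 + u 1 + u 2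

/-- The roots `eⁱ` in terms of the Riemann invariants. -/
def root (u : Fin 3 → ℝ) (i : Fin 3) : ℝ := u 0 + u 1 + u 2 - 2 * u i

/-- The value of the wave profile at the angle `τ` of the cycle `a`. -/
def profileAt (ν : ℝ) (u : Fin 3 → ℝ) (τ : ℝ) : ℝ := phaseVel ν u - 2 * cycleP ν u τ

/-- The integrand of `perX`: the derivative of the position `x` with respect to the angle `τ`. -/
def densX (ν : ℝ) (u : Fin 3 → ℝ) (τ : ℝ) : ℝ := √(cycleP ν u τ) / √(cycleQ ν u τ)

/-- The integrand of `perY`, minus the velocity times `densX`. -/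
def densY (ν : ℝ) (u : Fin 3 → ℝ) (τ : ℝ) : ℝ :=
  -(phaseVel ν u - 2 * cycleP ν u τ) * (√(cycleP ν u τ) / √(cycleQ ν u τ))

/-- The integrand of `perZ`: with the velocity `η` as a function of the position `x`, it is
`(η_x ^ 2 + η ^ 2) / 2` times `densX`. -/
def densZ (ν : ℝ) (u : Fin 3 → ℝ) (τ : ℝ) : ℝ :=
  1 / 2 * ((u 1 - u 0) ^ 2 * (1 - Real.cos τ ^ 2) * (√(cycleQ ν u τ) / √(cycleP ν u τ))
    + (phaseVel ν u - 2 * cycleP ν u τ) ^ 2 * (√(cycleP ν u τ) / √(cycleQ ν u τ)))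

/-- The integrand of `perI`: with the velocity `η` as a function of the position `x`, it is
`(c - η) η_x ^ 2` times `densX`. -/
def densI (ν : ℝ) (u : Fin 3 → ℝ) (τ : ℝ) : ℝ :=
  2 * (u 1 - u 0) ^ 2 * (1 - Real.cos τ ^ 2) * (√(cycleP ν u τ) * √(cycleQ ν u τ))

/-- `X = ∂I/∂A = 1 / k`, the wave length divided by `2π`. -/
def perX (ν : ℝ) (u : Fin 3 → ℝ) : ℝ := (2 * Real.pi)⁻¹ * ∫ τ in (0 : ℝ)..(2 * Real.pi), densX ν u τ

/-- `Y = ∂I/∂B = -β / k`. -/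
def perY (ν : ℝ) (u : Fin 3 → ℝ) : ℝ := (2 * Real.pi)⁻¹ * ∫ τ in (0 : ℝ)..(2 * Real.pi), densY ν u τ

/-- `Z = ∂I/∂c = J + β ^ 2 / (2 k)`. -/
def perZ (ν : ℝ) (u : Fin 3 → ℝ) : ℝ := (2 * Real.pi)⁻¹ * ∫ τ in (0 : ℝ)..(2 * Real.pi), densZ ν u τ

/-- The abbreviated action `I = (2π)⁻¹ ∮ (c - η) η_x dη`, a function of the constants `A`, `B` and
the phase velocity `c` in the first integral `(c - η) η_x ^ 2 = -∏ (η - eⁱ)`. -/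
def perI (ν : ℝ) (u : Fin 3 → ℝ) : ℝ := (2 * Real.pi)⁻¹ * ∫ τ in (0 : ℝ)..(2 * Real.pi), densI ν u τ

variable {ν : ℝ} {u : Fin 3 → ℝ}

theorem isOpen_riemannDomain (ν : ℝ) : IsOpen (riemannDomain ν) := by
  have h1 : IsOpen {u : Fin 3 → ℝ | -ν < u 0} := isOpen_lt (by fun_prop) (by fun_prop)
  have h2 : IsOpen {u : Fin 3 → ℝ | u 0 < u 1} := isOpen_lt (by fun_prop) (by fun_prop)
  have h3 : IsOpen {u : Fin 3 → ℝ | u 1 < u 2} := isOpen_lt (by fun_prop) (by fun_prop)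
  exact h1.inter (h2.inter h3)

theorem cycleP_pos (hu : u ∈ riemannDomain ν) (τ : ℝ) : 0 < cycleP ν u τ := by
  obtain ⟨h1, h2, h3⟩ := hu
  unfold cycleP
  nlinarith [Real.cos_le_one τ, Real.neg_one_le_cos τ]

theorem cycleQ_pos (hu : u ∈ riemannDomain ν) (τ : ℝ) : 0 < cycleQ ν u τ := by
  obtain ⟨h1, h2, h3⟩ := hu
  unfold cycleQ cycleP
  nlinarith [Real.cos_le_one τ, Real.neg_one_le_cos τ]

theorem contDiff_cycleP (ν : ℝ) {n : WithTop ℕ∞} :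
    ContDiff ℝ n (Function.uncurry (cycleP ν)) := by
  unfold Function.uncurry cycleP; fun_prop

theorem contDiff_cycleQ (ν : ℝ) {n : WithTop ℕ∞} :
    ContDiff ℝ n (Function.uncurry (cycleQ ν)) := by
  unfold Function.uncurry cycleQ cycleP; fun_prop

theorem contDiffOn_sqrtP (ν : ℝ) {n : WithTop ℕ∞} :
    ContDiffOn ℝ n (fun x : (Fin 3 → ℝ) × ℝ => √(cycleP ν x.1 x.2))
      (riemannDomain ν ×ˢ Set.univ) :=
  (contDiff_cycleP ν).contDiffOn.sqrt fun x hx => (cycleP_pos hx.1 x.2).ne'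

theorem contDiffOn_sqrtQ (ν : ℝ) {n : WithTop ℕ∞} :
    ContDiffOn ℝ n (fun x : (Fin 3 → ℝ) × ℝ => √(cycleQ ν x.1 x.2))
      (riemannDomain ν ×ˢ Set.univ) :=
  (contDiff_cycleQ ν).contDiffOn.sqrt fun x hx => (cycleQ_pos hx.1 x.2).ne'

theorem contDiffOn_densX (ν : ℝ) {n : WithTop ℕ∞} :
    ContDiffOn ℝ n (Function.uncurry (densX ν)) (riemannDomain ν ×ˢ Set.univ) :=
  (contDiffOn_sqrtP ν).div (contDiffOn_sqrtQ ν) fun x hx =>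
    (Real.sqrt_pos.2 (cycleQ_pos hx.1 x.2)).ne'

theorem contDiff_profile (ν : ℝ) {n : WithTop ℕ∞} :
    ContDiff ℝ n (fun x : (Fin 3 → ℝ) × ℝ => phaseVel ν x.1 - 2 * cycleP ν x.1 x.2) := by
  unfold phaseVel cycleP; fun_prop

theorem contDiffOn_densY (ν : ℝ) {n : WithTop ℕ∞} :
    ContDiffOn ℝ n (Function.uncurry (densY ν)) (riemannDomain ν ×ˢ Set.univ) :=
  (contDiff_profile ν).neg.contDiffOn.mul (contDiffOn_densX ν)

theorem contDiffOn_densZ (ν : ℝ) {n : WithTop ℕ∞} :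
    ContDiffOn ℝ n (Function.uncurry (densZ ν)) (riemannDomain ν ×ˢ Set.univ) := by
  have h1 : ContDiff ℝ n (fun x : (Fin 3 → ℝ) × ℝ =>
      (x.1 1 - x.1 0) ^ 2 * (1 - Real.cos x.2 ^ 2)) := by fun_prop
  have h2 := (contDiffOn_sqrtQ ν (n := n)).div (contDiffOn_sqrtP ν) fun x hx =>
    (Real.sqrt_pos.2 (cycleP_pos hx.1 x.2)).ne'
  exact contDiffOn_const.mul ((h1.contDiffOn.mul h2).add
    (((contDiff_profile ν).pow 2).contDiffOn.mul (contDiffOn_densX ν)))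

theorem contDiffOn_densI (ν : ℝ) {n : WithTop ℕ∞} :
    ContDiffOn ℝ n (Function.uncurry (densI ν)) (riemannDomain ν ×ˢ Set.univ) := by
  have h1 : ContDiff ℝ n (fun x : (Fin 3 → ℝ) × ℝ =>
      2 * (x.1 1 - x.1 0) ^ 2 * (1 - Real.cos x.2 ^ 2)) := by fun_prop
  exact h1.contDiffOn.mul ((contDiffOn_sqrtP ν).mul (contDiffOn_sqrtQ ν))

theorem contDiffOn_perX (ν : ℝ) : ContDiffOn ℝ 2 (perX ν) (riemannDomain ν) :=
  contDiffOn_const.mul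
    (contDiffOn_integral_param (n := 2) (isOpen_riemannDomain ν) (contDiffOn_densX ν) _ _)

theorem contDiffOn_perY (ν : ℝ) : ContDiffOn ℝ 2 (perY ν) (riemannDomain ν) :=
  contDiffOn_const.mul
    (contDiffOn_integral_param (n := 2) (isOpen_riemannDomain ν) (contDiffOn_densY ν) _ _)

theorem contDiffOn_perZ (ν : ℝ) : ContDiffOn ℝ 2 (perZ ν) (riemannDomain ν) :=
  contDiffOn_const.mul
    (contDiffOn_integral_param (n := 2) (isOpen_riemannDomain ν) (contDiffOn_densZ ν) _ _)

theorem contDiffOn_perI (ν : ℝ) : ContDiffOn ℝ 2 (perI ν) (riemannDomain ν) :=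
  contDiffOn_const.mul
    (contDiffOn_integral_param (n := 2) (isOpen_riemannDomain ν) (contDiffOn_densI ν) _ _)

theorem perX_pos (hu : u ∈ riemannDomain ν) : 0 < perX ν u := by
  refine mul_pos (by positivity)
      (intervalIntegral.intervalIntegral_pos_of_pos ?_ ?_ (by positivity))
  · exact (continuous_slice (contDiffOn_densX ν (n := 0)).continuousOn hu).intervalIntegrable _ _
  · exact fun τ => div_pos (Real.sqrt_pos.2 (cycleP_pos hu τ)) (Real.sqrt_pos.2 (cycleQ_pos hu τ))

/-- The derivative of `cycleP` in the direction `v`, at fixed angle. -/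
def dirP (v : Fin 3 → ℝ) (τ : ℝ) : ℝ := (v 0 + v 1) / 2 - (v 1 - v 0) / 2 * Real.cos τ

theorem hasDerivAt_coord (u v : Fin 3 → ℝ) (i : Fin 3) :
    HasDerivAt (fun σ : ℝ => (u + σ • v) i) (v i) 0 := by
  simpa using ((hasDerivAt_id (0 : ℝ)).mul_const (v i)).const_add (u i)

theorem hasDerivAt_line_P (ν : ℝ) (u v : Fin 3 → ℝ) (τ : ℝ) :
    HasDerivAt (fun σ : ℝ => cycleP ν (u + σ • v) τ) (dirP v τ) 0 := by
  have h := fun i => hasDerivAt_coord u v i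
  exact ((((h 0).add (h 1)).div_const 2).const_add ν).sub
    ((((h 1).sub (h 0)).div_const 2).mul_const (Real.cos τ))

theorem hasDerivAt_line_Q (ν : ℝ) (u v : Fin 3 → ℝ) (τ : ℝ) :
    HasDerivAt (fun σ : ℝ => cycleQ ν (u + σ • v) τ) (v 2 - dirP v τ) 0 :=
  ((hasDerivAt_coord u v 2).add_const ν).sub (hasDerivAt_line_P ν u v τ)

theorem hasDerivAt_line_sqrtP (hu : u ∈ riemannDomain ν) (v : Fin 3 → ℝ) (τ : ℝ) :
    HasDerivAt (fun σ : ℝ => √(cycleP ν (u + σ • v) τ)) (dirP v τ / (2 * √(cycleP ν u τ))) 0 := by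
  simpa using (hasDerivAt_line_P ν u v τ).sqrt (by simpa using (cycleP_pos hu τ).ne')

theorem hasDerivAt_line_sqrtQ (hu : u ∈ riemannDomain ν) (v : Fin 3 → ℝ) (τ : ℝ) :
    HasDerivAt (fun σ : ℝ => √(cycleQ ν (u + σ • v) τ))
      ((v 2 - dirP v τ) / (2 * √(cycleQ ν u τ))) 0 := by
  simpa using (hasDerivAt_line_Q ν u v τ).sqrt (by simpa using (cycleQ_pos hu τ).ne')

theorem hasDerivAt_line_phaseVel (ν : ℝ) (u v : Fin 3 → ℝ) :
    HasDerivAt (fun σ : ℝ => phaseVel ν (u + σ • v)) (v 0 + v 1 + v 2) 0 :=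
  (((hasDerivAt_coord u v 0).const_add (2 * ν)).add (hasDerivAt_coord u v 1)).add
    (hasDerivAt_coord u v 2)

/-- The derivative of `s / t` for `s ^ 2 = p`, `t ^ 2 = q`, in terms of those of `p` and `q`. -/
def quotDeriv (s t p' q' : ℝ) : ℝ := (p' / (2 * s) * t - s * (q' / (2 * t))) / t ^ 2

/-- The derivative of `densX` in the direction `v`, at fixed angle. -/
def dirX (ν : ℝ) (u v : Fin 3 → ℝ) (τ : ℝ) : ℝ :=
  quotDeriv √(cycleP ν u τ) √(cycleQ ν u τ) (dirP v τ) (v 2 - dirP v τ)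

theorem hasDerivAt_line_densX (hu : u ∈ riemannDomain ν) (v : Fin 3 → ℝ) (τ : ℝ) :
    HasDerivAt (fun σ : ℝ => densX ν (u + σ • v) τ) (dirX ν u v τ) 0 := by
  have h := (hasDerivAt_line_sqrtP hu v τ).div (hasDerivAt_line_sqrtQ hu v τ)
    (by simpa using (Real.sqrt_pos.2 (cycleQ_pos hu τ)).ne')
  exact HasDerivAt.congr_deriv h (by simp [dirX, quotDeriv])

theorem hasDerivAt_line_densX_inv (hu : u ∈ riemannDomain ν) (v : Fin 3 → ℝ) (τ : ℝ) :
    HasDerivAt (fun σ : ℝ => √(cycleQ ν (u + σ • v) τ) / √(cycleP ν (u + σ • v) τ))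
      (quotDeriv √(cycleQ ν u τ) √(cycleP ν u τ) (v 2 - dirP v τ) (dirP v τ)) 0 := by
  have h := (hasDerivAt_line_sqrtQ hu v τ).div (hasDerivAt_line_sqrtP hu v τ)
    (by simpa using (Real.sqrt_pos.2 (cycleP_pos hu τ)).ne')
  exact HasDerivAt.congr_deriv h (by simp [quotDeriv])

theorem hasDerivAt_line_profile (ν : ℝ) (u v : Fin 3 → ℝ) (τ : ℝ) :
    HasDerivAt (fun σ : ℝ => phaseVel ν (u + σ • v) - 2 * cycleP ν (u + σ • v) τ)
      (v 0 + v 1 + v 2 - 2 * dirP v τ) 0 :=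
  (hasDerivAt_line_phaseVel ν u v).sub ((hasDerivAt_line_P ν u v τ).const_mul 2)

/-- The derivative of `densY` in the direction `v`, at fixed angle. -/
def dirY (ν : ℝ) (u v : Fin 3 → ℝ) (τ : ℝ) : ℝ :=
  -(v 0 + v 1 + v 2 - 2 * dirP v τ) * (√(cycleP ν u τ) / √(cycleQ ν u τ))
        + -(phaseVel ν u - 2 * cycleP ν u τ) *
          quotDeriv √(cycleP ν u τ) √(cycleQ ν u τ) (dirP v τ) (v 2 - dirP v τ)

theorem hasDerivAt_line_densY (hu : u ∈ riemannDomain ν) (v : Fin 3 → ℝ) (τ : ℝ) :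
    HasDerivAt (fun σ : ℝ => densY ν (u + σ • v) τ) (dirY ν u v τ) 0 := by
  have h := (hasDerivAt_line_profile ν u v τ).neg.mul (hasDerivAt_line_densX hu v τ)
  exact HasDerivAt.congr_deriv h (by simp [densX, dirX, dirY])

/-- The derivative of `densZ` in the direction `v`, at fixed angle. -/
def dirZ (ν : ℝ) (u v : Fin 3 → ℝ) (τ : ℝ) : ℝ :=
  1 / 2 * (2 * (u 1 - u 0) * (v 1 - v 0) * (1 - Real.cos τ ^ 2)
          * (√(cycleQ ν u τ) / √(cycleP ν u τ))
        + (u 1 - u 0) ^ 2 * (1 - Real.cos τ ^ 2) *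
          quotDeriv √(cycleQ ν u τ) √(cycleP ν u τ) (v 2 - dirP v τ) (dirP v τ)
        + (2 * (phaseVel ν u - 2 * cycleP ν u τ) * (v 0 + v 1 + v 2 - 2 * dirP v τ)
            * (√(cycleP ν u τ) / √(cycleQ ν u τ))
          + (phaseVel ν u - 2 * cycleP ν u τ) ^ 2 *
            quotDeriv √(cycleP ν u τ) √(cycleQ ν u τ) (dirP v τ) (v 2 - dirP v τ)))

theorem hasDerivAt_line_densZ (hu : u ∈ riemannDomain ν) (v : Fin 3 → ℝ) (τ : ℝ) :
    HasDerivAt (fun σ : ℝ => densZ ν (u + σ • v) τ) (dirZ ν u v τ) 0 := by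
  have h1 := ((((hasDerivAt_coord u v 1).sub (hasDerivAt_coord u v 0)).pow 2).mul_const
    (1 - Real.cos τ ^ 2)).mul (hasDerivAt_line_densX_inv hu v τ)
  have h2 := ((hasDerivAt_line_profile ν u v τ).pow 2).mul (hasDerivAt_line_densX hu v τ)
  exact HasDerivAt.congr_deriv ((h1.add h2).const_mul (1 / 2)) (by simp [densX, dirX, dirZ])

/-- The derivative of `densI` in the direction `v`, at fixed angle. -/
def dirI (ν : ℝ) (u v : Fin 3 → ℝ) (τ : ℝ) : ℝ :=
  2 * (2 * (u 1 - u 0) * (v 1 - v 0)) * (1 - Real.cos τ ^ 2)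
          * (√(cycleP ν u τ) * √(cycleQ ν u τ))
        + 2 * (u 1 - u 0) ^ 2 * (1 - Real.cos τ ^ 2) *
          (dirP v τ / (2 * √(cycleP ν u τ)) * √(cycleQ ν u τ)
            + √(cycleP ν u τ) * ((v 2 - dirP v τ) / (2 * √(cycleQ ν u τ))))

theorem hasDerivAt_line_densI (hu : u ∈ riemannDomain ν) (v : Fin 3 → ℝ) (τ : ℝ) :
    HasDerivAt (fun σ : ℝ => densI ν (u + σ • v) τ) (dirI ν u v τ) 0 := by
  have h1 :=
      (((((hasDerivAt_coord u v 1).sub (hasDerivAt_coord u v 0)).pow 2).const_mul 2).mul_const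
    (1 - Real.cos τ ^ 2)).mul ((hasDerivAt_line_sqrtP hu v τ).mul (hasDerivAt_line_sqrtQ hu v τ))
  exact HasDerivAt.congr_deriv h1 (by simp [dirI])

end Periods

/-! ### Relations between the derivatives of the periods -/

noncomputable section Relations

variable {ν : ℝ} {u : Fin 3 → ℝ}

/-- The partial derivatives of `A = e⁰ e¹ e² / 2` in the Riemann invariants. -/
def gradA (u : Fin 3 → ℝ) (i : Fin 3) : ℝ :=
  root u i * (root u 0 + root u 1 + root u 2 - root u i)
    - (root u 0 * root u 1 + root u 0 * root u 2 + root u 1 * root u 2) / 2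

theorem hasDerivAt_angle_P (ν : ℝ) (u : Fin 3 → ℝ) (τ : ℝ) :
    HasDerivAt (cycleP ν u) (Real.sin τ * ((u 1 - u 0) / 2)) τ := by
  have h := ((Real.hasDerivAt_cos τ).const_mul ((u 1 - u 0) / 2)).const_sub (ν + (u 0 + u 1) / 2)
  exact h.congr_deriv (by ring)

theorem hasDerivAt_angle_Q (ν : ℝ) (u : Fin 3 → ℝ) (τ : ℝ) :
    HasDerivAt (cycleQ ν u) (Real.sin τ * -((u 1 - u 0) / 2)) τ :=
  ((hasDerivAt_angle_P ν u τ).const_sub (u 2 + ν)).congr_deriv (by ring)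

theorem hasDerivAt_angle_sqrtP (hu : u ∈ riemannDomain ν) (τ : ℝ) :
    HasDerivAt (fun τ => √(cycleP ν u τ))
      (Real.sin τ * ((u 1 - u 0) / 2 / (2 * √(cycleP ν u τ)))) τ :=
  ((hasDerivAt_angle_P ν u τ).sqrt (cycleP_pos hu τ).ne').congr_deriv (by ring)

theorem hasDerivAt_angle_sqrtQ (hu : u ∈ riemannDomain ν) (τ : ℝ) :
    HasDerivAt (fun τ => √(cycleQ ν u τ))
      (Real.sin τ * (-((u 1 - u 0) / 2) / (2 * √(cycleQ ν u τ)))) τ :=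
  ((hasDerivAt_angle_Q ν u τ).sqrt (cycleQ_pos hu τ).ne').congr_deriv (by ring)

theorem hasDerivAt_sin_mul {K : ℝ → ℝ} {L τ : ℝ} (h : HasDerivAt K (Real.sin τ * L) τ) :
    HasDerivAt (fun τ => Real.sin τ * K τ) (Real.cos τ * K τ + (1 - Real.cos τ ^ 2) * L) τ :=
  ((Real.hasDerivAt_sin τ).mul h).congr_deriv (by rw [← Real.sin_sq]; ring)

theorem hasDerivAt_angle_quot (hu : u ∈ riemannDomain ν) (τ : ℝ) :
    HasDerivAt (densX ν u) (Real.sin τ * quotDeriv √(cycleP ν u τ) √(cycleQ ν u τ)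
      ((u 1 - u 0) / 2) (-((u 1 - u 0) / 2))) τ :=
  HasDerivAt.congr_deriv ((hasDerivAt_angle_sqrtP hu τ).div (hasDerivAt_angle_sqrtQ hu τ)
    (Real.sqrt_pos.2 (cycleQ_pos hu τ)).ne') (by unfold quotDeriv; ring)

theorem hasDerivAt_angle_prod (hu : u ∈ riemannDomain ν) (τ : ℝ) :
    HasDerivAt (fun τ => √(cycleP ν u τ) * √(cycleQ ν u τ))
      (Real.sin τ * ((u 1 - u 0) / 2 / (2 * √(cycleP ν u τ)) * √(cycleQ ν u τ)
        + √(cycleP ν u τ) * (-((u 1 - u 0) / 2) / (2 * √(cycleQ ν u τ))))) τ :=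
  HasDerivAt.congr_deriv ((hasDerivAt_angle_sqrtP hu τ).mul (hasDerivAt_angle_sqrtQ hu τ)) (by ring)

/-- Integrands that are cohomologous up to a factor have proportional periods. -/
theorem integral_eq_of_exact {K f g : ℝ → ℝ} {κ : ℝ}
    (h : ∀ τ, HasDerivAt (fun τ => Real.sin τ * K τ) (f τ - κ * g τ) τ) (hf : Continuous f)
    (hg : Continuous g) :
    ∫ τ in (0 : ℝ)..(2 * Real.pi), f τ = κ * ∫ τ in (0 : ℝ)..(2 * Real.pi), g τ := by
  have hi := fun (f : ℝ → ℝ) (hf : Continuous f) =>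
    hf.intervalIntegrable (μ := MeasureTheory.volume) 0 (2 * Real.pi)
  have h0 := intervalIntegral.integral_eq_sub_of_hasDerivAt (fun τ _ => h τ)
    (hi _ (hf.sub (hg.const_mul κ)))
  rw [intervalIntegral.integral_sub (hi f hf) (hi _ (hg.const_mul κ)),
    intervalIntegral.integral_const_mul] at h0
  simpa [sub_eq_zero] using h0

theorem fderiv_mean_apply {f : (Fin 3 → ℝ) → ℝ → ℝ}
    (hf : ContDiffOn ℝ 1 (Function.uncurry f) (riemannDomain ν ×ˢ Set.univ))
    (hu : u ∈ riemannDomain ν) (v : Fin 3 → ℝ) {f' : ℝ → ℝ}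
    (hf' : ∀ τ, HasDerivAt (fun s : ℝ => f (u + s • v) τ) (f' τ) 0) :
    fderiv ℝ (fun u => (2 * Real.pi)⁻¹ * ∫ τ in (0 : ℝ)..(2 * Real.pi), f u τ) u v
      = (2 * Real.pi)⁻¹ * ∫ τ in (0 : ℝ)..(2 * Real.pi), f' τ ∧ Continuous f' := by
  obtain ⟨h1, h2⟩ := fderiv_integral_param_apply (isOpen_riemannDomain ν) hf hu v hf' 0 (2
      * Real.pi)
  refine ⟨?_, h2⟩
  rw [fderiv_const_mul (hasFDerivAt_integral_param (isOpen_riemannDomain ν)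
      hf hu _ _).differentiableAt]
  simp [h1]

theorem fderiv_perX (hu : u ∈ riemannDomain ν) (v : Fin 3 → ℝ) :
    fderiv ℝ (perX ν) u v = (2 * Real.pi)⁻¹ * ∫ τ in (0 : ℝ)..(2 * Real.pi), dirX ν u v τ ∧
      Continuous (dirX ν u v) :=
  fderiv_mean_apply (contDiffOn_densX ν) hu v (hasDerivAt_line_densX hu v)

theorem fderiv_perY (hu : u ∈ riemannDomain ν) (v : Fin 3 → ℝ) :
    fderiv ℝ (perY ν) u v = (2 * Real.pi)⁻¹ * ∫ τ in (0 : ℝ)..(2 * Real.pi), dirY ν u v τ ∧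
      Continuous (dirY ν u v) :=
  fderiv_mean_apply (contDiffOn_densY ν) hu v (hasDerivAt_line_densY hu v)

theorem fderiv_perZ (hu : u ∈ riemannDomain ν) (v : Fin 3 → ℝ) :
    fderiv ℝ (perZ ν) u v = (2 * Real.pi)⁻¹ * ∫ τ in (0 : ℝ)..(2 * Real.pi), dirZ ν u v τ ∧
      Continuous (dirZ ν u v) :=
  fderiv_mean_apply (contDiffOn_densZ ν) hu v (hasDerivAt_line_densZ hu v)

theorem fderiv_perI (hu : u ∈ riemannDomain ν) (v : Fin 3 → ℝ) :
    fderiv ℝ (perI ν) u v = (2 * Real.pi)⁻¹ * ∫ τ in (0 : ℝ)..(2 * Real.pi), dirI ν u v τ ∧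
      Continuous (dirI ν u v) :=
  fderiv_mean_apply (contDiffOn_densI ν) hu v (hasDerivAt_line_densI hu v)

/-- The coordinates `s = √p`, `t = √q` in which integrands at a given angle are rational. -/
theorem exists_sqrt_coords (hu : u ∈ riemannDomain ν) (τ : ℝ) :
    ∃ s t : ℝ, 0 < s ∧ 0 < t ∧ √(cycleP ν u τ) = s ∧ √(cycleQ ν u τ) = t ∧ cycleP ν u τ = s ^ 2 ∧
      ν = s ^ 2 - (u 0 + u 1) / 2 + (u 1 - u 0) / 2 * Real.cos τ ∧
      u 2 = t ^ 2 + (u 0 + u 1) / 2 - (u 1 - u 0) / 2 * Real.cos τ := by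
  refine ⟨_, _, Real.sqrt_pos.2 (cycleP_pos hu τ), Real.sqrt_pos.2 (cycleQ_pos hu τ), rfl, rfl, ?_⟩
  rw [Real.sq_sqrt (cycleP_pos hu τ).le, Real.sq_sqrt (cycleQ_pos hu τ).le]
  refine ⟨rfl, ?_, ?_⟩ <;> simp only [cycleQ, cycleP] <;> ring

/-- In each Riemann invariant the derivative of `β / k` is `eⁱ` times that of `1 / k`. -/
theorem fderiv_perY_single (hu : u ∈ riemannDomain ν) (i : Fin 3) :
    fderiv ℝ (perY ν) u (Pi.single i 1) = -root u i * fderiv ℝ (perX ν) u (Pi.single i 1) := by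
  obtain ⟨hX, cX⟩ := fderiv_perX hu (Pi.single i 1)
  obtain ⟨hY, cY⟩ := fderiv_perY hu (Pi.single i 1)
  -- `∂_i densY + eⁱ ∂_i densX` is the derivative of `sin τ √p / √q`, of its negative, or of `0`
  rw [hX, hY, mul_left_comm, integral_eq_of_exact
    (K := fun τ => (![1, -1, 0] : Fin 3 → ℝ) i * densX ν u τ) (κ := -root u i) ?_ cY cX]
  intro τ
  refine (hasDerivAt_sin_mul (((hasDerivAt_angle_quot hu τ).const_mul _).congr_deriv
    (mul_left_comm _ _ _))).congr_deriv ?_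
  obtain ⟨s, t, hs, ht, hs1, ht1, hp, hν, h2⟩ := exists_sqrt_coords hu τ
  fin_cases i <;> simp [dirX, dirY, dirP, quotDeriv, densX, root, phaseVel] <;> rw [hs1, ht1,
      hp] <;>
    rw [hν, h2] <;> field_simp <;> ring

/-- In each Riemann invariant the derivative of `Z = ∂I/∂c` is `∂A/∂uⁱ` times that of `1 / k`. -/
theorem fderiv_perZ_single (hu : u ∈ riemannDomain ν) (i : Fin 3) :
    fderiv ℝ (perZ ν) u (Pi.single i 1) = gradA u i * fderiv ℝ (perX ν) u (Pi.single i 1) := by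
  obtain ⟨hX, cX⟩ := fderiv_perX hu (Pi.single i 1)
  obtain ⟨hZ, cZ⟩ := fderiv_perZ hu (Pi.single i 1)
  have hp := hasDerivAt_angle_P ν u
  have hst := hasDerivAt_angle_prod hu
  have hst0 : ∀ τ, √(cycleP ν u τ) * √(cycleQ ν u τ) ≠ 0 := fun τ =>
    (mul_pos (Real.sqrt_pos.2 (cycleP_pos hu τ)) (Real.sqrt_pos.2 (cycleQ_pos hu τ))).ne'
  set D : ℝ → ℝ := fun τ => (u 1 - u 0) / 2 / (2 * √(cycleP ν u τ)) * √(cycleQ ν u τ)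
    + √(cycleP ν u τ) * (-((u 1 - u 0) / 2) / (2 * √(cycleQ ν u τ))) with hD
  set σ := u 0 + u 1 + 2 * u 2 + 3 * ν with hσ
  have key : ∀ α β γ τ : ℝ, HasDerivAt
      (fun τ => (α * cycleP ν u τ ^ 2 + β * cycleP ν u τ + γ) / (√(cycleP ν u τ) * √(cycleQ ν u τ)))
      (Real.sin τ * (((2 * α * cycleP ν u τ + β) * ((u 1 - u 0) / 2)
          * (√(cycleP ν u τ) * √(cycleQ ν u τ))
        - (α * cycleP ν u τ ^ 2 + β * cycleP ν u τ + γ) * D τ)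
          / (√(cycleP ν u τ) * √(cycleQ ν u τ)) ^ 2)) τ := fun α β γ τ => by
    have h := (((((hp τ).pow 2).const_mul α).add ((hp τ).const_mul β)).add_const γ).div (hst τ)
      (hst0 τ)
    refine HasDerivAt.congr_deriv h ?_
    simp only [Pi.add_apply, Pi.pow_apply, hD]
    ring
  -- the exact term is sought as `sin τ` times a quadratic polynomial in `p` over `√p √q`; comparing
  -- powers of `p` determines the coefficients
  rw [hX, hZ, mul_left_comm, integral_eq_of_exact (K := fun τ =>
    ((![2, -2, 0] : Fin 3 → ℝ) i * cycleP ν u τ ^ 2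
      + (![-σ, σ, u 1 - u 0] : Fin 3 → ℝ) i * cycleP ν u τ
      + (![(u 1 + ν) * (u 2 + ν), -((u 0 + ν) * (u 2 + ν)), 0] : Fin 3 → ℝ) i)
      / (√(cycleP ν u τ) * √(cycleQ ν u τ))) (κ := gradA u i) ?_ cZ cX]
  intro τ
  refine (hasDerivAt_sin_mul (key _ _ _ τ)).congr_deriv ?_
  obtain ⟨s, t, hs, ht, hs1, ht1, hp, hν, h2⟩ := exists_sqrt_coords hu τ
  fin_cases i <;> simp [dirX, dirZ, dirP, quotDeriv, root, phaseVel, gradA, hD, hσ] <;>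
    rw [hs1, ht1, hp] <;> rw [hν, h2] <;> field_simp <;> ring

/-- The differential `dI = X dA + Y dB + Z dc` of the abbreviated action. -/
theorem fderiv_perI_single (hu : u ∈ riemannDomain ν) (i : Fin 3) :
    fderiv ℝ (perI ν) u (Pi.single i 1)
      = gradA u i * perX ν u + root u i * perY ν u + perZ ν u := by
  obtain ⟨hI, cI⟩ := fderiv_perI hu (Pi.single i 1)
  have cX := continuous_slice (contDiffOn_densX ν (n := 0)).continuousOn hu
  have cY := continuous_slice (contDiffOn_densY ν (n := 0)).continuousOn hu
  have cZ := continuous_slice (contDiffOn_densZ ν (n := 0)).continuousOn hu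
  have hi := fun (f : ℝ → ℝ) (hf : Continuous f) =>
    hf.intervalIntegrable (μ := MeasureTheory.volume) 0 (2 * Real.pi)
  -- moving `uⁱ` at fixed `τ` differs from moving it at fixed `η` by the total derivative of
  -- `(c - η) η_x ∂_i η`, where `(c - η) η_x` is a multiple of `sin τ √p √q`
  rw [hI, integral_eq_of_exact (K := fun τ => 2 * (u 1 - u 0) *
      ((![1, -1, 0] : Fin 3 → ℝ) i * Real.cos τ + (![0, 0, -1] : Fin 3 → ℝ) i) *
        (√(cycleP ν u τ) * √(cycleQ ν u τ))) (κ := 1)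
      (g := fun τ => gradA u i * densX ν u τ + root u i * densY ν u τ + densZ ν u τ) ?_ cI
      (((cX.const_mul _).add (cY.const_mul _)).add cZ)]
  · have hX := hi _ (cX.const_mul (gradA u i))
    have hY := hi _ (cY.const_mul (root u i))
    rw [intervalIntegral.integral_add (hX.add hY) (hi _ cZ), intervalIntegral.integral_add hX hY,
      intervalIntegral.integral_const_mul, intervalIntegral.integral_const_mul]
    unfold perX perY perZ
    ring
  intro τ
  have h1 := (((Real.hasDerivAt_cos τ).const_mul ((![1, -1, 0] : Fin 3 → ℝ) i)).add_const
    ((![0, 0, -1] : Fin 3 → ℝ) i)).const_mul (2 * (u 1 - u 0))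
  have h2 := h1.mul (hasDerivAt_angle_prod hu τ)
  refine (hasDerivAt_sin_mul (h2.congr_deriv (g' := Real.sin τ * (2 * (u 1 - u 0) *
    -((![1, -1, 0] : Fin 3 → ℝ) i) * (√(cycleP ν u τ) * √(cycleQ ν u τ)) +
      2 * (u 1 - u 0) *
      ((![1, -1, 0] : Fin 3 → ℝ) i * Real.cos τ + (![0, 0, -1] : Fin 3 → ℝ) i) *
      ((u 1 - u 0) / 2 / (2 * √(cycleP ν u τ)) * √(cycleQ ν u τ)
        + √(cycleP ν u τ) * (-((u 1 - u 0) / 2) / (2 * √(cycleQ ν u τ))))))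
            (by ring))).congr_deriv ?_
  obtain ⟨s, t, hs, ht, hs1, ht1, hp, hν, hu2⟩ := exists_sqrt_coords hu τ
  fin_cases i <;> simp [dirI, densX, densY, densZ, gradA, dirP, root, phaseVel] <;>
    rw [hs1, ht1, hp] <;> rw [hν, hu2] <;> field_simp <;> ring

end Relations

/-! ### The wave number as an Abelian integral -/

noncomputable section AbelianIntegrals

variable {ν : ℝ} {u : Fin 3 → ℝ}

theorem quotDeriv_eq {s t : ℝ} (hs : 0 < s) (ht : 0 < t) (a b : ℝ) :
    quotDeriv s t a b = a / (2 * s * t) - b * s / (2 * t ^ 3) := by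
  unfold quotDeriv; field_simp

/-- `1 / k` increases in the first two Riemann invariants and decreases in the third. -/
theorem fderiv_perX_single_ne_zero (hu : u ∈ riemannDomain ν) (i : Fin 3) :
    fderiv ℝ (perX ν) u (Pi.single i 1) ≠ 0 := by
  obtain ⟨hX, cX⟩ := fderiv_perX hu (Pi.single i 1)
  rw [hX]
  refine mul_ne_zero (by positivity) ?_
  have hs := fun τ => Real.sqrt_pos.2 (cycleP_pos hu τ)
  have ht := fun τ => Real.sqrt_pos.2 (cycleQ_pos hu τ)
  have hform : ∀ τ, dirX ν u (Pi.single i 1) τ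
      = dirP (Pi.single i 1) τ / (2 * √(cycleP ν u τ) * √(cycleQ ν u τ))
        - ((Pi.single i 1 : Fin 3 → ℝ) 2 - dirP (Pi.single i 1) τ) * √(cycleP ν u τ)
          / (2 * √(cycleQ ν u τ) ^ 3) := fun τ => quotDeriv_eq (hs τ) (ht τ) _ _
  by_cases hi : i = 2
  · subst hi
    have hneg : ∀ τ, 0 < -dirX ν u (Pi.single 2 1) τ := fun τ => by
      rw [hform]
      have := hs τ
      have := ht τ
      simp [dirP]
      positivity
    have := intervalIntegral.intervalIntegral_pos_of_pos (cX.neg.intervalIntegrable 0 (2 * Real.pi))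
      hneg (by positivity)
    simp only [Pi.neg_apply, intervalIntegral.integral_neg] at this
    linarith
  · have h2 : (Pi.single i 1 : Fin 3 → ℝ) 2 = 0 := by simp [Ne.symm hi]
    have hP : ∀ τ, 0 ≤ dirP (Pi.single i 1) τ := fun τ => by
      have h1 := Real.cos_le_one τ
      have h2 := Real.neg_one_le_cos τ
      fin_cases i <;> simp [dirP] at hi ⊢ <;> linarith
    have hP' : 0 < dirP (Pi.single i 1) (![0, Real.pi, 0] i) := by
      fin_cases i <;> simp [dirP] at hi ⊢ <;> norm_num
    have hform' : ∀ τ, dirX ν u (Pi.single i 1) τ = dirP (Pi.single i 1) τ *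
        (1 / (2 * √(cycleP ν u τ) * √(cycleQ ν u τ))
          + √(cycleP ν u τ) / (2 * √(cycleQ ν u τ) ^ 3)) := fun τ => by
      rw [hform, h2]; ring
    have hpos : ∀ τ, 0 < 1 / (2 * √(cycleP ν u τ) * √(cycleQ ν u τ))
          + √(cycleP ν u τ) / (2 * √(cycleQ ν u τ) ^ 3) := fun τ => by
      have := hs τ
      have := ht τ
      positivity
    refine (intervalIntegral.integral_pos (by positivity) cX.continuousOn
      (fun τ _ => ?_) ⟨![0, Real.pi, 0] i, ?_, ?_⟩).ne'
    · rw [hform']; exact mul_nonneg (hP τ) (hpos τ).le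
    · have := Real.pi_pos
      fin_cases i <;> simp at hi ⊢ <;> grind
    · rw [hform']; exact mul_pos hP' (hpos _)

theorem image_cycle (hu : u ∈ riemannDomain ν) :
    (fun τ => cycleP ν u τ - ν) '' Set.Ioo 0 Real.pi = Set.Ioo (u 0) (u 1) := by
  obtain ⟨h1, h2, h3⟩ := hu
  have hd : 0 < (u 1 - u 0) / 2 := by linarith
  ext z
  constructor
  · rintro ⟨τ, ⟨ha, hb⟩, rfl⟩
    have hc1 : Real.cos τ < 1 := by
      simpa using Real.cos_lt_cos_of_nonneg_of_le_pi le_rfl hb.le ha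
    have hc2 : -1 < Real.cos τ := by
      simpa using Real.cos_lt_cos_of_nonneg_of_le_pi ha.le le_rfl hb
    simp only [cycleP]
    constructor <;> nlinarith
  · rintro ⟨ha, hb⟩
    set x := ((u 0 + u 1) / 2 - z) / ((u 1 - u 0) / 2) with hx
    have hx1 : x < 1 := by rw [hx, div_lt_one hd]; linarith
    have hx2 : -1 < x := by rw [hx, lt_div_iff₀ hd]; linarith
    refine ⟨Real.arccos x, ⟨Real.arccos_pos.2 hx1, ?_⟩, ?_⟩
    · exact lt_of_le_of_ne (Real.arccos_le_pi x) fun h => by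
        rw [Real.arccos_eq_pi] at h; linarith
    · have hne : u 1 - u 0 ≠ 0 := by linarith
      simp only [cycleP, Real.cos_arccos hx2.le hx1.le]
      rw [hx]
      field_simp
      ring

theorem sqrt_R_cycle (hu : u ∈ riemannDomain ν) {τ : ℝ} (hτ : 0 ≤ Real.sin τ) :
    √(R ν u (cycleP ν u τ - ν))
      = √(cycleP ν u τ) * √(cycleQ ν u τ) * ((u 1 - u 0) / 2 * Real.sin τ) := by
  obtain ⟨h1, h2, h3⟩ := id hu
  have hd : 0 < (u 1 - u 0) / 2 := by linarith
  have h : R ν u (cycleP ν u τ - ν)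
      = cycleP ν u τ * cycleQ ν u τ * ((u 1 - u 0) / 2 * Real.sin τ) ^ 2 := by
    rw [mul_pow, Real.sin_sq]
    simp only [R, cycleQ, cycleP]
    ring
  rw [h, Real.sqrt_mul (mul_pos (cycleP_pos hu τ) (cycleQ_pos hu τ)).le,
    Real.sqrt_mul (cycleP_pos hu τ).le, Real.sqrt_sq (by positivity)]

/-- The substitution `z = (u⁰ + u¹) / 2 - (u¹ - u⁰) / 2 cos τ` in the Abelian integral. -/
theorem integral_abel (hu : u ∈ riemannDomain ν) :
    ∫ z in (u 0)..(u 1), (z + ν) / √(R ν u z) = ∫ τ in (0 : ℝ)..Real.pi, densX ν u τ := by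
  obtain ⟨h1, h2, h3⟩ := id hu
  have hd : 0 < (u 1 - u 0) / 2 := by linarith
  rw [intervalIntegral.integral_of_le h2.le, intervalIntegral.integral_of_le Real.pi_pos.le,
    MeasureTheory.integral_Ioc_eq_integral_Ioo, MeasureTheory.integral_Ioc_eq_integral_Ioo,
    ← image_cycle hu, MeasureTheory.integral_image_eq_integral_abs_deriv_smul measurableSet_Ioo
      (fun τ _ => ((hasDerivAt_angle_P ν u τ).sub_const ν).hasDerivWithinAt)]
  · refine MeasureTheory.setIntegral_congr_fun measurableSet_Ioo fun τ hτ => ?_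
    have hs := Real.sin_pos_of_pos_of_lt_pi hτ.1 hτ.2
    have hp := cycleP_pos hu τ
    have hsp := Real.sqrt_pos.2 hp
    have hsq := Real.sqrt_pos.2 (cycleQ_pos hu τ)
    have hpp := Real.mul_self_sqrt hp.le
    have hne : u 1 - u 0 ≠ 0 := by linarith
    simp only [densX, smul_eq_mul]
    rw [sqrt_R_cycle hu hs.le, abs_of_pos (by positivity), sub_add_cancel]
    field_simp
    linear_combination -hpp
  · intro x hx y hy hxy
    refine Real.injOn_cos ⟨hx.1.le, hx.2.le⟩ ⟨hy.1.le, hy.2.le⟩ ?_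
    simp only [cycleP] at hxy
    have : (u 1 - u 0) / 2 * Real.cos x = (u 1 - u 0) / 2 * Real.cos y := by linarith
    exact mul_left_cancel₀ hd.ne' this

theorem waveNumber_eq (hu : u ∈ riemannDomain ν) : waveNumber ν u = (perX ν u)⁻¹ := by
  have c := continuous_slice (contDiffOn_densX ν (n := 0)).continuousOn hu
  have hsymm : ∫ τ in Real.pi..(2 * Real.pi), densX ν u τ = ∫ τ in (0 : ℝ)..Real.pi,
      densX ν u τ := by
    have h := intervalIntegral.integral_comp_sub_left (a := Real.pi) (b := 2 * Real.pi)
      (densX ν u) (2 * Real.pi)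
    rw [show 2 * Real.pi - 2 * Real.pi = 0 by ring, show 2 * Real.pi - Real.pi =
        Real.pi by ring] at h
    rw [← h]
    refine intervalIntegral.integral_congr fun τ _ => ?_
    simp [densX, cycleQ, cycleP, Real.cos_two_pi_sub]
  have h1 : cycleIntegral ν u (fun z => z + ν) = ∫ τ in (0 : ℝ)..(2 * Real.pi), densX ν u τ := by
    rw [← intervalIntegral.integral_add_adjacent_intervals (c.intervalIntegrable 0 Real.pi)
      (c.intervalIntegrable _ _), hsymm]
    unfold cycleIntegral
    simp only [div_neg, intervalIntegral.integral_neg]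
    rw [intervalIntegral.integral_symm (u 0) (u 1), integral_abel hu]
    ring
  unfold waveNumber perX
  rw [h1, mul_inv, inv_inv]

theorem pd_eq_fderiv {f : (Fin 3 → ℝ) → ℝ} {u : Fin 3 → ℝ} (hf : DifferentiableAt ℝ f u)
    (i : Fin 3) : pd i f u = fderiv ℝ f u (Pi.single i 1) := by
  have h1 : HasFDerivAt f (fderiv ℝ f u) (Function.update u i (u i)) := by
    simpa using hf.hasFDerivAt
  exact (h1.comp_hasDerivAt (u i) (hasDerivAt_update u i (u i))).deriv

theorem differentiableAt_perX (hu : u ∈ riemannDomain ν) : DifferentiableAt ℝ (perX ν) u :=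
  ((contDiffOn_perX ν).contDiffAt ((isOpen_riemannDomain ν).mem_nhds hu)).differentiableAt
    (by simp)

theorem hasFDerivAt_waveNumber (hu : u ∈ riemannDomain ν) :
    HasFDerivAt (waveNumber ν) (-(perX ν u ^ 2)⁻¹ • fderiv ℝ (perX ν) u) u := by
  have h := (hasDerivAt_inv (perX_pos hu).ne').comp_hasFDerivAt u
    (differentiableAt_perX hu).hasFDerivAt
  refine h.congr_of_eventuallyEq ?_
  filter_upwards [(isOpen_riemannDomain ν).mem_nhds hu] with x hx using waveNumber_eq hx

theorem hasFDerivAt_phaseVel (ν : ℝ) (u : Fin 3 → ℝ) :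
    HasFDerivAt (phaseVel ν) (∑ i, ContinuousLinearMap.proj (R := ℝ) (φ := fun _ : Fin 3 => ℝ) i)
        u := by
  have h := fun i : Fin 3 => hasFDerivAt_apply (𝕜 := ℝ) (F' := fun _ : Fin 3 => ℝ) i u
  refine HasFDerivAt.congr_fderiv ((((h 0).const_add (2 * ν)).add (h 1)).add (h 2)) ?_
  rw [Fin.sum_univ_three]

theorem hasFDerivAt_frequency (hu : u ∈ riemannDomain ν) :
    HasFDerivAt (frequency ν) (phaseVel ν u • (-(perX ν u ^ 2)⁻¹ • fderiv ℝ (perX ν) u)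
      + (perX ν u)⁻¹ • ∑ i, ContinuousLinearMap.proj (R := ℝ) (φ := fun _ : Fin 3 => ℝ) i) u := by
  rw [← waveNumber_eq hu]
  exact (hasFDerivAt_phaseVel ν u).mul (hasFDerivAt_waveNumber hu)

theorem pd_waveNumber_ne_zero (hu : u ∈ riemannDomain ν) (i : Fin 3) :
    pd i (waveNumber ν) u ≠ 0 := by
  have h := hasFDerivAt_waveNumber hu
  rw [pd_eq_fderiv h.differentiableAt, h.fderiv]
  have h1 := fderiv_perX_single_ne_zero hu i
  have h2 := (perX_pos hu).ne'
  simpa using ⟨h2, h1⟩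

theorem speed_eq (hu : u ∈ riemannDomain ν) (i : Fin 3) :
    speed ν i u = phaseVel ν u - perX ν u / fderiv ℝ (perX ν) u (Pi.single i 1) := by
  have h := hasFDerivAt_waveNumber hu
  have h' := hasFDerivAt_frequency hu
  have h1 := fderiv_perX_single_ne_zero hu i
  have h2 := (perX_pos hu).ne'
  unfold speed
  rw [pd_eq_fderiv h.differentiableAt, pd_eq_fderiv h'.differentiableAt, h.fderiv, h'.fderiv]
  simp
  field_simp
  ring

end AbelianIntegrals

/-! ### The periodic solution of the travelling wave equation -/

noncomputable section Model

variable {ν : ℝ} {u : Fin 3 → ℝ}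

/-- The position, on the scale of `x`, at which the wave reaches the angle `τ` of the cycle. -/
def arc (ν : ℝ) (u : Fin 3 → ℝ) (τ : ℝ) : ℝ := ∫ σ in (0 : ℝ)..τ, densX ν u σ

theorem contDiff_densX (hu : u ∈ riemannDomain ν) {n : WithTop ℕ∞} : ContDiff ℝ n (densX ν u) := by
  have h : ContDiff ℝ n (fun τ : ℝ => (u, τ)) := by fun_prop
  exact (contDiffOn_densX ν).comp_contDiff h fun τ => ⟨hu, trivial⟩

theorem densX_pos (hu : u ∈ riemannDomain ν) (τ : ℝ) : 0 < densX ν u τ :=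
  div_pos (Real.sqrt_pos.2 (cycleP_pos hu τ)) (Real.sqrt_pos.2 (cycleQ_pos hu τ))

theorem densX_periodic (ν : ℝ) (u : Fin 3 → ℝ) : Function.Periodic (densX ν u) (2 * Real.pi) :=
  fun τ => by simp [densX, cycleQ, cycleP, Real.cos_add_two_pi]

theorem hasDerivAt_arc (hu : u ∈ riemannDomain ν) (τ : ℝ) :
    HasDerivAt (arc ν u) (densX ν u τ) τ :=
  have hc := (contDiff_densX hu (n := 0)).continuous
  intervalIntegral.integral_hasDerivAt_right (hc.intervalIntegrable _ _)
    hc.aestronglyMeasurable.stronglyMeasurableAtFilter hc.continuousAt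

theorem arc_two_pi (ν : ℝ) (u : Fin 3 → ℝ) : arc ν u (2 * Real.pi) = 2 * Real.pi * perX ν u := by
  have := Real.pi_pos
  unfold arc perX
  field_simp

theorem strictMono_arc (hu : u ∈ riemannDomain ν) : StrictMono (arc ν u) :=
  strictMono_of_deriv_pos fun τ => by
    rw [(hasDerivAt_arc hu τ).deriv]; exact densX_pos hu τ

theorem continuous_arc (hu : u ∈ riemannDomain ν) : Continuous (arc ν u) :=
  continuous_iff_continuousAt.2 fun τ => (hasDerivAt_arc hu τ).continuousAt

theorem surjective_arc (hu : u ∈ riemannDomain ν) : Function.Surjective (arc ν u) := by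
  have hi := (contDiff_densX hu (n := 0)).continuous.intervalIntegrable
    (μ := MeasureTheory.volume) 0 (2 * Real.pi)
  exact (continuous_arc hu).surjective
    ((densX_periodic ν u).tendsto_atTop_intervalIntegral_of_pos' hi (densX_pos hu) (by positivity))
    ((densX_periodic ν u).tendsto_atBot_intervalIntegral_of_pos' hi (densX_pos hu) (by positivity))

theorem arc_add (hu : u ∈ riemannDomain ν) (τ : ℝ) (n : ℤ) :
    arc ν u (τ + n * (2 * Real.pi)) = arc ν u τ + n * (2 * Real.pi * perX ν u) := by
  have hc := (contDiff_densX hu (n := 0)).continuous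
  have hi : ∀ a b, IntervalIntegrable (densX ν u) MeasureTheory.volume a b :=
    fun a b => hc.intervalIntegrable a b
  unfold arc
  rw [← intervalIntegral.integral_add_adjacent_intervals (hi 0 τ) (hi τ _)]
  have h := (densX_periodic ν u).intervalIntegral_add_zsmul_eq n τ hi
  rw [(densX_periodic ν u).intervalIntegral_add_eq τ 0, zero_add] at h
  have h2 := arc_two_pi ν u
  unfold arc at h2
  rw [h2] at h
  simp only [zsmul_eq_mul] at h
  rw [h]

/-- The angle of the cycle as a coordinate on the line. -/
def arcHomeo (hu : u ∈ riemannDomain ν) : ℝ ≃ₜ ℝ :=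
  ((strictMono_arc hu).orderIsoOfSurjective _ (surjective_arc hu)).toHomeomorph

/-- The angle of the cycle reached at the position `x`. -/
def angle (hu : u ∈ riemannDomain ν) (x : ℝ) : ℝ := (arcHomeo hu).symm x

theorem arc_angle (hu : u ∈ riemannDomain ν) (x : ℝ) : arc ν u (angle hu x) = x :=
  (arcHomeo hu).apply_symm_apply x

theorem angle_arc (hu : u ∈ riemannDomain ν) (τ : ℝ) : angle hu (arc ν u τ) = τ :=
  (arcHomeo hu).symm_apply_apply τ

theorem contDiff_arc (hu : u ∈ riemannDomain ν) (n : ℕ) : ContDiff ℝ n (arc ν u) := by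
  refine ContDiff.of_le (n := (n : WithTop ℕ∞) + 1) ?_ (by norm_cast; omega)
  rw [contDiff_succ_iff_deriv]
  refine ⟨fun τ => (hasDerivAt_arc hu τ).differentiableAt, by simp, ?_⟩
  rw [show deriv (arc ν u) = densX ν u from funext fun τ => (hasDerivAt_arc hu τ).deriv]
  exact contDiff_densX hu

theorem contDiff_angle (hu : u ∈ riemannDomain ν) (n : ℕ) : ContDiff ℝ n (angle hu) :=
  (arcHomeo hu).contDiff_symm_deriv (fun τ => (densX_pos hu τ).ne') (hasDerivAt_arc hu)
    (contDiff_arc hu n)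

theorem hasDerivAt_angle (hu : u ∈ riemannDomain ν) (x : ℝ) :
    HasDerivAt (angle hu) (densX ν u (angle hu x))⁻¹ x :=
  (hasDerivAt_arc hu _).of_local_left_inverse
    ((contDiff_angle hu 0).continuous.continuousAt) (densX_pos hu _).ne'
    (Eventually.of_forall (arc_angle hu))

theorem angle_add (hu : u ∈ riemannDomain ν) (x : ℝ) :
    angle hu (x + 2 * Real.pi * perX ν u) = angle hu x + 2 * Real.pi := by
  have h := arc_add hu (angle hu x) 1
  rw [arc_angle] at h
  simp only [Int.cast_one, one_mul] at h
  rw [← h, angle_arc]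

/-- The wave profile on the scale of `x`. -/
def wave (hu : u ∈ riemannDomain ν) (x : ℝ) : ℝ := profileAt ν u (angle hu x)

/-- The derivative of `wave`. -/
def waveD (hu : u ∈ riemannDomain ν) (x : ℝ) : ℝ :=
  -(u 1 - u 0) * Real.sin (angle hu x) * (√(cycleQ ν u (angle hu x)) / √(cycleP ν u (angle hu x)))

/-- The derivative of `∏ (y - eⁱ)`. -/
def cubicD (u : Fin 3 → ℝ) (y : ℝ) : ℝ :=
  3 * y ^ 2 - 2 * (root u 0 + root u 1 + root u 2) * y
    + (root u 0 * root u 1 + root u 0 * root u 2 + root u 1 * root u 2)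

theorem contDiff_profileAt (ν : ℝ) (u : Fin 3 → ℝ) {n : WithTop ℕ∞} :
    ContDiff ℝ n (profileAt ν u) := by
  unfold profileAt cycleP; fun_prop

theorem contDiff_wave (hu : u ∈ riemannDomain ν) (n : ℕ) : ContDiff ℝ n (wave hu) :=
  (contDiff_profileAt ν u).comp (contDiff_angle hu n)

theorem hasDerivAt_wave (hu : u ∈ riemannDomain ν) (x : ℝ) :
    HasDerivAt (wave hu) (waveD hu x) x := by
  have h1 := ((hasDerivAt_angle_P ν u (angle hu x)).const_mul 2).const_sub (phaseVel ν u)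
  refine (HasDerivAt.comp x h1 (hasDerivAt_angle hu x)).congr_deriv ?_
  simp only [waveD, densX, inv_div]
  ring

theorem hasDerivAt_angle_quot_inv (hu : u ∈ riemannDomain ν) (τ : ℝ) :
    HasDerivAt (fun τ => √(cycleQ ν u τ) / √(cycleP ν u τ))
      (Real.sin τ * quotDeriv √(cycleQ ν u τ) √(cycleP ν u τ)
        (-((u 1 - u 0) / 2)) ((u 1 - u 0) / 2)) τ :=
  HasDerivAt.congr_deriv ((hasDerivAt_angle_sqrtQ hu τ).div (hasDerivAt_angle_sqrtP hu τ)
    (Real.sqrt_pos.2 (cycleP_pos hu τ)).ne') (by unfold quotDeriv; ring)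

theorem phaseVel_sub_wave_pos (hu : u ∈ riemannDomain ν) (x : ℝ) : 0 < phaseVel ν u
    - wave hu x := by
  have := cycleP_pos hu (angle hu x)
  unfold wave profileAt
  linarith

theorem hasDerivAt_waveD (hu : u ∈ riemannDomain ν) (x : ℝ) :
    HasDerivAt (waveD hu)
      ((waveD hu x ^ 2 - cubicD u (wave hu x)) / (2 * (phaseVel ν u - wave hu x))) x := by
  have h1 := (hasDerivAt_sin_mul (hasDerivAt_angle_quot_inv hu (angle hu x))).const_mul (-(u 1
      - u 0))
  refine (HasDerivAt.congr_of_eventuallyEq (HasDerivAt.comp x h1 (hasDerivAt_angle hu x))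
    (Eventually.of_forall fun y => ?_)).congr_deriv ?_
  · simp only [waveD, Function.comp]; ring
  rw [eq_div_iff (mul_pos two_pos (phaseVel_sub_wave_pos hu x)).ne']
  simp only [waveD, wave, profileAt, mul_pow, Real.sin_sq, cubicD, quotDeriv, densX, inv_div]
  clear h1
  generalize angle hu x = τ
  obtain ⟨s, t, hs, ht, hs1, ht1, hp, hν, h2⟩ := exists_sqrt_coords hu τ
  rw [hs1, ht1, hp]
  simp only [root, phaseVel]
  rw [hν, h2]
  field_simp
  ring

theorem wave_first_integral (hu : u ∈ riemannDomain ν) (x : ℝ) :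
    (phaseVel ν u - wave hu x) * waveD hu x ^ 2
      = -((wave hu x - root u 0) * (wave hu x - root u 1) * (wave hu x - root u 2)) := by
  simp only [waveD, wave, profileAt, mul_pow, Real.sin_sq]
  generalize angle hu x = τ
  obtain ⟨s, t, hs, ht, hs1, ht1, hp, hν, h2⟩ := exists_sqrt_coords hu τ
  rw [hs1, ht1, hp]
  simp only [root, phaseVel]
  rw [hν, h2]
  field_simp
  ring

theorem wave_periodic (hu : u ∈ riemannDomain ν) :
    Function.Periodic (wave hu) (2 * Real.pi * perX ν u) := fun x => by
  simp [wave, angle_add, profileAt, cycleP, Real.cos_add_two_pi]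

theorem angle_zero (hu : u ∈ riemannDomain ν) : angle hu 0 = 0 := by
  conv_lhs => rw [show (0 : ℝ) = arc ν u 0 by simp [arc]]
  exact angle_arc hu 0

theorem wave_zero (hu : u ∈ riemannDomain ν) : wave hu 0 = root u 0 := by
  simp only [wave, profileAt, angle_zero, cycleP, Real.cos_zero, phaseVel, root]
  ring

theorem waveD_zero (hu : u ∈ riemannDomain ν) : waveD hu 0 = 0 := by
  simp [waveD, angle_zero]

theorem wave_eq_max (hu : u ∈ riemannDomain ν) {x : ℝ} (hx : wave hu x = root u 0) :
    ∃ n : ℤ, x = n * (2 * Real.pi * perX ν u) := by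
  have h1 : Real.cos (angle hu x) = 1 := by
    have hd : u 1 - u 0 ≠ 0 := (sub_pos.2 hu.2.1).ne'
    simp only [wave, profileAt, cycleP, phaseVel, root] at hx
    have : (u 1 - u 0) * Real.cos (angle hu x) = (u 1 - u 0) * 1 := by linarith
    exact mul_left_cancel₀ hd this
  obtain ⟨n, hn⟩ := (Real.cos_eq_one_iff _).1 h1
  refine ⟨n, ?_⟩
  have h2 := arc_add hu 0 n
  rw [zero_add, hn, arc_angle] at h2
  simpa [arc] using h2

theorem wave_mem_Icc (hu : u ∈ riemannDomain ν) (x : ℝ) :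
    wave hu x ∈ Set.Icc (root u 1) (root u 0) := by
  have h1 := Real.cos_le_one (angle hu x)
  have h2 := Real.neg_one_le_cos (angle hu x)
  have h3 := hu.2.1
  simp only [wave, profileAt, cycleP, phaseVel, root, Set.mem_Icc]
  constructor <;> nlinarith

theorem integral_comp_wave (hu : u ∈ riemannDomain ν) {f : ℝ → ℝ}
    (hf : Continuous fun τ => f (profileAt ν u τ)) :
    ∫ x in (0 : ℝ)..(2 * Real.pi * perX ν u), f (wave hu x)
      = ∫ τ in (0 : ℝ)..(2 * Real.pi), f (profileAt ν u τ) * densX ν u τ := by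
  have hg : Continuous fun x => f (wave hu x) := hf.comp (contDiff_angle hu 0).continuous
  have h := intervalIntegral.integral_comp_mul_deriv (a := 0) (b := 2 * Real.pi)
    (fun τ _ => hasDerivAt_arc hu τ) (contDiff_densX hu (n := 0)).continuous.continuousOn hg
  rw [arc_two_pi, show arc ν u 0 = 0 by simp [arc]] at h
  rw [← h]
  refine intervalIntegral.integral_congr fun τ _ => ?_
  simp [wave, angle_arc]

/-- A solution of the travelling wave equation that starts at rest from the crest is `wave`. -/
theorem eq_wave (hu : u ∈ riemannDomain ν) {y y' : ℝ → ℝ}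
    (hy : ∀ x, HasDerivAt y (y' x) x)
    (hy' : ∀ x, HasDerivAt y' ((y' x ^ 2 - cubicD u (y x)) / (2 * (phaseVel ν u - y x))) x)
    (hr : ∀ x, y x ∈ Set.Icc (root u 1) (root u 0)) (h0 : y 0 = root u 0) (h0' : y' 0 = 0) :
    ∀ x, y x = wave hu x := by
  intro x
  have hyc : Continuous y' := continuous_iff_continuousAt.2 fun x => (hy' x).continuousAt
  have hwc : Continuous (waveD hu) :=
    continuous_iff_continuousAt.2 fun x => (hasDerivAt_waveD hu x).continuousAt
  -- both solutions stay in a compact set on a bounded interval around `0` and `x`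
  obtain ⟨M₁, hM₁⟩ := (isCompact_Icc (a := -(|x| + 1)) (b := |x| + 1)).exists_bound_of_continuousOn
    hyc.continuousOn
  obtain ⟨M₂, hM₂⟩ := (isCompact_Icc (a := -(|x| + 1)) (b := |x| + 1)).exists_bound_of_continuousOn
    hwc.continuousOn
  set M := max M₁ M₂
  set V : ℝ × ℝ → ℝ × ℝ := fun z => (z.2, (z.2 ^ 2 - cubicD u z.1) / (2 * (phaseVel ν u - z.1)))
  set s : Set (ℝ × ℝ) := Set.Icc (root u 1) (root u 0) ×ˢ Set.Icc (-M) M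
  have hlip : LocallyLipschitzOn s V := fun z hz => by
    have hz1 : phaseVel ν u - z.1 ≠ 0 := by
      have h1 := hz.1.2
      have h2 := hu.1
      simp only [phaseVel, root] at h1 ⊢
      linarith
    have hV : ContDiffAt ℝ 1 V z := by
      refine contDiffAt_snd.prodMk (ContDiffAt.div ?_ ?_ (by simpa using hz1))
      · unfold cubicD; fun_prop
      · fun_prop
    obtain ⟨K, t, ht, hK⟩ := hV.exists_lipschitzOnWith
    exact ⟨K, t, mem_nhdsWithin_of_mem_nhds ht, hK⟩
  obtain ⟨K, hK⟩ := hlip.exists_lipschitzOnWith_of_compact (isCompact_Icc.prod isCompact_Icc)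
  have hx : x ∈ Set.Ioo (-(|x| + 1)) (|x| + 1) := by
    have := neg_abs_le x
    have := le_abs_self x
    constructor <;> linarith
  have h0m : (0 : ℝ) ∈ Set.Ioo (-(|x| + 1)) (|x| + 1) := by
    have := abs_nonneg x
    constructor <;> linarith
  have := ODE_solution_unique_of_mem_Ioo (v := fun _ => V) (s := fun _ => s) (K := K)
    (f := fun x => (y x, y' x)) (g := fun x => (wave hu x, waveD hu x)) (fun _ _ => hK) h0m
    (fun t ht => ⟨(hy t).prodMk (hy' t), hr t, abs_le.1 ((hM₁ t (Set.Ioo_subset_Icc_self ht)).trans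
      (le_max_left _ _))⟩)
    (fun t ht => ⟨(hasDerivAt_wave hu t).prodMk (hasDerivAt_waveD hu t), wave_mem_Icc hu t,
      abs_le.1 ((hM₂ t (Set.Ioo_subset_Icc_self ht)).trans (le_max_right _ _))⟩)
    (by simp [h0, h0', wave_zero, waveD_zero]) hx
  exact congrArg Prod.fst this

end Model

/-! ### Travelling waves -/

noncomputable section Travelling

variable {ν : ℝ} {u : Fin 3 → ℝ}

theorem dX_travelling {f : ℝ → ℝ} (hf : Differentiable ℝ f) (k ω : ℝ) :
    dX (fun p => f (k * p.1 - ω * p.2)) = fun p => k * deriv f (k * p.1 - ω * p.2) := by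
  funext p
  have h1 : HasDerivAt (fun x => k * x - ω * p.2) k p.1 := by
    simpa using ((hasDerivAt_id p.1).const_mul k).sub_const (ω * p.2)
  exact ((hf _).hasDerivAt.comp p.1 h1).deriv.trans (mul_comm _ _)

theorem dT_travelling {f : ℝ → ℝ} (hf : Differentiable ℝ f) (k ω : ℝ) :
    dT (fun p => f (k * p.1 - ω * p.2)) = fun p => -ω * deriv f (k * p.1 - ω * p.2) := by
  funext p
  have h1 : HasDerivAt (fun t => k * p.1 - ω * t) (-ω) p.2 := by
    simpa using ((hasDerivAt_id p.2).const_mul ω).const_sub (k * p.1)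
  exact ((hf _).hasDerivAt.comp p.2 h1).deriv.trans (mul_comm _ _)

theorem contDiff_deriv {f : ℝ → ℝ} {n : ℕ} (hf : ContDiff ℝ (n + 1 : ℕ) f) :
    ContDiff ℝ n (deriv f) :=
  (contDiff_succ_iff_deriv.1 (by exact_mod_cast hf)).2.2

/-- The Camassa-Holm equation for travelling waves, multiplied by `2 / k` and integrated once. -/
def travelEnergy (ν k ω : ℝ) (η : ℝ → ℝ) (θ : ℝ) : ℝ :=
  2 * k ^ 2 * (ω / k - η θ) * deriv (deriv η) θ - k ^ 2 * deriv η θ ^ 2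
    + 3 * η θ ^ 2 + 2 * (2 * ν - ω / k) * η θ

theorem hasDerivAt_travelEnergy {η : ℝ → ℝ} (hη : ContDiff ℝ 3 η) (k ω θ : ℝ) :
    HasDerivAt (travelEnergy ν k ω η)
      (2 * (k ^ 2 * (ω / k - η θ) * deriv (deriv (deriv η)) θ
        - 2 * k ^ 2 * deriv η θ * deriv (deriv η) θ + 3 * η θ * deriv η θ
        + (2 * ν - ω / k) * deriv η θ)) θ := by
  have c1 : ContDiff ℝ 2 (deriv η) := contDiff_deriv (n := 2) hη
  have c2 : ContDiff ℝ 1 (deriv (deriv η)) := contDiff_deriv (n := 1) c1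
  have h0 := ((hη.differentiable (by norm_num)) θ).hasDerivAt
  have h1 := ((c1.differentiable (by norm_num)) θ).hasDerivAt
  have h2 := ((c2.differentiable (by norm_num)) θ).hasDerivAt
  have h := (((((h0.const_sub (ω / k)).const_mul (2 * k ^ 2)).mul h2).sub
    ((h1.pow 2).const_mul (k ^ 2))).add ((h0.pow 2).const_mul 3)).add
      (h0.const_mul (2 * (2 * ν - ω / k)))
  refine HasDerivAt.congr_deriv h ?_
  simp
  ring

/-- For travelling waves the Camassa-Holm equation is equivalent to a second order equation. -/
theorem solvesCH_iff {η : ℝ → ℝ} (hη : ContDiff ℝ 3 η) {k : ℝ} (hk : k ≠ 0) (ω : ℝ) :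
    SolvesCH ν (fun p => η (k * p.1 - ω * p.2)) ↔ ∃ C, ∀ θ, travelEnergy ν k ω η θ = C := by
  have c1 : ContDiff ℝ 2 (deriv η) := contDiff_deriv (n := 2) hη
  have c2 : ContDiff ℝ 1 (deriv (deriv η)) := contDiff_deriv (n := 1) c1
  have d0 : Differentiable ℝ η := hη.differentiable (by norm_num)
  have d1 : Differentiable ℝ (deriv η) := c1.differentiable (by norm_num)
  have d2 : Differentiable ℝ (deriv (deriv η)) := c2.differentiable (by norm_num)
  have e1 := dX_travelling d0 k ω
  have e2 : dX (dX fun p => η (k * p.1 - ω * p.2))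
      = fun p => k * (k * deriv (deriv η) (k * p.1 - ω * p.2)) := by
    rw [e1, dX_travelling (d1.const_mul k) k ω]
    simp [deriv_const_mul_field]
  have e3 : dX (dX (dX fun p => η (k * p.1 - ω * p.2)))
      = fun p => k * (k * (k * deriv (deriv (deriv η)) (k * p.1 - ω * p.2))) := by
    rw [e2, dX_travelling ((d2.const_mul k).const_mul k) k ω]
    simp [deriv_const_mul_field]
  have e4 : dT (dX (dX fun p => η (k * p.1 - ω * p.2)))
      = fun p => -ω * (k * (k * deriv (deriv (deriv η)) (k * p.1 - ω * p.2))) := by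
    rw [e2, dT_travelling ((d2.const_mul k).const_mul k) k ω]
    simp [deriv_const_mul_field]
  have hE := hasDerivAt_travelEnergy (ν := ν) hη k ω
  have key : SolvesCH ν (fun p => η (k * p.1 - ω * p.2)) ↔
      ∀ θ, deriv (travelEnergy ν k ω η) θ = 0 := by
    unfold SolvesCH
    rw [e4, e3, e2, e1, dT_travelling d0 k ω]
    constructor
    · intro h θ
      have h1 := h (θ / k, 0)
      simp only [mul_div_cancel₀ θ hk, mul_zero, sub_zero] at h1
      rw [(hE θ).deriv]
      field_simp
      linear_combination 2 * h1
    · intro h p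
      have h1 := h (k * p.1 - ω * p.2)
      rw [(hE _).deriv] at h1
      field_simp at h1
      linear_combination (1 / 2) * h1
  rw [key]
  constructor
  · exact fun h => ⟨_, fun θ => is_const_of_deriv_eq_zero (fun θ => (hE θ).differentiableAt) h θ 0⟩
  · rintro ⟨C, hC⟩ θ
    rw [funext hC]
    simp

theorem riemann_mem {e : Fin 3 → ℝ} (he : e ∈ rootDomain ν) : riemann e ∈ riemannDomain ν := by
  obtain ⟨h1, h2, h3⟩ := he
  refine ⟨?_, ?_, ?_⟩ <;> simp [riemann] <;> linarith

theorem root_riemann (e : Fin 3 → ℝ) (i : Fin 3) : root (riemann e) i = e i := by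
  fin_cases i <;> simp [root, riemann] <;> ring

theorem phaseVel_riemann (ν : ℝ) (e : Fin 3 → ℝ) :
    phaseVel ν (riemann e) = 2 * ν + (e 0 + e 1 + e 2) := by
  simp [phaseVel, riemann]; ring

namespace IsOnePhaseWave

variable {e : Fin 3 → ℝ} {w : WaveData}

theorem contDiff_deriv_Φ (hw : IsOnePhaseWave ν e w) : ContDiff ℝ 3 (deriv w.Φ) :=
  contDiff_deriv (n := 3) hw.contDiff

theorem contDiff_η (hw : IsOnePhaseWave ν e w) : ContDiff ℝ 3 w.η :=
  contDiff_const.add (contDiff_const.mul hw.contDiff_deriv_Φ)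

theorem deriv_Φ_periodic (hw : IsOnePhaseWave ν e w) :
    Function.Periodic (deriv w.Φ) (2 * Real.pi) := fun θ => by
  rw [← deriv_comp_add_const, funext hw.periodic]

theorem η_periodic (hw : IsOnePhaseWave ν e w) : Function.Periodic w.η (2 * Real.pi) := fun θ => by
  simp only [WaveData.η, hw.deriv_Φ_periodic θ]

theorem ω_eq (hw : IsOnePhaseWave ν e w) : w.ω = phaseVel ν (riemann e) * w.k := by
  obtain ⟨A, B, -, h⟩ := hw.integrated
  have hk := hw.k_pos
  have : w.ω / w.k = phaseVel ν (riemann e) := by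
    rw [phaseVel_riemann]
    linarith [h 0, h 1, h (-1)]
  rw [← this]
  field_simp

theorem first_integral (hw : IsOnePhaseWave ν e w) (θ : ℝ) :
    w.k ^ 2 * (phaseVel ν (riemann e) - w.η θ) * deriv w.η θ ^ 2
      = -((w.η θ - e 0) * (w.η θ - e 1) * (w.η θ - e 2)) := by
  obtain ⟨A, B, h1, h⟩ := hw.integrated
  have hk := hw.k_pos
  have hω : w.ω / w.k = phaseVel ν (riemann e) := by rw [hw.ω_eq]; field_simp
  rw [← hω]
  linear_combination h1 θ - h (w.η θ)

/-- A profile of minimal period `2π` gives a velocity of minimal period `2π`. -/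
theorem not_periodic_η (hw : IsOnePhaseWave ν e w) {m : ℕ} (hm : 2 ≤ m) {T : ℝ}
    (hT : m * T = 2 * Real.pi) : ¬ Function.Periodic w.η T := by
  intro hp
  have hpi := Real.pi_pos
  have hm' : (2 : ℝ) ≤ m := by exact_mod_cast hm
  have hT0 : 0 < T := by
    by_contra h
    nlinarith
  have hd : Differentiable ℝ w.Φ := hw.contDiff.differentiable (by norm_num)
  have hp' : ∀ θ, deriv w.Φ (θ + T) = deriv w.Φ θ := fun θ => by
    have := hp θ
    simp only [WaveData.η, add_right_inj] at this
    exact mul_left_cancel₀ hw.k_pos.ne' this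
  have hconst : ∀ θ, w.Φ (θ + T) - w.Φ θ = w.Φ (0 + T) - w.Φ 0 := fun θ => by
    refine is_const_of_deriv_eq_zero (f := fun θ => w.Φ (θ + T) - w.Φ θ) ?_ (fun θ => ?_) θ 0
    · exact (hd.comp (differentiable_id.add_const T)).sub hd
    · have h1 : HasDerivAt (fun θ => w.Φ (θ + T)) (deriv w.Φ (θ + T)) θ :=
        (hd _).hasDerivAt.comp_add_const θ T
      have h2 := (h1.sub (hd θ).hasDerivAt).deriv
      rw [hp', sub_self] at h2
      exact h2
  have hiter : ∀ n : ℕ, w.Φ (n * T) = w.Φ 0 + n * (w.Φ (0 + T) - w.Φ 0) := fun n => by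
    induction n with
    | zero => simp
    | succ n ih =>
      have := hconst (n * T)
      push_cast
      rw [add_mul, one_mul]
      linarith
  have h0 : w.Φ (0 + T) - w.Φ 0 = 0 := by
    have h1 := hiter m
    have h2 := hw.periodic 0
    rw [zero_add] at h2
    rw [hT, h2] at h1
    have : (m : ℝ) * (w.Φ (0 + T) - w.Φ 0) = 0 := by linarith
    exact (mul_eq_zero.1 this).resolve_left (by linarith)
  refine hw.minimal T hT0 (by nlinarith) fun θ => ?_
  linarith [hconst θ]

theorem exists_deriv_ne_zero (hw : IsOnePhaseWave ν e w) : ∃ θ, deriv w.η θ ≠ 0 := by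
  by_contra! h
  refine hw.not_periodic_η (m := 2) le_rfl (T := Real.pi) (by norm_num) fun θ => ?_
  exact is_const_of_deriv_eq_zero (hw.contDiff_η.differentiable (by norm_num)) h _ _

/-- The second order equation of the profile. Multiplied by `η'` it is the derivative of the first
integral; this fixes the constant of integration, since `η` is not constant. -/
theorem second_order (hw : IsOnePhaseWave ν e w) (θ : ℝ) :
    2 * w.k ^ 2 * (phaseVel ν (riemann e) - w.η θ) * deriv (deriv w.η) θ
      = w.k ^ 2 * deriv w.η θ ^ 2 - cubicD (riemann e) (w.η θ) := by
  have hk := hw.k_pos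
  have hω : w.ω / w.k = phaseVel ν (riemann e) := by rw [hw.ω_eq]; field_simp
  obtain ⟨C, hC⟩ := (solvesCH_iff hw.contDiff_η hk.ne' w.ω).1 hw.solves
  have c1 : ContDiff ℝ 2 (deriv w.η) := contDiff_deriv (n := 2) hw.contDiff_η
  have h0 := fun θ => ((hw.contDiff_η.differentiable (by norm_num)) θ).hasDerivAt
  have h1 := fun θ => ((c1.differentiable (by norm_num)) θ).hasDerivAt
  obtain ⟨θ₀, hθ₀⟩ := hw.exists_deriv_ne_zero
  have hE : ∀ θ, travelEnergy ν w.k w.ω w.η θ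
      = 2 * w.k ^ 2 * (phaseVel ν (riemann e) - w.η θ) * deriv (deriv w.η) θ
        - w.k ^ 2 * deriv w.η θ ^ 2 + cubicD (riemann e) (w.η θ)
        - (e 0 * e 1 + e 0 * e 2 + e 1 * e 2) := fun θ => by
    simp only [travelEnergy, hω, cubicD, root_riemann, phaseVel_riemann]
    ring
  -- the derivative of the first integral vanishes
  have hd := ((((h0 θ₀).const_sub (phaseVel ν (riemann e))).const_mul (w.k ^ 2)).mul
    ((h1 θ₀).pow 2)).add ((((h0 θ₀).sub_const (e 0)).mul ((h0 θ₀).sub_const (e 1))).mul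
      ((h0 θ₀).sub_const (e 2)))
  have hz := hd.unique (((hasDerivAt_const θ₀ (0 : ℝ))).congr_of_eventuallyEq
    (Eventually.of_forall fun θ => by
      have := hw.first_integral θ
      simp only [Pi.add_apply, Pi.mul_apply, Pi.pow_apply]
      linarith))
  have hz' : deriv w.η θ₀ * (C + (e 0 * e 1 + e 0 * e 2 + e 1 * e 2)) = 0 := by
    rw [← hC θ₀, hE θ₀]
    simp at hz
    simp only [cubicD, root_riemann]
    linear_combination hz
  have hC' := (mul_eq_zero.1 hz').resolve_left hθ₀
  have := hE θ
  rw [hC θ] at this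
  linarith

/-- The velocity oscillates between `e¹` and `e⁰`, and attains `e⁰`. -/
theorem range_η (hw : IsOnePhaseWave ν e w) (he : e ∈ rootDomain ν) :
    (∀ θ, w.η θ ∈ Set.Icc (e 1) (e 0)) ∧ ∃ θ, w.η θ = e 0 ∧ deriv w.η θ = 0 := by
  obtain ⟨h21, h10, h0c⟩ := he
  have hk := hw.k_pos
  have hpi : 0 < 2 * Real.pi := by positivity
  have hc : Continuous w.η := hw.contDiff_η.continuous
  have hcpt : IsCompact (Set.Icc 0 (2 * Real.pi)) := isCompact_Icc
  have hne : (Set.Icc 0 (2 * Real.pi)).Nonempty := ⟨0, le_rfl, hpi.le⟩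
  obtain ⟨a, -, ha⟩ := hcpt.exists_isMaxOn hne hc.continuousOn
  obtain ⟨b, -, hb⟩ := hcpt.exists_isMinOn hne hc.continuousOn
  have hred : ∀ θ, ∃ t ∈ Set.Icc 0 (2 * Real.pi), w.η θ = w.η t := fun θ => by
    obtain ⟨t, ht, h⟩ := hw.η_periodic.exists_mem_Ico₀ hpi θ
    exact ⟨t, ⟨ht.1, ht.2.le⟩, h⟩
  have hmax : ∀ θ, w.η θ ≤ w.η a := fun θ => by
    obtain ⟨t, ht, h⟩ := hred θ
    rw [h]; exact ha ht
  have hmin : ∀ θ, w.η b ≤ w.η θ := fun θ => by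
    obtain ⟨t, ht, h⟩ := hred θ
    rw [h]; exact hb ht
  have hda : deriv w.η a = 0 := IsLocalMax.deriv_eq_zero (Eventually.of_forall hmax)
  have hdb : deriv w.η b = 0 := IsLocalMin.deriv_eq_zero (Eventually.of_forall hmin)
  have hroot : ∀ θ, deriv w.η θ = 0 → w.η θ = e 0 ∨ w.η θ = e 1 ∨ w.η θ = e 2 := fun θ hθ => by
    have h := hw.first_integral θ
    rw [hθ] at h
    have h' : (w.η θ - e 0) * (w.η θ - e 1) * (w.η θ - e 2) = 0 := by linarith
    rcases mul_eq_zero.1 h' with h' | h'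
    · rcases mul_eq_zero.1 h' with h' | h'
      · exact Or.inl (by linarith)
      · exact Or.inr (Or.inl (by linarith))
    · exact Or.inr (Or.inr (by linarith))
  have hlt : w.η b < w.η a := by
    obtain ⟨θ₀, hθ₀⟩ := hw.exists_deriv_ne_zero
    refine lt_of_le_of_ne (hmin a) fun h => hθ₀ ?_
    have : w.η = fun _ => w.η a := funext fun θ => le_antisymm (hmax θ) (h ▸ hmin θ)
    rw [this]; simp
  -- the gap between `e²` and `e¹` is forbidden
  have hgap : ¬ (w.η b ≤ (e 1 + e 2) / 2 ∧ (e 1 + e 2) / 2 ≤ w.η a) := fun ⟨h1, h2⟩ => by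
    obtain ⟨θ, hθ⟩ := mem_range_of_exists_le_of_exists_ge hc ⟨b, h1⟩ ⟨a, h2⟩
    have h := hw.first_integral θ
    rw [hθ, phaseVel_riemann] at h
    have h3 : 0 ≤ w.k ^ 2 * (2 * ν + (e 0 + e 1 + e 2) - (e 1 + e 2) / 2) * deriv w.η θ ^ 2 :=
      mul_nonneg (mul_nonneg (sq_nonneg _) (by linarith)) (sq_nonneg _)
    have h4 : 0 < ((e 1 + e 2) / 2 - e 0) * ((e 1 + e 2) / 2 - e 1) * ((e 1 + e 2) / 2 - e 2) :=
      mul_pos (mul_pos_of_neg_of_neg (by linarith) (by linarith)) (by linarith)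
    linarith
  have hab : w.η a = e 0 ∧ w.η b = e 1 := by
    rcases hroot a hda with h | h | h <;> rcases hroot b hdb with h' | h' | h' <;>
      rw [h, h'] at hlt hgap <;> first
        | exact ⟨h, h'⟩
        | (exfalso; linarith)
        | (exfalso; exact hgap ⟨by linarith, by linarith⟩)
  exact ⟨fun θ => ⟨hab.2 ▸ hmin θ, hab.1 ▸ hmax θ⟩, a, hab.1, hda⟩

/-- Every one-phase wave is a translate of the model wave. -/
theorem exists_translate (hw : IsOnePhaseWave ν e w) (he : e ∈ rootDomain ν) :
    ∃ θ₀, ∀ x, w.η (w.k * x + θ₀) = wave (riemann_mem he) x := by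
  obtain ⟨hr, θ₀, h0, h0'⟩ := hw.range_η he
  have hk := hw.k_pos
  have c1 : ContDiff ℝ 2 (deriv w.η) := contDiff_deriv (n := 2) hw.contDiff_η
  have hlin : ∀ x, HasDerivAt (fun x => w.k * x + θ₀) w.k x := fun x => by
    simpa using ((hasDerivAt_id x).const_mul w.k).add_const θ₀
  refine ⟨θ₀, eq_wave (riemann_mem he) (y := fun x => w.η (w.k * x + θ₀))
    (y' := fun x => w.k * deriv w.η (w.k * x + θ₀)) (fun x => ?_) (fun x => ?_) (fun x => ?_) ?_ ?_⟩
  · exact (((hw.contDiff_η.differentiable (by norm_num)) _).hasDerivAt.comp x (hlin x)).congr_deriv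
      (mul_comm _ _)
  · refine (((((c1.differentiable (by norm_num)) _).hasDerivAt.comp x (hlin x)).const_mul
      w.k)).congr_deriv ?_
    have h := hw.second_order (w.k * x + θ₀)
    have hpos : 0 < phaseVel ν (riemann e) - w.η (w.k * x + θ₀) := by
      have := (hr (w.k * x + θ₀)).2
      have := he.2.2
      rw [phaseVel_riemann]
      linarith
    rw [eq_div_iff (by positivity)]
    linear_combination h
  · simpa only [root_riemann] using hr _
  · simpa [root_riemann] using h0
  · simp [h0']

/-- The wave number is the reciprocal of the period of the spectral curve. -/
theorem k_mul_perX (hw : IsOnePhaseWave ν e w) (he : e ∈ rootDomain ν) :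
    w.k * perX ν (riemann e) = 1 := by
  obtain ⟨θ₀, h⟩ := hw.exists_translate he
  have hu := riemann_mem he
  have hk := hw.k_pos
  have hX := perX_pos hu
  have hpi := Real.pi_pos
  have h1 : wave hu (2 * Real.pi / w.k) = root (riemann e) 0 := by
    rw [← h, mul_div_cancel₀ _ hk.ne', add_comm, hw.η_periodic, ← wave_zero hu, ← h]
    simp
  obtain ⟨n, hn⟩ := wave_eq_max hu h1
  have hn0 : 0 < n := by
    by_contra hneg
    have h2 : (n : ℝ) ≤ 0 := by exact_mod_cast not_lt.1 hneg
    have h3 : 0 < 2 * Real.pi / w.k := by positivity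
    have h4 : (n : ℝ) * (2 * Real.pi * perX ν (riemann e)) ≤ 0 :=
      mul_nonpos_of_nonpos_of_nonneg h2 (by positivity)
    linarith
  have hper : Function.Periodic w.η (w.k * (2 * Real.pi * perX ν (riemann e))) := fun θ => by
    have h2 := wave_periodic hu ((θ - θ₀) / w.k)
    rw [← h, ← h] at h2
    rw [mul_add, mul_div_cancel₀ _ hk.ne'] at h2
    rw [← sub_add_cancel θ θ₀, ← h2]
    congr 1
    ring
  have hnk : (n : ℝ) * (w.k * (2 * Real.pi * perX ν (riemann e))) = 2 * Real.pi := by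
    rw [mul_left_comm, ← hn]; field_simp
  obtain rfl | hn2 := (show n = 1 ∨ 2 ≤ n by omega)
  · have : 2 * Real.pi * (w.k * perX ν (riemann e)) = 2 * Real.pi * 1 := by
      rw [← mul_left_comm, mul_one]
      simpa using hnk
    exact mul_left_cancel₀ (by positivity) this
  · exfalso
    lift n to ℕ using hn0.le
    exact hw.not_periodic_η (by exact_mod_cast hn2) (by exact_mod_cast hnk) hper

/-- Averages over the phase are averages over the cycle of the spectral curve. -/
theorem integral_comp_η (hw : IsOnePhaseWave ν e w) (he : e ∈ rootDomain ν) {f : ℝ → ℝ}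
    (hf : Continuous fun τ => f (profileAt ν (riemann e) τ)) :
    ∫ θ in (0 : ℝ)..(2 * Real.pi), f (w.η θ) = w.k * ∫ τ in (0 : ℝ)..(2 * Real.pi),
      f (profileAt ν (riemann e) τ) * densX ν (riemann e) τ := by
  obtain ⟨θ₀, h⟩ := hw.exists_translate he
  have hk := hw.k_pos
  have hper : Function.Periodic (fun θ => f (w.η θ)) (2 * Real.pi) := fun θ => by
    simp only [hw.η_periodic θ]
  rw [← integral_comp_wave (riemann_mem he) hf]
  have h1 := hper.intervalIntegral_add_eq 0 θ₀
  have h2 := intervalIntegral.mul_integral_comp_mul_add (a := 0)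
    (b := 2 * Real.pi * perX ν (riemann e)) (f := fun θ => f (w.η θ)) w.k θ₀
  simp only [h] at h2
  rw [h2, mul_zero, zero_add, mul_left_comm, hw.k_mul_perX he, mul_one, add_comm _ θ₀, ← h1,
      zero_add]

end IsOnePhaseWave

end Travelling

/-! ### Existence of one-phase waves -/

noncomputable section Existence

variable {ν : ℝ} {e : Fin 3 → ℝ}

/-- The model wave, rescaled to period `2π`, is the velocity of a one-phase wave, whose periodic
part
`Φ` is obtained by integrating `η - β`. -/
theorem exists_onePhaseWave (he : e ∈ rootDomain ν) (γ : ℝ) :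
    ∃ w : WaveData, w.γ = γ ∧ IsOnePhaseWave ν e w := by
  have hu := riemann_mem he
  have hpi := Real.pi_pos
  set X := perX ν (riemann e) with hXdef
  have hX : 0 < X := perX_pos hu
  set v : ℝ → ℝ := fun θ => wave hu (X * θ) with hv
  have hvs : ∀ n : ℕ, ContDiff ℝ n v := fun n => (contDiff_wave hu n).comp (by fun_prop)
  have hvp : Function.Periodic v (2 * Real.pi) := fun θ => by
    simp only [hv]
    rw [← wave_periodic hu (X * θ)]
    congr 1
    ring
  set β := (2 * Real.pi)⁻¹ * ∫ θ in (0 : ℝ)..(2 * Real.pi), v θ with hβ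
  set Ψ : ℝ → ℝ := fun θ => X * ∫ σ in (0 : ℝ)..θ, (v σ - β) with hΨ
  have hvc : Continuous fun σ => v σ - β := (hvs 0).continuous.sub continuous_const
  have hΨd : ∀ θ, HasDerivAt Ψ (X * (v θ - β)) θ := fun θ =>
    (intervalIntegral.integral_hasDerivAt_right (hvc.intervalIntegrable _ _)
      hvc.aestronglyMeasurable.stronglyMeasurableAtFilter hvc.continuousAt).const_mul X
  set m := (2 * Real.pi)⁻¹ * ∫ θ in (0 : ℝ)..(2 * Real.pi), Ψ θ with hm
  have hΦd : ∀ θ, HasDerivAt (fun θ => Ψ θ - m) (X * (v θ - β)) θ := fun θ => (hΨd θ).sub_const m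
  have hΨc : Continuous Ψ := continuous_iff_continuousAt.2 fun θ => (hΨd θ).continuousAt
  refine ⟨⟨X⁻¹, phaseVel ν (riemann e) * X⁻¹, β, γ, fun θ => Ψ θ - m⟩, rfl, ?_⟩
  set w : WaveData := ⟨X⁻¹, phaseVel ν (riemann e) * X⁻¹, β, γ, fun θ => Ψ θ - m⟩ with hw
  have hη : w.η = v := funext fun θ => by
    simp only [WaveData.η, hw, (hΦd θ).deriv]
    field_simp
    ring
  have hlin : ∀ θ, HasDerivAt (fun θ => X * θ) X θ := fun θ => by
    simpa using (hasDerivAt_id θ).const_mul X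
  have hv1 : deriv v = fun θ => X * waveD hu (X * θ) := funext fun θ =>
    ((hasDerivAt_wave hu _).comp θ (hlin θ)).deriv.trans (mul_comm _ _)
  have hv2 : deriv (deriv v) = fun θ => X * (X * ((waveD hu (X * θ) ^ 2
      - cubicD (riemann e) (wave hu (X * θ))) / (2 * (phaseVel ν (riemann e) - wave hu (X
          * θ))))) :=
    funext fun θ => by
      rw [hv1]
      exact ((((hasDerivAt_waveD hu _).comp θ (hlin θ)).const_mul X).congr_deriv (by ring)).deriv
  have hc : w.ω / w.k = phaseVel ν (riemann e) := by simp only [hw]; field_simp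
  refine ⟨inv_pos.2 hX, ?_, ?_, ?_, ?_, ?_, ?_⟩
  · have : ContDiff ℝ ((3 : ℕ) + 1) (fun θ => Ψ θ - m) := by
      rw [contDiff_succ_iff_deriv]
      refine ⟨fun θ => (hΦd θ).differentiableAt, by simp, ?_⟩
      rw [show deriv (fun θ => Ψ θ - m) = fun θ => X * (v θ - β) from funext fun θ => (hΦd θ).deriv]
      exact contDiff_const.mul ((hvs 3).sub contDiff_const)
    exact_mod_cast this
  · intro θ
    have hi : ∀ a b, IntervalIntegrable (fun σ => v σ - β) MeasureTheory.volume a b :=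
      fun a b => hvc.intervalIntegrable a b
    have h1 : ∫ σ in θ..(θ + 2 * Real.pi), (v σ - β) = 0 := by
      have hp : Function.Periodic (fun σ => v σ - β) (2 * Real.pi) := fun σ => by simp only [hvp σ]
      rw [hp.intervalIntegral_add_eq θ 0, zero_add, intervalIntegral.integral_sub
        ((hvs 0).continuous.intervalIntegrable _ _) intervalIntegrable_const, hβ]
      simp
      field_simp
      ring
    have h2 := intervalIntegral.integral_add_adjacent_intervals (hi 0 θ) (hi θ (θ + 2 * Real.pi))
    simp only [hw, hΨ]
    rw [← h2, h1, add_zero]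
  · intro T hT0 hT hp
    have h1 : v T = v 0 := by
      have h2 : deriv w.Φ T = deriv w.Φ 0 := by
        conv_rhs => rw [← funext hp]
        rw [deriv_comp_add_const, zero_add]
      simp only [hw, (hΦd _).deriv] at h2
      linarith [mul_left_cancel₀ hX.ne' h2]
    have h3 : wave hu (X * T) = root (riemann e) 0 := by
      rw [← wave_zero hu]; simpa [hv] using h1
    obtain ⟨n, hn⟩ := wave_eq_max hu h3
    have h4 : T = n * (2 * Real.pi) := by
      have : X * T = X * (n * (2 * Real.pi)) := by rw [hn]; ring
      exact mul_left_cancel₀ hX.ne' this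
    rw [h4] at hT0 hT
    have h5 : (0 : ℝ) < n := pos_of_mul_pos_left hT0 (by positivity)
    have h6 : (n : ℝ) < 1 := by
      by_contra h
      nlinarith
    have h7 : 0 < n := by exact_mod_cast h5
    have h8 : n < 1 := by exact_mod_cast h6
    omega
  · simp only [hw]
    rw [intervalIntegral.integral_sub (hΨc.intervalIntegrable _ _) intervalIntegrable_const, hm]
    simp
    field_simp
    ring
  · rw [hη]
    refine (solvesCH_iff (hvs 3) (inv_pos.2 hX).ne' _).2
      ⟨-(e 0 * e 1 + e 0 * e 2 + e 1 * e 2), fun θ => ?_⟩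
    have hpos := phaseVel_sub_wave_pos hu (X * θ)
    unfold travelEnergy
    rw [hc, hv2, hv1]
    simp only [hv, cubicD, root_riemann]
    have h2 : 2 * ν - phaseVel ν (riemann e) = -(e 0 + e 1 + e 2) := by
      rw [phaseVel_riemann]; ring
    rw [h2]
    field_simp
    ring
  · refine ⟨e 0 * e 1 * e 2 / 2, (e 0 * e 1 + e 0 * e 2 + e 1 * e 2) / 2, fun θ => ?_, fun z => ?_⟩
    · have h := wave_first_integral hu (X * θ)
      have h2 : 2 * ν - phaseVel ν (riemann e) = -(e 0 + e 1 + e 2) := by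
        rw [phaseVel_riemann]; ring
      rw [hη, hc, hv1, h2]
      simp only [root_riemann] at h
      simp only [hv, hw]
      field_simp
      linear_combination h
    · rw [hc, phaseVel_riemann]; ring

end Existence

/-! ### The averaged Lagrangian -/

noncomputable section Averaging

variable {ν : ℝ} {e : Fin 3 → ℝ} {w : WaveData}

/-- The mean of a function of the phase over a period. -/
def mean (f : ℝ → ℝ) : ℝ := (2 * Real.pi)⁻¹ * ∫ θ in (0 : ℝ)..(2 * Real.pi), f θ

theorem mean_add {f g : ℝ → ℝ} (hf : Continuous f) (hg : Continuous g) :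
    mean (fun θ => f θ + g θ) = mean f + mean g := by
  unfold mean
  rw [intervalIntegral.integral_add (hf.intervalIntegrable _ _) (hg.intervalIntegrable _ _),
      mul_add]

theorem mean_const_mul (a : ℝ) (f : ℝ → ℝ) : mean (fun θ => a * f θ) = a * mean f := by
  unfold mean
  rw [intervalIntegral.integral_const_mul, mul_left_comm]

theorem mean_const (a : ℝ) : mean (fun _ => a) = a := by
  have := Real.pi_pos
  simp [mean]
  field_simp

/-- Derivatives of periodic functions have zero mean. -/
theorem mean_deriv {f f' : ℝ → ℝ} (h : ∀ θ, HasDerivAt f (f' θ) θ) (hf' : Continuous f')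
    (hp : f (2 * Real.pi) = f 0) : mean f' = 0 := by
  unfold mean
  rw [intervalIntegral.integral_eq_sub_of_hasDerivAt (fun θ _ => h θ) (hf'.intervalIntegrable _ _),
      hp]
  simp

/-- The moments of `Φ'` and `Φ''` of which the averaged Lagrangian is a polynomial:
the mean of `Φ' ^ 2`. -/
def momSq (Φ : ℝ → ℝ) : ℝ := mean fun θ => deriv Φ θ ^ 2

/-- The mean of `Φ' ^ 3`. -/
def momCube (Φ : ℝ → ℝ) : ℝ := mean fun θ => deriv Φ θ ^ 3

/-- The mean of `Φ'' ^ 2`. -/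
def momGrad (Φ : ℝ → ℝ) : ℝ := mean fun θ => deriv (deriv Φ) θ ^ 2

/-- The mean of `Φ' Φ'' ^ 2`. -/
def momMixed (Φ : ℝ → ℝ) : ℝ := mean fun θ => deriv Φ θ * deriv (deriv Φ) θ ^ 2

/-- The mean of a differential polynomial in `Φ'`: the terms with coefficients `l`, `t₀`, `t₁`, `t₂`
add up to the derivative of `l Φ + (t₀ + t₁ Φ' + t₂ Φ' ^ 2) Φ''`. -/
theorem mean_diffPoly {Φ F : ℝ → ℝ} (hΦ : ContDiff ℝ 3 Φ) (hp : Function.Periodic Φ (2 * Real.pi))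
    (c₀ c₁ c₂ c₃ c₄ l t₀ t₁ t₂ : ℝ)
    (hF : ∀ θ, F θ = c₀ + c₁ * deriv Φ θ ^ 2 + c₂ * deriv (deriv Φ) θ ^ 2 + c₃ * deriv Φ θ ^ 3
      + c₄ * (deriv Φ θ * deriv (deriv Φ) θ ^ 2)
      + (l * deriv Φ θ + (t₁ + 2 * t₂ * deriv Φ θ) * deriv (deriv Φ) θ ^ 2
        + (t₀ + t₁ * deriv Φ θ + t₂ * deriv Φ θ ^ 2) * deriv (deriv (deriv Φ)) θ)) :
    mean F = c₀ + c₁ * momSq Φ + c₂ * momGrad Φ + c₃ * momCube Φ + c₄ * momMixed Φ := by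
  have s1 : ContDiff ℝ 2 (deriv Φ) := contDiff_deriv (n := 2) hΦ
  have s2 : ContDiff ℝ 1 (deriv (deriv Φ)) := contDiff_deriv (n := 1) s1
  have s3 : ContDiff ℝ 0 (deriv (deriv (deriv Φ))) := contDiff_deriv (n := 0) s2
  have k1 := s1.continuous
  have k2 := s2.continuous
  have k3 := s3.continuous
  have h0 := fun θ => ((hΦ.differentiable (by norm_num)) θ).hasDerivAt
  have h1 := fun θ => ((s1.differentiable (by norm_num)) θ).hasDerivAt
  have h2 := fun θ => ((s2.differentiable (by norm_num)) θ).hasDerivAt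
  have hp1 : Function.Periodic (deriv Φ) (2 * Real.pi) := fun θ => by
    rw [← deriv_comp_add_const, funext hp]
  have hp2 : Function.Periodic (deriv (deriv Φ)) (2 * Real.pi) := fun θ => by
    rw [← deriv_comp_add_const, funext hp1]
  have hex : mean (fun θ => l * deriv Φ θ + (t₁ + 2 * t₂ * deriv Φ θ) * deriv (deriv Φ) θ ^ 2
      + (t₀ + t₁ * deriv Φ θ + t₂ * deriv Φ θ ^ 2) * deriv (deriv (deriv Φ)) θ) = 0 := by
    refine mean_deriv (f := fun θ => l * Φ θ
      + (t₀ + t₁ * deriv Φ θ + t₂ * deriv Φ θ ^ 2) * deriv (deriv Φ) θ) (fun θ => ?_)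
          (by fun_prop) ?_
    · have h := ((h0 θ).const_mul l).add (((((h1 θ).const_mul t₁).const_add t₀).add
        (((h1 θ).pow 2).const_mul t₂)).mul (h2 θ))
      refine HasDerivAt.congr_deriv h ?_
      simp
      ring
    · have e0 := hp 0
      have e1 := hp1 0
      have e2 := hp2 0
      rw [zero_add] at e0 e1 e2
      simp only [e0, e1, e2]
  rw [funext hF, mean_add (by fun_prop) (by fun_prop), hex, mean_add (by fun_prop) (by fun_prop),
    mean_add (by fun_prop) (by fun_prop), mean_add (by fun_prop) (by fun_prop),
    mean_add (by fun_prop) (by fun_prop), mean_const, mean_const_mul, mean_const_mul,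
    mean_const_mul, mean_const_mul, add_zero]
  rfl

/-- The averaged Lagrangian is a polynomial in `(k, ω, β, γ)` and four moments of the profile. -/
theorem avgLagrangian_eq {Φ : ℝ → ℝ} (hΦ : ContDiff ℝ 3 Φ)
    (hp : Function.Periodic Φ (2 * Real.pi)) (ν k ω β γ : ℝ) :
    avgLagrangian ν k ω β γ Φ = β * γ / 2 - β ^ 3 / 2 - ν * β ^ 2
      + (k * ω / 2 - 3 / 2 * β * k ^ 2 - ν * k ^ 2) * momSq Φ
      + (k ^ 3 * ω / 2 - β * k ^ 4 / 2) * momGrad Φ - k ^ 3 / 2 * momCube Φ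
      - k ^ 5 / 2 * momMixed Φ := by
  have h3 : iteratedDeriv 3 Φ = deriv (deriv (deriv Φ)) := by
    simp [iteratedDeriv_succ, iteratedDeriv_zero]
  rw [show avgLagrangian ν k ω β γ Φ = mean fun θ => lagrangian ν (β + k * deriv Φ θ)
    (k ^ 3 * iteratedDeriv 3 Φ θ) (-γ - ω * deriv Φ θ) from rfl,
    mean_diffPoly hΦ hp (β * γ / 2 - β ^ 3 / 2 - ν * β ^ 2)
      (k * ω / 2 - 3 / 2 * β * k ^ 2 - ν * k ^ 2) (k ^ 3 * ω / 2 - β * k ^ 4 / 2) (-(k ^ 3 / 2))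
      (-(k ^ 5 / 2)) ((β * ω + k * γ) / 2 - 3 / 2 * β ^ 2 * k - 2 * ν * β * k)
      (k ^ 3 * (-γ / 2 + β ^ 2 / 4)) (k ^ 3 * (-ω / 2 + β * k / 2)) (k ^ 5 / 4) fun θ => ?_]
  · ring
  · rw [h3]
    unfold lagrangian
    ring

theorem densI_eq {u : Fin 3 → ℝ} (hu : u ∈ riemannDomain ν) (τ : ℝ) :
    densI ν u τ = -((profileAt ν u τ - root u 0) * (profileAt ν u τ - root u 1)
      * (profileAt ν u τ - root u 2)) * densX ν u τ := by
  obtain ⟨s, t, hs, ht, hs1, ht1, hp, hν, h2⟩ := exists_sqrt_coords hu τ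
  simp only [densI, densX, profileAt, phaseVel, root]
  rw [hs1, ht1, hp, hν, h2]
  field_simp
  ring

theorem densZ_eq {u : Fin 3 → ℝ} (hu : u ∈ riemannDomain ν) (τ : ℝ) :
    densZ ν u τ = 1 / 2 * (-((profileAt ν u τ - root u 0) * (profileAt ν u τ - root u 1)
      * (profileAt ν u τ - root u 2)) / (phaseVel ν u - profileAt ν u τ) + profileAt ν u τ ^ 2)
      * densX ν u τ := by
  obtain ⟨s, t, hs, ht, hs1, ht1, hp, hν, h2⟩ := exists_sqrt_coords hu τ
  simp only [densZ, densX, profileAt, phaseVel, root]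
  rw [hs1, ht1, hp, hν, h2, sub_sub_cancel]
  field_simp
  ring

namespace IsOnePhaseWave

theorem contDiff_Φ (hw : IsOnePhaseWave ν e w) : ContDiff ℝ 3 w.Φ := hw.contDiff.of_le (by norm_num)

theorem deriv_η (hw : IsOnePhaseWave ν e w) : deriv w.η = fun θ => w.k * deriv (deriv w.Φ) θ := by
  funext θ
  have h := ((hw.contDiff_deriv_Φ.differentiable (by norm_num)) θ).hasDerivAt
  exact ((h.const_mul w.k).const_add w.β).deriv

theorem deriv_deriv_η (hw : IsOnePhaseWave ν e w) :
    deriv (deriv w.η) = fun θ => w.k * deriv (deriv (deriv w.Φ)) θ := by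
  rw [hw.deriv_η]
  exact funext fun θ => deriv_const_mul_field _

/-- The second order equation averaged over a period. -/
theorem mean_second_order (hw : IsOnePhaseWave ν e w) :
    w.k ^ 4 * momGrad w.Φ + 3 * (w.β ^ 2 + w.k ^ 2 * momSq w.Φ) - 2 * (e 0 + e 1 + e 2) * w.β
      + (e 0 * e 1 + e 0 * e 2 + e 1 * e 2) = 0 := by
  set c := phaseVel ν (riemann e) with hc
  have h := mean_diffPoly (F := fun _ => 0) hw.contDiff_Φ hw.periodic
    (3 * w.β ^ 2 - 2 * (e 0 + e 1 + e 2) * w.β + (e 0 * e 1 + e 0 * e 2 + e 1 * e 2)) (3 * w.k ^ 2)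
    (w.k ^ 4) 0 0 (w.k * (6 * w.β - 2 * (e 0 + e 1 + e 2)))
    (2 * w.k ^ 3 * (c - w.β)) (-2 * w.k ^ 4) 0 fun θ => by
      have h := hw.second_order θ
      rw [hw.deriv_deriv_η, hw.deriv_η, ← hc] at h
      simp only [cubicD, root_riemann, WaveData.η] at h
      linear_combination -h
  rw [mean_const] at h
  linear_combination -h

/-- The second order equation multiplied by `η - β` and averaged over a period. -/
theorem mean_second_order_mul (hw : IsOnePhaseWave ν e w) :
    -2 * w.k ^ 4 * (phaseVel ν (riemann e) - w.β) * momGrad w.Φ + 3 * w.k ^ 5 * momMixed w.Φ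
      + (6 * w.β - 2 * (e 0 + e 1 + e 2)) * w.k ^ 2 * momSq w.Φ + 3 * w.k ^ 3 * momCube w.Φ =
          0 := by
  set c := phaseVel ν (riemann e) with hc
  have h := mean_diffPoly (F := fun _ => 0) hw.contDiff_Φ hw.periodic
    0 ((6 * w.β - 2 * (e 0 + e 1 + e 2)) * w.k ^ 2) (-2 * w.k ^ 4 * (c - w.β)) (3 * w.k ^ 3)
    (3 * w.k ^ 5)
    (w.k * (3 * w.β ^ 2 - 2 * (e 0 + e 1 + e 2) * w.β + (e 0 * e 1 + e 0 * e 2 + e 1 * e 2)))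
    0 (2 * w.k ^ 4 * (c - w.β)) (-2 * w.k ^ 5) fun θ => by
      have h := hw.second_order θ
      rw [hw.deriv_deriv_η, hw.deriv_η, ← hc] at h
      simp only [cubicD, root_riemann, WaveData.η] at h
      linear_combination -(w.k * deriv w.Φ θ) * h
  rw [mean_const] at h
  linear_combination -h

/-- The first integral averaged over a period. -/
theorem mean_first_integral (hw : IsOnePhaseWave ν e w) :
    w.k ^ 4 * ((phaseVel ν (riemann e) - w.β) * momGrad w.Φ - w.k * momMixed w.Φ)
      + (w.β ^ 3 + 3 * w.β * w.k ^ 2 * momSq w.Φ + w.k ^ 3 * momCube w.Φ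
        - (e 0 + e 1 + e 2) * (w.β ^ 2 + w.k ^ 2 * momSq w.Φ)
        + (e 0 * e 1 + e 0 * e 2 + e 1 * e 2) * w.β - e 0 * e 1 * e 2) = 0 := by
  set c := phaseVel ν (riemann e) with hc
  have h := mean_diffPoly (F := fun _ => 0) hw.contDiff_Φ hw.periodic
    (w.β ^ 3 - (e 0 + e 1 + e 2) * w.β ^ 2 + (e 0 * e 1 + e 0 * e 2 + e 1 * e 2) * w.β
      - e 0 * e 1 * e 2)
    (3 * w.β * w.k ^ 2 - (e 0 + e 1 + e 2) * w.k ^ 2) (w.k ^ 4 * (c - w.β)) (w.k ^ 3) (-w.k ^ 5)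
    (w.k * (3 * w.β ^ 2 - 2 * (e 0 + e 1 + e 2) * w.β + (e 0 * e 1 + e 0 * e 2 + e 1 * e 2)))
    0 0 0 fun θ => by
      have h := hw.first_integral θ
      rw [hw.deriv_η, ← hc] at h
      simp only [WaveData.η] at h
      linear_combination -h
  rw [mean_const] at h
  linear_combination -h

theorem mean_comp_η (hw : IsOnePhaseWave ν e w) (he : e ∈ rootDomain ν) {f : ℝ → ℝ}
    (hf : Continuous fun τ => f (profileAt ν (riemann e) τ)) :
    mean (fun θ => f (w.η θ))
      = w.k * mean fun τ => f (profileAt ν (riemann e) τ) * densX ν (riemann e) τ := by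
  unfold mean
  rw [hw.integral_comp_η he hf]
  ring

theorem β_eq (hw : IsOnePhaseWave ν e w) (he : e ∈ rootDomain ν) :
    w.β = -w.k * perY ν (riemann e) := by
  have h1 := hw.mean_comp_η he (f := fun y => y) (contDiff_profileAt ν _ (n := 0)).continuous
  have h2 := mean_diffPoly (F := w.η) hw.contDiff_Φ hw.periodic w.β 0 0 0 0 w.k 0 0 0 fun θ => by
    simp only [WaveData.η]; ring
  have h3 : perY ν (riemann e)
      = -mean fun τ => profileAt ν (riemann e) τ * densX ν (riemann e) τ := by
    rw [neg_eq_neg_one_mul, ← mean_const_mul]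
    unfold perY mean
    congr 2
    funext τ
    simp only [densY, densX, profileAt]
    ring
  rw [h3]
  linear_combination h1 - h2

/-- The mean of the first integral, read once in the angle of the cycle and once in the phase. -/
theorem perI_eq (hw : IsOnePhaseWave ν e w) (he : e ∈ rootDomain ν) :
    perI ν (riemann e)
      = w.k ^ 3 * ((phaseVel ν (riemann e) - w.β) * momGrad w.Φ - w.k * momMixed w.Φ) := by
  have hu := riemann_mem he
  have hk := hw.k_pos
  have hcp := (contDiff_profileAt ν (riemann e) (n := 0)).continuous
  have h1 := hw.mean_comp_η he (f := fun y => -((y - e 0) * (y - e 1) * (y - e 2))) (by fun_prop)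
  have h2 := mean_diffPoly (F := fun θ => -((w.η θ - e 0) * (w.η θ - e 1) * (w.η θ - e 2)))
    hw.contDiff_Φ hw.periodic 0 0 (w.k ^ 4 * (phaseVel ν (riemann e) - w.β)) 0 (-w.k ^ 5) 0 0 0 0
    fun θ => by
      have h := hw.first_integral θ
      rw [hw.deriv_η] at h
      simp only [WaveData.η] at h ⊢
      linear_combination -h
  have h3 : perI ν (riemann e) = mean fun τ => -((profileAt ν (riemann e) τ - e 0)
      * (profileAt ν (riemann e) τ - e 1) * (profileAt ν (riemann e) τ - e 2))
        * densX ν (riemann e) τ := by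
    unfold perI mean
    congr 2
    funext τ
    rw [densI_eq hu]
    simp only [root_riemann]
  rw [← h3, h2] at h1
  apply mul_left_cancel₀ hk.ne'
  linear_combination -h1

theorem perZ_eq (hw : IsOnePhaseWave ν e w) (he : e ∈ rootDomain ν) :
    2 * w.k * perZ ν (riemann e)
      = w.k ^ 4 * momGrad w.Φ + w.β ^ 2 + w.k ^ 2 * momSq w.Φ := by
  have hu := riemann_mem he
  have hk := hw.k_pos
  have hcp := (contDiff_profileAt ν (riemann e) (n := 0)).continuous
  have hpos : ∀ τ, phaseVel ν (riemann e) - profileAt ν (riemann e) τ ≠ 0 := fun τ => by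
    have := cycleP_pos hu τ
    simp only [profileAt, sub_sub_cancel]
    positivity
  have hpos' : ∀ θ, phaseVel ν (riemann e) - w.η θ ≠ 0 := fun θ => by
    have h1 := ((hw.range_η he).1 θ).2
    have h2 := he.2.2
    rw [phaseVel_riemann]
    linarith
  have h1 := hw.mean_comp_η he (f := fun y => 1 / 2 * (-((y - e 0) * (y - e 1) * (y - e 2))
    / (phaseVel ν (riemann e) - y) + y ^ 2)) (by
      refine continuous_const.mul (Continuous.add (Continuous.div ?_ ?_ hpos) ?_) <;> fun_prop)
  have h2 := mean_diffPoly (F := fun θ => 1 / 2 * (-((w.η θ - e 0) * (w.η θ - e 1) * (w.η θ - e 2))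
      / (phaseVel ν (riemann e) - w.η θ) + w.η θ ^ 2))
    hw.contDiff_Φ hw.periodic (w.β ^ 2 / 2) (w.k ^ 2 / 2) (w.k ^ 4 / 2) 0 0 (w.β * w.k) 0 0 0
    fun θ => by
      rw [← hw.first_integral θ, mul_right_comm, mul_div_cancel_right₀ _ (hpos' θ), hw.deriv_η]
      simp only [WaveData.η]
      ring
  have h3 : perZ ν (riemann e) = mean fun τ => 1 / 2 * (-((profileAt ν (riemann e) τ - e 0)
      * (profileAt ν (riemann e) τ - e 1) * (profileAt ν (riemann e) τ - e 2))
        / (phaseVel ν (riemann e) - profileAt ν (riemann e) τ) + profileAt ν (riemann e) τ ^ 2)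
        * densX ν (riemann e) τ := by
    unfold perZ mean
    congr 2
    funext τ
    rw [densZ_eq hu]
    simp only [root_riemann]
  rw [← h3, h2] at h1
  linear_combination -2 * h1

theorem avgL_ω_eq (hw : IsOnePhaseWave ν e w) :
    w.avgL_ω ν = w.k / 2 * momSq w.Φ + w.k ^ 3 / 2 * momGrad w.Φ := by
  unfold WaveData.avgL_ω
  simp only [avgLagrangian_eq hw.contDiff_Φ hw.periodic]
  refine HasDerivAt.deriv ?_
  have h := hasDerivAt_id w.ω
  have h1 := ((((((h.const_mul w.k).div_const 2).sub_const (3 / 2 * w.β * w.k ^ 2)).sub_const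
    (ν * w.k ^ 2)).mul_const (momSq w.Φ)).const_add (w.β * w.γ / 2 - w.β ^ 3 / 2 - ν * w.β ^ 2)).add
    ((((h.const_mul (w.k ^ 3)).div_const 2).sub_const (w.β * w.k ^ 4 / 2)).mul_const (momGrad w.Φ))
  exact HasDerivAt.congr_deriv ((h1.sub_const (w.k ^ 3 / 2 * momCube w.Φ)).sub_const
    (w.k ^ 5 / 2 * momMixed w.Φ)) (by ring)

theorem avgL_γ_eq (hw : IsOnePhaseWave ν e w) : w.avgL_γ ν = w.β / 2 := by
  unfold WaveData.avgL_γ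
  simp only [avgLagrangian_eq hw.contDiff_Φ hw.periodic]
  refine HasDerivAt.deriv ?_
  have h1 := (((((((hasDerivAt_id w.γ).const_mul w.β).div_const 2).sub_const (w.β ^ 3
      / 2)).sub_const
    (ν * w.β ^ 2)).add_const ((w.k * w.ω / 2 - 3 / 2 * w.β * w.k ^ 2 - ν * w.k ^ 2)
      * momSq w.Φ)).add_const ((w.k ^ 3 * w.ω / 2 - w.β * w.k ^ 4 / 2) * momGrad w.Φ))
  exact HasDerivAt.congr_deriv ((h1.sub_const (w.k ^ 3 / 2 * momCube w.Φ)).sub_const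
    (w.k ^ 5 / 2 * momMixed w.Φ)) (by ring)

theorem avgL_β_eq (hw : IsOnePhaseWave ν e w) :
    w.avgL_β ν = w.γ / 2 - phaseVel ν (riemann e) * w.β
      + (e 0 * e 1 + e 0 * e 2 + e 1 * e 2) / 2 := by
  unfold WaveData.avgL_β
  simp only [avgLagrangian_eq hw.contDiff_Φ hw.periodic]
  refine HasDerivAt.deriv ?_
  have h := hasDerivAt_id w.β
  have h1 := (((((h.mul_const w.γ).div_const 2).sub ((h.pow 3).div_const 2)).sub
    ((h.pow 2).const_mul ν)).add (((((h.const_mul (3 / 2)).mul_const (w.k ^ 2)).const_sub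
      (w.k * w.ω / 2)).sub_const (ν * w.k ^ 2)).mul_const (momSq w.Φ))).add
      ((((h.mul_const (w.k ^ 4)).div_const 2).const_sub (w.k ^ 3 * w.ω
          / 2)).mul_const (momGrad w.Φ))
  refine HasDerivAt.congr_deriv ((h1.sub_const (w.k ^ 3 / 2 * momCube w.Φ)).sub_const
    (w.k ^ 5 / 2 * momMixed w.Φ)) ?_
  have h2 := hw.mean_second_order
  rw [phaseVel_riemann]
  simp
  linear_combination -(1 / 2) * h2

theorem avgL_k_eq (hw : IsOnePhaseWave ν e w) (he : e ∈ rootDomain ν) :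
    w.avgL_k ν = perI ν (riemann e) - phaseVel ν (riemann e) * w.avgL_ω ν := by
  rw [hw.avgL_ω_eq, hw.perI_eq he]
  unfold WaveData.avgL_k
  simp only [avgLagrangian_eq hw.contDiff_Φ hw.periodic]
  refine HasDerivAt.deriv ?_
  have h := hasDerivAt_id w.k
  have h1 := (((((h.mul_const w.ω).div_const 2).sub ((h.pow 2).const_mul (3 / 2 * w.β))).sub
    ((h.pow 2).const_mul ν)).mul_const (momSq w.Φ)).const_add
      (w.β * w.γ / 2 - w.β ^ 3 / 2 - ν * w.β ^ 2)
  have h2 := ((((h.pow 3).mul_const w.ω).div_const 2).sub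
    (((h.pow 4).const_mul w.β).div_const 2)).mul_const (momGrad w.Φ)
  have h3 := ((h.pow 3).div_const 2).mul_const (momCube w.Φ)
  have h4 := ((h.pow 5).div_const 2).mul_const (momMixed w.Φ)
  refine HasDerivAt.congr_deriv (((h1.add h2).sub h3).sub h4) ?_
  have h5 := hw.mean_second_order_mul
  have h6 := hw.ω_eq
  rw [h6]
  rw [phaseVel_riemann] at h5 ⊢
  simp
  apply mul_left_cancel₀ hw.k_pos.ne'
  linear_combination -(1 / 2) * h5

/-- The averaged Lagrangian of a wave in terms of the action `I` and the constants `A`, `B`. -/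
theorem avgL_eq (hw : IsOnePhaseWave ν e w) (he : e ∈ rootDomain ν) :
    w.avgL ν = w.γ * w.β / 2 - phaseVel ν (riemann e) * w.β ^ 2 / 2
      + (e 0 * e 1 + e 0 * e 2 + e 1 * e 2) / 2 * w.β - e 0 * e 1 * e 2 / 2
      + w.k * perI ν (riemann e) := by
  unfold WaveData.avgL
  rw [avgLagrangian_eq hw.contDiff_Φ hw.periodic, hw.ω_eq, hw.perI_eq he]
  have h1 := hw.mean_first_integral
  rw [phaseVel_riemann] at h1 ⊢
  linear_combination -(1 / 2) * h1

end IsOnePhaseWave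

end Averaging

/-! ### The modulation variables as functions of the Riemann invariants -/

noncomputable section Modulation

variable {ν : ℝ} {u : Fin 3 → ℝ}

/-- `A = e⁰ e¹ e² / 2` as a function of the Riemann invariants. -/
def constA (u : Fin 3 → ℝ) : ℝ := root u 0 * root u 1 * root u 2 / 2

/-- `B = (e⁰ e¹ + e⁰ e² + e¹ e²) / 2` as a function of the Riemann invariants. -/
def constB (u : Fin 3 → ℝ) : ℝ := (root u 0 * root u 1 + root u 0 * root u 2 + root u 1 * root u 2)
    / 2

/-- The wave number as a function of the Riemann invariants. -/
def fieldK (ν : ℝ) (u : Fin 3 → ℝ) : ℝ := (perX ν u)⁻¹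

/-- The mean velocity as a function of the Riemann invariants. -/
def fieldβ (ν : ℝ) (u : Fin 3 → ℝ) : ℝ := -(perY ν u) / perX ν u

/-- The wave action density `J` as a function of the Riemann invariants. -/
def fieldJ (ν : ℝ) (u : Fin 3 → ℝ) : ℝ := perZ ν u - perY ν u ^ 2 / (2 * perX ν u)

/-- The part of the averaged Lagrangian that does not depend on `γ`. -/
def reducedL (ν : ℝ) (u : Fin 3 → ℝ) : ℝ :=
  -(phaseVel ν u * fieldβ ν u ^ 2 / 2) + constB u * fieldβ ν u - constA u + fieldK ν u * perI ν u

/-- The Hamiltonian density as a function of the Riemann invariants. -/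
def fieldH (ν : ℝ) (u : Fin 3 → ℝ) : ℝ := phaseVel ν u * fieldK ν u * fieldJ ν u - reducedL ν u

/-- The field variables `(k, J, β)` as functions of the Riemann invariants. -/
def fieldCoords (ν : ℝ) (u : Fin 3 → ℝ) : ℝ × ℝ × ℝ := (fieldK ν u, fieldJ ν u, fieldβ ν u)

theorem contDiff_constA {n : WithTop ℕ∞} : ContDiff ℝ n constA := by unfold constA root; fun_prop

theorem contDiff_constB {n : WithTop ℕ∞} : ContDiff ℝ n constB := by unfold constB root; fun_prop

theorem contDiff_phaseVel (ν : ℝ) {n : WithTop ℕ∞} : ContDiff ℝ n (phaseVel ν) := by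
  unfold phaseVel; fun_prop

theorem contDiffOn_fieldK (ν : ℝ) : ContDiffOn ℝ 2 (fieldK ν) (riemannDomain ν) :=
  (contDiffOn_perX ν).inv fun _ hu => (perX_pos hu).ne'

theorem contDiffOn_fieldβ (ν : ℝ) : ContDiffOn ℝ 2 (fieldβ ν) (riemannDomain ν) :=
  (contDiffOn_perY ν).neg.div (contDiffOn_perX ν) fun _ hu => (perX_pos hu).ne'

theorem contDiffOn_fieldJ (ν : ℝ) : ContDiffOn ℝ 2 (fieldJ ν) (riemannDomain ν) :=
  (contDiffOn_perZ ν).sub (((contDiffOn_perY ν).pow 2).div (contDiffOn_const.mul (contDiffOn_perX ν))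
    fun _ hu => (mul_pos two_pos (perX_pos hu)).ne')

theorem contDiffOn_reducedL (ν : ℝ) : ContDiffOn ℝ 2 (reducedL ν) (riemannDomain ν) :=
  (((((contDiff_phaseVel ν).contDiffOn.mul ((contDiffOn_fieldβ ν).pow 2)).div_const 2).neg.add
    (contDiff_constB.contDiffOn.mul (contDiffOn_fieldβ ν))).sub contDiff_constA.contDiffOn).add
    ((contDiffOn_fieldK ν).mul (contDiffOn_perI ν))

theorem contDiffOn_fieldH (ν : ℝ) : ContDiffOn ℝ 2 (fieldH ν) (riemannDomain ν) :=
  (((contDiff_phaseVel ν).contDiffOn.mul (contDiffOn_fieldK ν)).mul (contDiffOn_fieldJ ν)).sub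
    (contDiffOn_reducedL ν)

theorem contDiffOn_fieldCoords (ν : ℝ) : ContDiffOn ℝ 2 (fieldCoords ν) (riemannDomain ν) :=
  (contDiffOn_fieldK ν).prodMk ((contDiffOn_fieldJ ν).prodMk (contDiffOn_fieldβ ν))

theorem differentiableAt_of_contDiffOn {F : Type*} [NormedAddCommGroup F] [NormedSpace ℝ F]
    {f : (Fin 3 → ℝ) → F} (hf : ContDiffOn ℝ 2 f (riemannDomain ν))
    (hu : u ∈ riemannDomain ν) : DifferentiableAt ℝ f u :=
  (hf.contDiffAt ((isOpen_riemannDomain ν).mem_nhds hu)).differentiableAt (by simp)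

theorem hasDerivAt_line {f : (Fin 3 → ℝ) → ℝ} (hf : DifferentiableAt ℝ f u) (v : Fin 3 → ℝ) :
    HasDerivAt (fun σ : ℝ => f (u + σ • v)) (fderiv ℝ f u v) 0 := by
  have h1 : HasFDerivAt f (fderiv ℝ f u) (u + (0 : ℝ) • v) := by simpa using hf.hasFDerivAt
  have h2 : HasDerivAt (fun σ : ℝ => u + σ • v) v 0 := by
    simpa using ((hasDerivAt_id (0 : ℝ)).smul_const v).const_add u
  exact HasFDerivAt.comp_hasDerivAt (l := f) 0 h1 h2

theorem fderiv_eq_sum (f : (Fin 3 → ℝ) → ℝ) (u v : Fin 3 → ℝ) :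
    fderiv ℝ f u v = v 0 * fderiv ℝ f u (Pi.single 0 1) + v 1 * fderiv ℝ f u (Pi.single 1 1)
      + v 2 * fderiv ℝ f u (Pi.single 2 1) := by
  have hv : v = v 0 • Pi.single (0 : Fin 3) (1 : ℝ) + v 1 • Pi.single (1 : Fin 3) (1 : ℝ)
      + v 2 • Pi.single (2 : Fin 3) (1 : ℝ) := by
    ext i; fin_cases i <;> simp
  conv_lhs => rw [hv]
  simp only [map_add, map_smul, smul_eq_mul]

theorem fderiv_phaseVel (ν : ℝ) (u v : Fin 3 → ℝ) : fderiv ℝ (phaseVel ν) u v = v 0 + v 1 + v 2 :=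
  (hasDerivAt_line ((contDiff_phaseVel ν (n := 1)).differentiable (by simp) u) v).unique
    (hasDerivAt_line_phaseVel ν u v)

theorem hasDerivAt_line_root (u v : Fin 3 → ℝ) (i : Fin 3) :
    HasDerivAt (fun σ : ℝ => root (u + σ • v) i) (root v i) 0 :=
  (((hasDerivAt_coord u v 0).add (hasDerivAt_coord u v 1)).add (hasDerivAt_coord u v 2)).sub
    ((hasDerivAt_coord u v i).const_mul 2)

theorem fderiv_constA (u v : Fin 3 → ℝ) :
    fderiv ℝ constA u v = v 0 * gradA u 0 + v 1 * gradA u 1 + v 2 * gradA u 2 := by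
  have h := (hasDerivAt_line ((contDiff_constA (n := 1)).differentiable (by simp) u) v).unique
    ((((hasDerivAt_line_root u v 0).mul (hasDerivAt_line_root u v 1)).mul
      (hasDerivAt_line_root u v 2)).div_const 2)
  rw [h]
  simp [gradA, root]
  ring

theorem fderiv_constB (u v : Fin 3 → ℝ) :
    fderiv ℝ constB u v = v 0 * root u 0 + v 1 * root u 1 + v 2 * root u 2 := by
  have h := (hasDerivAt_line ((contDiff_constB (n := 1)).differentiable (by simp) u) v).unique
    (((((hasDerivAt_line_root u v 0).mul (hasDerivAt_line_root u v 1)).add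
      ((hasDerivAt_line_root u v 0).mul (hasDerivAt_line_root u v 2))).add
        ((hasDerivAt_line_root u v 1).mul (hasDerivAt_line_root u v 2))).div_const 2)
  rw [h]
  simp [root]
  ring

/-- `dI = X dA + Y dB + Z dc`. -/
theorem fderiv_perI_eq (hu : u ∈ riemannDomain ν) (v : Fin 3 → ℝ) :
    fderiv ℝ (perI ν) u v = perX ν u * fderiv ℝ constA u v + perY ν u * fderiv ℝ constB u v
      + perZ ν u * fderiv ℝ (phaseVel ν) u v := by
  rw [fderiv_eq_sum, fderiv_constA, fderiv_constB, fderiv_phaseVel, fderiv_perI_single hu,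
    fderiv_perI_single hu, fderiv_perI_single hu]
  ring

theorem line_phaseVel (ν : ℝ) (u v : Fin 3 → ℝ) :
    HasDerivAt (fun σ : ℝ => phaseVel ν (u + σ • v)) (fderiv ℝ (phaseVel ν) u v) 0 :=
  hasDerivAt_line ((contDiff_phaseVel ν (n := 1)).differentiable (by simp) u) v

section Differentials

variable (hu : u ∈ riemannDomain ν) (v : Fin 3 → ℝ)
include hu

theorem line_perX : HasDerivAt (fun σ : ℝ => perX ν (u + σ • v)) (fderiv ℝ (perX ν) u v) 0 :=
  hasDerivAt_line (differentiableAt_of_contDiffOn (contDiffOn_perX ν) hu) v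

theorem line_perY : HasDerivAt (fun σ : ℝ => perY ν (u + σ • v)) (fderiv ℝ (perY ν) u v) 0 :=
  hasDerivAt_line (differentiableAt_of_contDiffOn (contDiffOn_perY ν) hu) v

theorem line_perZ : HasDerivAt (fun σ : ℝ => perZ ν (u + σ • v)) (fderiv ℝ (perZ ν) u v) 0 :=
  hasDerivAt_line (differentiableAt_of_contDiffOn (contDiffOn_perZ ν) hu) v

theorem line_perI : HasDerivAt (fun σ : ℝ => perI ν (u + σ • v)) (fderiv ℝ (perI ν) u v) 0 :=
  hasDerivAt_line (differentiableAt_of_contDiffOn (contDiffOn_perI ν) hu) v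

theorem line_fieldK : HasDerivAt (fun σ : ℝ => fieldK ν (u + σ • v)) (fderiv ℝ (fieldK ν) u v) 0 :=
  hasDerivAt_line (differentiableAt_of_contDiffOn (contDiffOn_fieldK ν) hu) v

theorem line_fieldβ : HasDerivAt (fun σ : ℝ => fieldβ ν (u + σ • v)) (fderiv ℝ (fieldβ ν) u v) 0 :=
  hasDerivAt_line (differentiableAt_of_contDiffOn (contDiffOn_fieldβ ν) hu) v

theorem line_fieldJ : HasDerivAt (fun σ : ℝ => fieldJ ν (u + σ • v)) (fderiv ℝ (fieldJ ν) u v) 0 :=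
  hasDerivAt_line (differentiableAt_of_contDiffOn (contDiffOn_fieldJ ν) hu) v

theorem fderiv_fieldK :
    fderiv ℝ (fieldK ν) u v = -(fderiv ℝ (perX ν) u v) / perX ν u ^ 2 := by
  have h := (line_perX hu v).inv (by simpa using (perX_pos hu).ne')
  rw [(line_fieldK hu v).unique h]
  simp

theorem fderiv_fieldβ :
    fderiv ℝ (fieldβ ν) u v
      = -(fderiv ℝ (perY ν) u v) / perX ν u + perY ν u * fderiv ℝ (perX ν) u v / perX ν u ^ 2 := by
  have hX := (perX_pos hu).ne'
  have h := (line_perY hu v).neg.div (line_perX hu v) (by simpa using hX)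
  rw [(line_fieldβ hu v).unique h]
  simp
  field_simp

theorem fderiv_fieldJ :
    fderiv ℝ (fieldJ ν) u v = fderiv ℝ (perZ ν) u v - perY ν u * fderiv ℝ (perY ν) u v / perX ν u
      + perY ν u ^ 2 * fderiv ℝ (perX ν) u v / (2 * perX ν u ^ 2) := by
  have hX := (perX_pos hu).ne'
  have h := (line_perZ hu v).sub (((line_perY hu v).pow 2).div ((line_perX hu v).const_mul 2)
    (by simpa using hX))
  rw [(line_fieldJ hu v).unique h]
  simp
  field_simp
  ring

theorem fderiv_phaseVel_mul_fieldK :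
    fderiv ℝ (fun u => phaseVel ν u * fieldK ν u) u v
      = fderiv ℝ (phaseVel ν) u v * fieldK ν u + phaseVel ν u * fderiv ℝ (fieldK ν) u v := by
  have hd : DifferentiableAt ℝ (fun u => phaseVel ν u * fieldK ν u) u :=
    differentiableAt_of_contDiffOn ((contDiff_phaseVel ν).contDiffOn.mul (contDiffOn_fieldK ν)) hu
  rw [(hasDerivAt_line hd v).unique ((line_phaseVel ν u v).mul (line_fieldK hu v))]
  simp

/-- The differential of the averaged Lagrangian at fixed `γ`. -/
theorem fderiv_reducedL :
    fderiv ℝ (reducedL ν) u v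
      = (perI ν u - phaseVel ν u * fieldJ ν u) * fderiv ℝ (fieldK ν) u v
        + fieldJ ν u * fderiv ℝ (fun u => phaseVel ν u * fieldK ν u) u v
        + (constB u - phaseVel ν u * fieldβ ν u) * fderiv ℝ (fieldβ ν) u v := by
  have hX := (perX_pos hu).ne'
  have hA := hasDerivAt_line ((contDiff_constA (n := 1)).differentiable (by simp) u) v
  have hB := hasDerivAt_line ((contDiff_constB (n := 1)).differentiable (by simp) u) v
  have h := ((((((line_phaseVel ν u v).mul ((line_fieldβ hu v).pow 2)).div_const 2).neg).add
    (hB.mul (line_fieldβ hu v))).sub hA).add ((line_fieldK hu v).mul (line_perI hu v))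
  rw [(hasDerivAt_line (differentiableAt_of_contDiffOn (contDiffOn_reducedL ν) hu) v).unique h,
    fderiv_phaseVel_mul_fieldK hu, fderiv_perI_eq hu]
  simp
  have h1 : fieldβ ν u = -perY ν u * fieldK ν u := by
    unfold fieldβ fieldK; rw [div_eq_mul_inv]
  have h2 : perZ ν u = fieldJ ν u + perY ν u ^ 2 * fieldK ν u / 2 := by
    unfold fieldJ fieldK; field_simp; ring
  have h3 : fieldK ν u * perX ν u = 1 := by unfold fieldK; field_simp
  rw [h1, h2]
  linear_combination (fderiv ℝ constA u v) * h3

/-- `dH = (c J - I) dk + ω dJ + (c β - B) dβ`. -/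
theorem fderiv_fieldH :
    fderiv ℝ (fieldH ν) u v
      = (phaseVel ν u * fieldJ ν u - perI ν u) * fderiv ℝ (fieldK ν) u v
        + phaseVel ν u * fieldK ν u * fderiv ℝ (fieldJ ν) u v
        + (phaseVel ν u * fieldβ ν u - constB u) * fderiv ℝ (fieldβ ν) u v := by
  have hL := hasDerivAt_line (differentiableAt_of_contDiffOn (contDiffOn_reducedL ν) hu) v
  have h := (((line_phaseVel ν u v).mul (line_fieldK hu v)).mul (line_fieldJ hu v)).sub hL
  rw [(hasDerivAt_line (differentiableAt_of_contDiffOn (contDiffOn_fieldH ν) hu) v).unique h,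
    fderiv_reducedL hu, fderiv_phaseVel_mul_fieldK hu]
  simp
  ring

theorem fderiv_fieldCoords :
    fderiv ℝ (fieldCoords ν) u v
      = (fderiv ℝ (fieldK ν) u v, fderiv ℝ (fieldJ ν) u v, fderiv ℝ (fieldβ ν) u v) := by
  have hK := (differentiableAt_of_contDiffOn (contDiffOn_fieldK ν) hu).hasFDerivAt
  have hJ := (differentiableAt_of_contDiffOn (contDiffOn_fieldJ ν) hu).hasFDerivAt
  have hβ := (differentiableAt_of_contDiffOn (contDiffOn_fieldβ ν) hu).hasFDerivAt
  have h : HasFDerivAt (fieldCoords ν) _ u := hK.prodMk (hJ.prodMk hβ)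
  rw [h.fderiv]
  rfl

end Differentials

/-- The matrix with rows `1`, `-∂_i B`, `∂_i A` is a Vandermonde matrix up to row operations. -/
theorem eq_zero_of_moments (hu : u ∈ riemannDomain ν) {r : Fin 3 → ℝ} (h0 : r 0 + r 1 + r 2 = 0)
    (h1 : root u 0 * r 0 + root u 1 * r 1 + root u 2 * r 2 = 0)
    (h2 : gradA u 0 * r 0 + gradA u 1 * r 1 + gradA u 2 * r 2 = 0) (i : Fin 3) : r i = 0 := by
  obtain ⟨-, h01, h12⟩ := hu
  have hd01 : root u 0 - root u 1 ≠ 0 := by simp only [root]; intro h; linarith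
  have hd02 : root u 0 - root u 2 ≠ 0 := by simp only [root]; intro h; linarith
  have hd12 : root u 1 - root u 2 ≠ 0 := by simp only [root]; intro h; linarith
  have hsq : root u 0 ^ 2 * r 0 + root u 1 ^ 2 * r 1 + root u 2 ^ 2 * r 2 = 0 := by
    simp only [gradA] at h2
    linear_combination (root u 0 + root u 1 + root u 2) * h1
      - (root u 0 * root u 1 + root u 0 * root u 2 + root u 1 * root u 2) / 2 * h0 - h2
  have e0 : (root u 0 - root u 1) * (root u 0 - root u 2) * r 0 = 0 := by
    linear_combination hsq - (root u 1 + root u 2) * h1 + root u 1 * root u 2 * h0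
  have e1 : (root u 0 - root u 1) * (root u 1 - root u 2) * r 1 = 0 := by
    linear_combination -hsq + (root u 0 + root u 2) * h1 - root u 0 * root u 2 * h0
  have e2 : (root u 0 - root u 2) * (root u 1 - root u 2) * r 2 = 0 := by
    linear_combination hsq - (root u 0 + root u 1) * h1 + root u 0 * root u 1 * h0
  fin_cases i
  · exact (mul_eq_zero.1 e0).resolve_left (mul_ne_zero hd01 hd02)
  · exact (mul_eq_zero.1 e1).resolve_left (mul_ne_zero hd01 hd12)
  · exact (mul_eq_zero.1 e2).resolve_left (mul_ne_zero hd02 hd12)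

/-- A vector in the kernel is one on which the differentials of `X`, `Y` and `Z` vanish, to which
`eq_zero_of_moments` applies. -/
theorem fderiv_fieldCoords_injective (hu : u ∈ riemannDomain ν) :
    Function.Injective (fderiv ℝ (fieldCoords ν) u) := by
  rw [injective_iff_map_eq_zero]
  intro v hv
  have hX := (perX_pos hu).ne'
  rw [fderiv_fieldCoords hu, Prod.mk_eq_zero, Prod.mk_eq_zero, fderiv_fieldK hu, fderiv_fieldJ hu,
    fderiv_fieldβ hu] at hv
  obtain ⟨h1, h2, h3⟩ := hv
  have hX' : fderiv ℝ (perX ν) u v = 0 := by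
    rw [div_eq_zero_iff] at h1
    simpa [hX] using h1
  rw [hX'] at h2 h3
  have hY' : fderiv ℝ (perY ν) u v = 0 := by simpa [hX] using h3
  rw [hY'] at h2
  have hZ' : fderiv ℝ (perZ ν) u v = 0 := by simpa using h2
  have hr := eq_zero_of_moments hu (r := fun i => v i * fderiv ℝ (perX ν) u (Pi.single i 1))
    (by rw [← hX', fderiv_eq_sum (v := v)])
    (by
      rw [fderiv_eq_sum (v := v), fderiv_perY_single hu, fderiv_perY_single hu,
          fderiv_perY_single hu] at hY'
      linear_combination -hY')
    (by
      rw [fderiv_eq_sum (v := v), fderiv_perZ_single hu, fderiv_perZ_single hu,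
          fderiv_perZ_single hu] at hZ'
      linear_combination hZ')
  funext i
  exact (mul_eq_zero.1 (hr i)).resolve_right (fderiv_perX_single_ne_zero hu i)

/-- The differential of `(k, J, β)` as a linear isomorphism. -/
def fieldCoordsEquiv (hu : u ∈ riemannDomain ν) : (Fin 3 → ℝ) ≃L[ℝ] (ℝ × ℝ × ℝ) :=
  (LinearEquiv.ofInjectiveOfFinrankEq (fderiv ℝ (fieldCoords ν) u : (Fin 3 → ℝ) →ₗ[ℝ] ℝ × ℝ × ℝ)
    (fderiv_fieldCoords_injective hu) (by simp)).toContinuousLinearEquiv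

theorem coe_fieldCoordsEquiv (hu : u ∈ riemannDomain ν) :
    (fieldCoordsEquiv hu : (Fin 3 → ℝ) →L[ℝ] (ℝ × ℝ × ℝ)) = fderiv ℝ (fieldCoords ν) u := by
  ext v <;> rfl

theorem hasStrictFDerivAt_fieldCoords (hu : u ∈ riemannDomain ν) :
    HasStrictFDerivAt (fieldCoords ν)
      (fieldCoordsEquiv hu : (Fin 3 → ℝ) →L[ℝ] (ℝ × ℝ × ℝ)) u := by
  rw [coe_fieldCoordsEquiv]
  exact ((contDiffOn_fieldCoords ν).contDiffAt
    ((isOpen_riemannDomain ν).mem_nhds hu)).hasStrictFDerivAt (by simp)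

/-- The Hamiltonian density is locally a `C²` function of `(k, J, β)`. -/
theorem exists_local_hamiltonian (hu : u ∈ riemannDomain ν) :
    ∃ h : ℝ × ℝ × ℝ → ℝ, ContDiffAt ℝ 2 h (fieldCoords ν u) ∧
      ∀ᶠ u' in 𝓝 u, h (fieldCoords ν u') = fieldH ν u' := by
  have hmem := (isOpen_riemannDomain ν).mem_nhds hu
  have hc := (contDiffOn_fieldCoords ν).contDiffAt hmem
  have hs := hasStrictFDerivAt_fieldCoords hu
  have hleft : ∀ᶠ u' in 𝓝 u, hc.localInverse hs.hasFDerivAt (by simp) (fieldCoords ν u') = u' :=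
    HasStrictFDerivAt.eventually_left_inverse (hc.hasStrictFDerivAt' hs.hasFDerivAt (by simp))
  refine ⟨fieldH ν ∘ hc.localInverse hs.hasFDerivAt (by simp), ?_, ?_⟩
  · refine ContDiffAt.comp _ ?_ (hc.to_localInverse hs.hasFDerivAt (by simp))
    rw [hleft.self_of_nhds]
    exact (contDiffOn_fieldH ν).contDiffAt hmem
  · filter_upwards [hleft] with u' hu'
    simp only [Function.comp, hu']

/-- The derivatives `H_k = c J - I`, `H_J = ω`, `H_β = c β - B`. -/
theorem fderiv_local_hamiltonian (hu : u ∈ riemannDomain ν) {h : ℝ × ℝ × ℝ → ℝ}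
    (hd : DifferentiableAt ℝ h (fieldCoords ν u))
    (hh : ∀ᶠ u' in 𝓝 u, h (fieldCoords ν u') = fieldH ν u') (z : ℝ × ℝ × ℝ) :
    fderiv ℝ h (fieldCoords ν u) z = (phaseVel ν u * fieldJ ν u - perI ν u) * z.1
      + phaseVel ν u * fieldK ν u * z.2.1 + (phaseVel ν u * fieldβ ν u - constB u) * z.2.2 := by
  have hc := (hasStrictFDerivAt_fieldCoords hu).hasFDerivAt
  have h1 : HasFDerivAt (fieldH ν) _ u := (hd.hasFDerivAt.comp u hc).congr_of_eventuallyEq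
    (hh.mono fun u' h => h.symm)
  obtain ⟨v, rfl⟩ := (fieldCoordsEquiv hu).surjective z
  have h2 := fderiv_fieldH hu v
  rw [h1.fderiv] at h2
  have h3 : fieldCoordsEquiv hu v = _ := fderiv_fieldCoords hu v
  rw [h3]
  rw [coe_fieldCoordsEquiv] at h2
  simp only [ContinuousLinearMap.comp_apply, fderiv_fieldCoords hu] at h2
  exact h2

end Modulation

/-! ### The modulation equations in Riemann invariant form -/

noncomputable section Final

variable {ν : ℝ} {u : Fin 3 → ℝ}

/-- In the variables `X = 1 / k`, `Y = -β / k`, `Z = J + β ^ 2 / (2 k)` the modulation equations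
decouple: with `D = ∂_t + c ∂_x` they read `D X = X c_x`, `D Y = -X B_x`, `D Z = X A_x`, which are
combinations of the three expressions `X_i D uⁱ - X ∂_x uⁱ`. -/
theorem modulation_iff (hu : u ∈ riemannDomain ν) (a b : Fin 3 → ℝ) :
    (fderiv ℝ (fieldK ν) u a = -fderiv ℝ (fun u => phaseVel ν u * fieldK ν u) u b ∧
      fderiv ℝ (fieldJ ν) u a = -fderiv ℝ (fun u => phaseVel ν u * fieldJ ν u - perI ν u) u b ∧
      fderiv ℝ (fieldβ ν) u a = -fderiv ℝ (fun u => phaseVel ν u * fieldβ ν u - constB u) u b) ↔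
    ∀ i, a i + speed ν i u * b i = 0 := by
  have hX := (perX_pos hu).ne'
  set X := perX ν u with hXdef
  set r : Fin 3 → ℝ := fun i =>
    fderiv ℝ (perX ν) u (Pi.single i 1) * (a i + phaseVel ν u * b i) - X * b i with hr
  have hcJ : fderiv ℝ (fun u => phaseVel ν u * fieldJ ν u - perI ν u) u b
      = fderiv ℝ (phaseVel ν) u b * fieldJ ν u + phaseVel ν u * fderiv ℝ (fieldJ ν) u b
        - fderiv ℝ (perI ν) u b := by
    have hd : DifferentiableAt ℝ (fun u => phaseVel ν u * fieldJ ν u - perI ν u) u :=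
      differentiableAt_of_contDiffOn (((contDiff_phaseVel ν).contDiffOn.mul
        (contDiffOn_fieldJ ν)).sub (contDiffOn_perI ν)) hu
    rw [(hasDerivAt_line hd b).unique (((line_phaseVel ν u b).mul (line_fieldJ hu b)).sub
      (line_perI hu b))]
    simp
  have hcβ : fderiv ℝ (fun u => phaseVel ν u * fieldβ ν u - constB u) u b
      = fderiv ℝ (phaseVel ν) u b * fieldβ ν u + phaseVel ν u * fderiv ℝ (fieldβ ν) u b
        - fderiv ℝ constB u b := by
    have hB := (contDiff_constB (n := 1)).differentiable (by simp) u
    have hd : DifferentiableAt ℝ (fun u => phaseVel ν u * fieldβ ν u - constB u) u :=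
      differentiableAt_of_contDiffOn (((contDiff_phaseVel ν).contDiffOn.mul
        (contDiffOn_fieldβ ν)).sub contDiff_constB.contDiffOn) hu
    rw [(hasDerivAt_line hd b).unique (((line_phaseVel ν u b).mul (line_fieldβ hu b)).sub
      (hasDerivAt_line hB b))]
    simp
  -- `D X - X c_x`, `D Y + X B_x` and `D Z - X A_x` as combinations of the `r i`
  have hT1 : fderiv ℝ (perX ν) u a + phaseVel ν u * fderiv ℝ (perX ν) u b
      - X * fderiv ℝ (phaseVel ν) u b = r 0 + r 1 + r 2 := by
    rw [fderiv_eq_sum _ u a, fderiv_eq_sum (perX ν) u b, fderiv_phaseVel]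
    simp only [hr]
    ring
  have hT2 : fderiv ℝ (perY ν) u a + phaseVel ν u * fderiv ℝ (perY ν) u b
      + X * fderiv ℝ constB u b = -(root u 0 * r 0 + root u 1 * r 1 + root u 2 * r 2) := by
    rw [fderiv_eq_sum _ u a, fderiv_eq_sum (perY ν) u b, fderiv_constB, fderiv_perY_single hu,
      fderiv_perY_single hu, fderiv_perY_single hu]
    simp only [hr]
    ring
  have hT3 : fderiv ℝ (perZ ν) u a + phaseVel ν u * fderiv ℝ (perZ ν) u b
      - X * fderiv ℝ constA u b = gradA u 0 * r 0 + gradA u 1 * r 1 + gradA u 2 * r 2 := by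
    rw [fderiv_eq_sum _ u a, fderiv_eq_sum (perZ ν) u b, fderiv_constA, fderiv_perZ_single hu,
      fderiv_perZ_single hu, fderiv_perZ_single hu]
    simp only [hr]
    ring
  -- the modulation equations in terms of these
  have e1 : fderiv ℝ (fieldK ν) u a + fderiv ℝ (fun u => phaseVel ν u * fieldK ν u) u b
      = -(r 0 + r 1 + r 2) / X ^ 2 := by
    rw [← hT1, fderiv_phaseVel_mul_fieldK hu, fderiv_fieldK hu, fderiv_fieldK hu]
    simp only [fieldK, ← hXdef]
    field_simp
    ring
  have e3 : fderiv ℝ (fieldβ ν) u a + fderiv ℝ (fun u => phaseVel ν u * fieldβ ν u - constB u) u b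
      = (root u 0 * r 0 + root u 1 * r 1 + root u 2 * r 2) / X
        + perY ν u * (r 0 + r 1 + r 2) / X ^ 2 := by
    rw [← neg_neg (root u 0 * r 0 + root u 1 * r 1 + root u 2 * r 2), ← hT1, ← hT2, hcβ,
      fderiv_fieldβ hu, fderiv_fieldβ hu]
    simp only [fieldβ, ← hXdef]
    field_simp
    ring
  have e2 : fderiv ℝ (fieldJ ν) u a + fderiv ℝ (fun u => phaseVel ν u * fieldJ ν u - perI ν u) u b
      = gradA u 0 * r 0 + gradA u 1 * r 1 + gradA u 2 * r 2
        + perY ν u * (root u 0 * r 0 + root u 1 * r 1 + root u 2 * r 2) / X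
        + perY ν u ^ 2 * (r 0 + r 1 + r 2) / (2 * X ^ 2) := by
    rw [← neg_neg (root u 0 * r 0 + root u 1 * r 1 + root u 2 * r 2), ← hT1, ← hT2, ← hT3, hcJ,
      fderiv_fieldJ hu, fderiv_fieldJ hu, fderiv_perI_eq hu]
    simp only [fieldJ, ← hXdef]
    field_simp
    ring
  have hri : ∀ i, a i + speed ν i u * b i = 0 ↔ r i = 0 := fun i => by
    have hi := fderiv_perX_single_ne_zero hu i
    have : r i = fderiv ℝ (perX ν) u (Pi.single i 1) * (a i + speed ν i u * b i) := by
      rw [speed_eq hu, ← hXdef]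
      simp only [hr]
      field_simp
      ring
    rw [this, mul_eq_zero, or_iff_right hi]
  simp only [hri, eq_neg_iff_add_eq_zero, e1, e2, e3]
  constructor
  · rintro ⟨h1, h2, h3⟩
    have s0 : r 0 + r 1 + r 2 = 0 := by
      rw [div_eq_zero_iff] at h1
      linarith [h1.resolve_right (pow_ne_zero 2 hX)]
    rw [s0] at h2 h3
    have s1 : root u 0 * r 0 + root u 1 * r 1 + root u 2 * r 2 = 0 := by
      simpa [hX] using h3
    rw [s1] at h2
    exact eq_zero_of_moments hu s0 s1 (by simpa using h2)
  · intro h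
    simp [h]

/-- The passage from the roots to the Riemann invariants as a linear isomorphism. -/
def riemannEquiv : (Fin 3 → ℝ) ≃L[ℝ] (Fin 3 → ℝ) :=
  LinearEquiv.toContinuousLinearEquiv
    { toFun := riemann
      invFun := root
      map_add' := fun x y => by ext i; fin_cases i <;> simp [riemann] <;> ring
      map_smul' := fun a x => by ext i; fin_cases i <;> simp [riemann] <;> ring
      left_inv := fun e => funext (root_riemann e)
      right_inv := fun u => by ext i; fin_cases i <;> simp [riemann, root] <;> ring }

theorem coe_riemannEquiv : ⇑riemannEquiv = riemann := rfl

theorem hasFDerivAt_riemann (e : Fin 3 → ℝ) :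
    HasFDerivAt riemann (riemannEquiv : (Fin 3 → ℝ) →L[ℝ] (Fin 3 → ℝ)) e :=
  riemannEquiv.hasFDerivAt

theorem isOpen_rootDomain (ν : ℝ) : IsOpen (rootDomain ν) := by
  have h1 : IsOpen {e : Fin 3 → ℝ | e 2 < e 1} := isOpen_lt (by fun_prop) (by fun_prop)
  have h2 : IsOpen {e : Fin 3 → ℝ | e 1 < e 0} := isOpen_lt (by fun_prop) (by fun_prop)
  have h3 : IsOpen {e : Fin 3 → ℝ | e 0 < 2 * ν + (e 0 + e 1 + e 2)} :=
    isOpen_lt (by fun_prop) (by fun_prop)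
  exact h1.inter (h2.inter h3)

namespace IsOnePhaseWave

variable {e : Fin 3 → ℝ} {w : WaveData}

theorem k_eq (hw : IsOnePhaseWave ν e w) (he : e ∈ rootDomain ν) : w.k = fieldK ν (riemann e) :=
  eq_inv_of_mul_eq_one_left (hw.k_mul_perX he)

theorem β_eq_field (hw : IsOnePhaseWave ν e w) (he : e ∈ rootDomain ν) :
    w.β = fieldβ ν (riemann e) := by
  rw [hw.β_eq he, hw.k_eq he]
  unfold fieldβ fieldK
  rw [div_eq_mul_inv]
  ring

theorem J_eq (hw : IsOnePhaseWave ν e w) (he : e ∈ rootDomain ν) :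
    w.avgL_ω ν = fieldJ ν (riemann e) := by
  have h1 := hw.perZ_eq he
  have h2 := hw.β_eq he
  have h3 := hw.k_mul_perX he
  have hk := hw.k_pos.ne'
  have hX := (perX_pos (riemann_mem he)).ne'
  have h4 : perY ν (riemann e) ^ 2 / (2 * perX ν (riemann e)) = w.k * perY ν (riemann e) ^ 2
      / 2 := by
    field_simp
    linear_combination -(perY ν (riemann e)) ^ 2 * h3
  rw [hw.avgL_ω_eq]
  unfold fieldJ
  rw [h4]
  rw [h2] at h1
  apply mul_left_cancel₀ hk
  linear_combination -(1 / 2) * h1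

theorem coords_eq (hw : IsOnePhaseWave ν e w) (he : e ∈ rootDomain ν) :
    w.coords ν = fieldCoords ν (riemann e) := by
  unfold WaveData.coords fieldCoords
  rw [hw.J_eq he, ← hw.k_eq he, ← hw.β_eq_field he]

theorem avgL_eq_reducedL (hw : IsOnePhaseWave ν e w) (he : e ∈ rootDomain ν) :
    w.avgL ν = w.γ * fieldβ ν (riemann e) / 2 + reducedL ν (riemann e) := by
  rw [hw.avgL_eq he, hw.β_eq_field he, hw.k_eq he]
  simp only [reducedL, constA, constB, root_riemann]
  ring

theorem hamiltonian_eq (hw : IsOnePhaseWave ν e w) (he : e ∈ rootDomain ν) :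
    w.hamiltonian ν = fieldH ν (riemann e) := by
  unfold WaveData.hamiltonian fieldH
  rw [hw.avgL_eq_reducedL he, hw.avgL_γ_eq, hw.J_eq he, hw.ω_eq, hw.k_eq he, hw.β_eq_field he]
  ring

end IsOnePhaseWave

section Family

variable {W : (Fin 3 → ℝ) → WaveData} {e : Fin 3 → ℝ}

theorem isLocalHamiltonian_iff (hW : ∀ e ∈ rootDomain ν, IsOnePhaseWave ν e (W e))
    (he : e ∈ rootDomain ν) (h : ℝ × ℝ × ℝ → ℝ) :
    IsLocalHamiltonian ν W e h ↔ ContDiffAt ℝ 2 h (fieldCoords ν (riemann e)) ∧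
      ∀ᶠ u in 𝓝 (riemann e), h (fieldCoords ν u) = fieldH ν u := by
  unfold IsLocalHamiltonian
  rw [(hW e he).coords_eq he, ← coe_riemannEquiv, ← riemannEquiv.map_nhds_eq, eventually_map]
  refine and_congr_right fun _ => eventually_congr ?_
  filter_upwards [(isOpen_rootDomain ν).mem_nhds he] with e' he'
  rw [(hW e' he').coords_eq he', (hW e' he').hamiltonian_eq he', coe_riemannEquiv]

theorem IsLocalHamiltonian.eventually_fderiv (hW : ∀ e ∈ rootDomain ν, IsOnePhaseWave ν e (W e))
    (he : e ∈ rootDomain ν) {h : ℝ × ℝ × ℝ → ℝ} (hh : IsLocalHamiltonian ν W e h) :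
    ∀ᶠ e' in 𝓝 e, ∀ z, fderiv ℝ h ((W e').coords ν) z
      = (phaseVel ν (riemann e') * fieldJ ν (riemann e') - perI ν (riemann e')) * z.1
        + phaseVel ν (riemann e') * fieldK ν (riemann e') * z.2.1
        + (phaseVel ν (riemann e') * fieldβ ν (riemann e') - constB (riemann e')) * z.2.2 := by
  obtain ⟨h1, h2⟩ := (isLocalHamiltonian_iff hW he h).1 hh
  have hu := riemann_mem he
  have hc : ContinuousAt (fieldCoords ν) (riemann e) :=
    (differentiableAt_of_contDiffOn (contDiffOn_fieldCoords ν) hu).continuousAt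
  have h3 := hc.eventually (h1.eventually (by simp))
  have hr : ContinuousAt riemann e := (hasFDerivAt_riemann e).continuousAt
  filter_upwards [hr.eventually (h3.and h2.eventually_nhds), (isOpen_rootDomain ν).mem_nhds he]
    with e' he1 he2 z
  rw [(hW e' he2).coords_eq he2]
  exact fderiv_local_hamiltonian (riemann_mem he2) (he1.1.differentiableAt (by simp)) he1.2 z

theorem hasFDerivAt_comp_riemann {f : (Fin 3 → ℝ) → ℝ} {g : (Fin 3 → ℝ) → ℝ}
    (hf : DifferentiableAt ℝ f (riemann e)) (hg : g =ᶠ[𝓝 e] fun e' => f (riemann e')) :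
    HasFDerivAt g ((fderiv ℝ f (riemann e)).comp
      (riemannEquiv : (Fin 3 → ℝ) →L[ℝ] (Fin 3 → ℝ))) e :=
  (hf.hasFDerivAt.comp e (hasFDerivAt_riemann e)).congr_of_eventuallyEq hg

/-- The differential of the averaged Lagrangian along a family of waves: the profile, being a
critical point, does not contribute. -/
theorem hasFDerivAt_avgL (hW : ∀ e ∈ rootDomain ν, IsOnePhaseWave ν e (W e))
    (he : e ∈ rootDomain ν) (hγ : DifferentiableAt ℝ (fun e' => (W e').γ) e) :
    HasFDerivAt (fun e' => (W e').avgL ν)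
      ((W e).avgL_k ν • fderiv ℝ (fun e' => (W e').k) e
        + (W e).avgL_ω ν • fderiv ℝ (fun e' => (W e').ω) e
        + (W e).avgL_β ν • fderiv ℝ (fun e' => (W e').β) e
        + (W e).avgL_γ ν • fderiv ℝ (fun e' => (W e').γ) e) e := by
  have hu := riemann_mem he
  have hmem := (isOpen_rootDomain ν).mem_nhds he
  have hev : ∀ {f g : (Fin 3 → ℝ) → ℝ}, (∀ e' ∈ rootDomain ν, f e' = g e') → f =ᶠ[𝓝 e] g :=
    fun h => by filter_upwards [hmem] with e' he' using h e' he'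
  have hK := hasFDerivAt_comp_riemann (g := fun e' => (W e').k)
    (differentiableAt_of_contDiffOn (contDiffOn_fieldK ν) hu)
    (hev fun e' he' => (hW e' he').k_eq he')
  have hβ := hasFDerivAt_comp_riemann (g := fun e' => (W e').β)
    (differentiableAt_of_contDiffOn (contDiffOn_fieldβ ν) hu)
    (hev fun e' he' => (hW e' he').β_eq_field he')
  have hω := hasFDerivAt_comp_riemann (g := fun e' => (W e').ω)
    (f := fun u => phaseVel ν u * fieldK ν u)
    (differentiableAt_of_contDiffOn ((contDiff_phaseVel ν).contDiffOn.mul (contDiffOn_fieldK ν)) hu)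
    (hev fun e' he' => by rw [(hW e' he').ω_eq, (hW e' he').k_eq he'])
  have hL := hasFDerivAt_comp_riemann (g := fun e' => reducedL ν (riemann e'))
    (differentiableAt_of_contDiffOn (contDiffOn_reducedL ν) hu) EventuallyEq.rfl
  have hmain : HasFDerivAt (fun e' => (1 / 2 : ℝ) * ((W e').γ * (W e').β) + reducedL ν (riemann e'))
    _ e := ((hγ.hasFDerivAt.mul hβ).const_mul (1 / 2)).add hL
  refine (hmain.congr_of_eventuallyEq (hev fun e' he' => ?_)).congr_fderiv ?_
  · rw [(hW e' he').avgL_eq_reducedL he', (hW e' he').β_eq_field he']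
    ring
  · rw [hK.fderiv, hω.fderiv, hβ.fderiv, (hW e he).avgL_k_eq he, (hW e he).avgL_β_eq,
      (hW e he).avgL_γ_eq, (hW e he).J_eq he, (hW e he).β_eq_field he]
    ext v
    simp only [add_apply, smul_apply,
      ContinuousLinearMap.comp_apply, smul_eq_mul, fderiv_reducedL hu, constB, root_riemann]
    ring

theorem coords_localDiffeo (hW : ∀ e ∈ rootDomain ν, IsOnePhaseWave ν e (W e))
    (he : e ∈ rootDomain ν) : ∃ D : (Fin 3 → ℝ) ≃L[ℝ] (ℝ × ℝ × ℝ),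
      HasStrictFDerivAt (fun e' => (W e').coords ν) (D : (Fin 3 → ℝ) →L[ℝ] (ℝ × ℝ × ℝ)) e := by
  refine ⟨riemannEquiv.trans (fieldCoordsEquiv (riemann_mem he)), ?_⟩
  have h := (hasStrictFDerivAt_fieldCoords (riemann_mem he)).comp e
    (riemannEquiv.hasStrictFDerivAt (x := e))
  refine h.congr_of_eventuallyEq ?_
  filter_upwards [(isOpen_rootDomain ν).mem_nhds he] with e' he'
  exact ((hW e' he').coords_eq he').symm

end Family

theorem dT_congr {f g : ℝ × ℝ → ℝ} {p : ℝ × ℝ} (h : f =ᶠ[𝓝 p] g) : dT f p = dT g p := by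
  have hc : ContinuousAt (fun t : ℝ => (p.1, t)) p.2 := by fun_prop
  exact EventuallyEq.deriv_eq (hc.eventually h)

theorem dX_congr {f g : ℝ × ℝ → ℝ} {p : ℝ × ℝ} (h : f =ᶠ[𝓝 p] g) : dX f p = dX g p := by
  have hc : ContinuousAt (fun x : ℝ => (x, p.2)) p.1 := by fun_prop
  exact EventuallyEq.deriv_eq (hc.eventually h)

theorem dT_comp {f : (Fin 3 → ℝ) → ℝ} {U : ℝ × ℝ → Fin 3 → ℝ} {p : ℝ × ℝ}
    (hf : DifferentiableAt ℝ f (U p)) (hU : DifferentiableAt ℝ U p) :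
    dT (fun q => f (U q)) p = fderiv ℝ f (U p) fun i => dT (fun q => U q i) p := by
  have h1 : HasDerivAt (fun t : ℝ => (p.1, t)) ((0 : ℝ), (1 : ℝ)) p.2 :=
    (hasDerivAt_const p.2 p.1).prodMk (hasDerivAt_id p.2)
  have h2 : HasDerivAt (fun t => U (p.1, t)) (fderiv ℝ U p (0, 1)) p.2 :=
    HasFDerivAt.comp_hasDerivAt (l := U) p.2 hU.hasFDerivAt h1
  have h3 : (fun i => dT (fun q => U q i) p) = fderiv ℝ U p (0, 1) :=
    funext fun i => (hasDerivAt_pi.1 h2 i).deriv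
  rw [h3]
  exact (HasFDerivAt.comp_hasDerivAt (l := f) p.2 hf.hasFDerivAt h2).deriv

theorem dX_comp {f : (Fin 3 → ℝ) → ℝ} {U : ℝ × ℝ → Fin 3 → ℝ} {p : ℝ × ℝ}
    (hf : DifferentiableAt ℝ f (U p)) (hU : DifferentiableAt ℝ U p) :
    dX (fun q => f (U q)) p = fderiv ℝ f (U p) fun i => dX (fun q => U q i) p := by
  have h1 : HasDerivAt (fun x : ℝ => (x, p.2)) ((1 : ℝ), (0 : ℝ)) p.1 :=
    (hasDerivAt_id p.1).prodMk (hasDerivAt_const p.1 p.2)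
  have h2 : HasDerivAt (fun x => U (x, p.2)) (fderiv ℝ U p (1, 0)) p.1 :=
    HasFDerivAt.comp_hasDerivAt (l := U) p.1 hU.hasFDerivAt h1
  have h3 : (fun i => dX (fun q => U q i) p) = fderiv ℝ U p (1, 0) :=
    funext fun i => (hasDerivAt_pi.1 h2 i).deriv
  rw [h3]
  exact (HasFDerivAt.comp_hasDerivAt (l := f) p.1 hf.hasFDerivAt h2).deriv

/-- Whichever local Hamiltonian is chosen, the modulation equations at a point are the three
conservation laws with fluxes `ω`, `c J - I` and `c β - B`. -/
theorem modulation_at_iff {W : (Fin 3 → ℝ) → WaveData}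
    (hW : ∀ e ∈ rootDomain ν, IsOnePhaseWave ν e (W e)) {e : ℝ × ℝ → Fin 3 → ℝ} {p : ℝ × ℝ}
    (hd : DifferentiableAt ℝ e p) (he : e p ∈ rootDomain ν) {h : ℝ × ℝ × ℝ → ℝ}
    (hh : IsLocalHamiltonian ν W (e p) h) :
    (dT (fun q => (W (e q)).k) p = -dX (fun q => fderiv ℝ h ((W (e q)).coords ν) (0, 1, 0)) p ∧
      dT (fun q => (W (e q)).avgL_ω ν) p
        = -dX (fun q => fderiv ℝ h ((W (e q)).coords ν) (1, 0, 0)) p ∧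
      dT (fun q => (W (e q)).β) p
        = -dX (fun q => fderiv ℝ h ((W (e q)).coords ν) (0, 0, 1)) p) ↔
    ∀ i : Fin 3, dT (fun q => riemann (e q) i) p
      + speed ν i (riemann (e p)) * dX (fun q => riemann (e q) i) p = 0 := by
  have hu := riemann_mem he
  have hU : DifferentiableAt ℝ (fun q => riemann (e q)) p :=
    (hasFDerivAt_riemann (e p)).differentiableAt.comp p hd
  have hdom : ∀ᶠ q in 𝓝 p, e q ∈ rootDomain ν :=
    hd.continuousAt.eventually ((isOpen_rootDomain ν).mem_nhds he)
  have hf := hd.continuousAt.eventually (hh.eventually_fderiv hW he)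
  have dK := differentiableAt_of_contDiffOn (contDiffOn_fieldK ν) hu
  have dJ := differentiableAt_of_contDiffOn (contDiffOn_fieldJ ν) hu
  have dβ := differentiableAt_of_contDiffOn (contDiffOn_fieldβ ν) hu
  have dω : DifferentiableAt ℝ (fun u => phaseVel ν u * fieldK ν u) (riemann (e p)) :=
    differentiableAt_of_contDiffOn ((contDiff_phaseVel ν).contDiffOn.mul (contDiffOn_fieldK ν)) hu
  have dcJ : DifferentiableAt ℝ (fun u => phaseVel ν u * fieldJ ν u - perI ν u) (riemann (e p)) :=
    differentiableAt_of_contDiffOn (((contDiff_phaseVel ν).contDiffOn.mul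
      (contDiffOn_fieldJ ν)).sub (contDiffOn_perI ν)) hu
  have dcβ : DifferentiableAt ℝ (fun u => phaseVel ν u * fieldβ ν u - constB u) (riemann (e p)) :=
    differentiableAt_of_contDiffOn (((contDiff_phaseVel ν).contDiffOn.mul
      (contDiffOn_fieldβ ν)).sub contDiff_constB.contDiffOn) hu
  rw [← modulation_iff hu, ← dT_comp (U := fun q => riemann (e q)) dK hU,
    ← dT_comp (U := fun q => riemann (e q)) dJ hU, ← dT_comp (U := fun q => riemann (e q)) dβ hU,
    ← dX_comp (U := fun q => riemann (e q)) dω hU, ← dX_comp (U := fun q => riemann (e q)) dcJ hU,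
    ← dX_comp (U := fun q => riemann (e q)) dcβ hU]
  rw [dT_congr (hdom.mono fun q hq => (hW _ hq).k_eq hq),
    dT_congr (hdom.mono fun q hq => (hW _ hq).J_eq hq),
    dT_congr (hdom.mono fun q hq => (hW _ hq).β_eq_field hq),
    dX_congr (g := fun q => phaseVel ν (riemann (e q)) * fieldK ν (riemann (e q)))
      (hf.mono fun q hq => (hq (0, 1, 0)).trans (by simp only [mul_zero, mul_one, zero_add,
          add_zero])),
    dX_congr (g := fun q => phaseVel ν (riemann (e q)) * fieldJ ν (riemann (e q))
        - perI ν (riemann (e q)))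
      (hf.mono fun q hq => (hq (1, 0, 0)).trans (by simp only [mul_zero, mul_one, add_zero])),
    dX_congr (g := fun q => phaseVel ν (riemann (e q)) * fieldβ ν (riemann (e q))
        - constB (riemann (e q)))
      (hf.mono fun q hq => (hq (0, 0, 1)).trans (by simp only [mul_zero, mul_one, zero_add]))]

end Final

end CamassaHolm

open CamassaHolm

theorem theorem1 (ν : ℝ) :
    -- a one-phase wave exists for all admissible roots and all `γ`
    (∀ e ∈ rootDomain ν, ∀ γ : ℝ, ∃ w : WaveData, w.γ = γ ∧ IsOnePhaseWave ν e w) ∧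
    -- the speeds are well defined
    (∀ u ∈ riemannDomain ν, DifferentiableAt ℝ (waveNumber ν) u ∧
      DifferentiableAt ℝ (frequency ν) u ∧ ∀ i, pd i (waveNumber ν) u ≠ 0) ∧
    -- for every choice of a one-phase wave for each triple of admissible roots:
    ∀ W : (Fin 3 → ℝ) → WaveData, (∀ e ∈ rootDomain ν, IsOnePhaseWave ν e (W e)) →
      (∀ e ∈ rootDomain ν,
        -- wave number and frequency are the Abelian integrals
        riemann e ∈ riemannDomain ν ∧
        (W e).k = waveNumber ν (riemann e) ∧
        (W e).ω = frequency ν (riemann e) ∧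
        -- the differential of the averaged Lagrangian of the waves is
        -- `L̄_k dk + L̄_ω dω + L̄_β dβ + L̄_γ dγ`
        (DifferentiableAt ℝ (fun e' => (W e').γ) e →
          HasFDerivAt (fun e' => (W e').avgL ν)
            ((W e).avgL_k ν • fderiv ℝ (fun e' => (W e').k) e
              + (W e).avgL_ω ν • fderiv ℝ (fun e' => (W e').ω) e
              + (W e).avgL_β ν • fderiv ℝ (fun e' => (W e').β) e
              + (W e).avgL_γ ν • fderiv ℝ (fun e' => (W e').γ) e) e) ∧
        -- `(k, J, β)` are local coordinates, and the Hamiltonian is a function of them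
        (∃ D : (Fin 3 → ℝ) ≃L[ℝ] (ℝ × ℝ × ℝ),
          HasStrictFDerivAt (fun e' => (W e').coords ν) (D : (Fin 3 → ℝ) →L[ℝ] (ℝ × ℝ × ℝ)) e) ∧
        (∃ h : ℝ × ℝ × ℝ → ℝ, IsLocalHamiltonian ν W e h)) ∧
      -- the modulation equations are equivalent to the equations in Riemann invariant form
      (∀ (Ω : Set (ℝ × ℝ)) (e : ℝ × ℝ → Fin 3 → ℝ), IsOpen Ω → DifferentiableOn ℝ e Ω →
        (∀ p ∈ Ω, e p ∈ rootDomain ν) →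
        (SatisfiesModulation ν W Ω e ↔
          ∀ p ∈ Ω, ∀ i : Fin 3,
            dT (fun q => riemann (e q) i) p
              + speed ν i (riemann (e p)) * dX (fun q => riemann (e q) i) p = 0)) := by
  refine ⟨fun e he γ => ?_, fun u hu => ⟨(hasFDerivAt_waveNumber hu).differentiableAt,
    (hasFDerivAt_frequency hu).differentiableAt, pd_waveNumber_ne_zero hu⟩, fun W hW => ?_⟩
  · exact exists_onePhaseWave he γ
  have hham : ∀ e ∈ rootDomain ν, ∃ h, IsLocalHamiltonian ν W e h := fun e he => by
    obtain ⟨h, hh⟩ := exists_local_hamiltonian (riemann_mem he)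
    exact ⟨h, (isLocalHamiltonian_iff hW he h).2 hh⟩
  have hk : ∀ e ∈ rootDomain ν, (W e).k = waveNumber ν (riemann e) := fun e he => by
    rw [(hW e he).k_eq he, waveNumber_eq (riemann_mem he), fieldK]
  refine ⟨fun e he => ⟨riemann_mem he, hk e he, ?_, hasFDerivAt_avgL hW he,
    coords_localDiffeo hW he, hham e he⟩, fun Ω e hΩ hd hdom => ?_⟩
  · rw [(hW e he).ω_eq, hk e he]
    rfl
  · have hdp : ∀ p ∈ Ω, DifferentiableAt ℝ e p := fun p hp => hd.differentiableAt (hΩ.mem_nhds hp)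
    refine forall₂_congr fun p hp => ⟨fun ⟨h, hh, hm⟩ => ?_, fun hp' => ?_⟩
    · exact (modulation_at_iff hW (hdp p hp) (hdom p hp) hh).1 hm
    · obtain ⟨h, hh⟩ := hham (e p) (hdom p hp)
      exact ⟨h, hh, (modulation_at_iff hW (hdp p hp) (hdom p hp) hh).2 hp'⟩
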